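/- Let $\mu$ be a locally finite Borel measure on $\mathbb{R}^d$ (for instance Lebesgue measure). Let $K:\mathbb{R}^d\times\mathbb{R}^d\to[0,\infty)$ be a bounded, measurable, symmetric kernel whose integral operator $\mathcal{K}f(x)=\int K(x,y)f(y)\,d\mu(y)$ on $L^2(\mu)$ is bounded with spectrum contained in $[0,M]$, where $0<M<1$. Put $\|K\|_\infty=\sup_{x,y}|K(x,y)|$. Let $X$ be a determinantal point process with kernel $K$ with respect to $\mu$, that is, a simple point process with $n$-th order intensity functions $\rho_n(x_1,\dots,x_n)=\det\big(K(x_i,x_j)\big)_{1\le i,j\le n}$, $n\ge1$: $\rho_n\ge 0$ $\mu^n$-almost everywhere and $\mathbb{E}\sum^{\neq}_{x_1,\dots,x_n\in X}f(x_1,\dots,x_n)=\int f\rho_n\,d\mu^n$ for all measurable $f\ge0$, the sum being over $n$-tuples of pairwise distinct points. For two sub-$\sigma$-algebras $\mathscr{A},\mathscr{B}$ let $\beta(\mathscr{A},\mathscr{B})=\frac12\sup\sum_{i,j}|\mathbb{P}(A_i\cap B_j)-\mathbb{P}(A_i)\mathbb{P}(B_j)|$, the supremum being over all finite partitions $(A_i)$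 of the probability space in $\mathscr{A}$ and $(B_j)$ in $\mathscr{B}$. For $A\subset\mathbb{R}^d$ let $\mathcal{E}(A)$ be the $\sigma$-algebra generated by $X\cap A$, and set $$\beta_{p,q}(r)=\sup\beta(\mathcal{E}(A),\mathcal{E}(B)),\qquad S_{p,q}(r)=\sup\int_{A\times B}|K(x,y)|^2\,d\mu(x)\,d\mu(y),$$ both suprema being over all bounded Borel sets $A,B$ with $\mu(A)\le p$, $\mu(B)\le q$ and $\operatorname{dist}(A,B)>r$ (the distance to the empty set being $+\infty$). Then, for all $p,q,r>0$, $$2(1-M)^{\frac{(p+q)\|K\|_\infty}{M}}\,S_{p,q}(r)\;\le\;\beta_{p,q}(r)\;\le\;4(1+2p\|K\|_\infty)(1+2q\|K\|_\infty)e^{2(p+q)\|K\|_\infty}\,S_{p,q}(r).$$ If moreover $\mu(\{x\})=0$ for every $x$ (for instance if $\mu$ is Lebesgue measure), both inequalities also hold with $S_{p,q}(r)$ replaced by the supremum of the same integrals over the bounded Borel sets $A,B$ with $\mu(A)<p$, $\mu(B)<q$ and $\operatorname{dist}(A,B)>r$. -/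

import Mathlib

open MeasureTheory
open scoped ENNReal

noncomputable section

namespace DPPMixing

/-- A finite partition of the whole space into (possibly empty) sets of the `σ`-algebra `𝒜`. -/
def IsFinitePartition {Ω : Type*} (𝒜 : MeasurableSpace Ω) {m : ℕ} (A : Fin m → Set Ω) : Prop :=
  (∀ i, MeasurableSet[𝒜] (A i)) ∧ Pairwise (Function.onFun Disjoint A) ∧ ⋃ i, A i = Set.univ

/-- The `β`-mixing coefficient of two sub-`σ`-algebras `𝒜`, `ℬ`: half of the supremum, over all
finite partitions `(A i)` in `𝒜` and `(B j)` in `ℬ`, of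
`∑ i j, |P (A i ∩ B j) - P (A i) P (B j)|`. -/
def betaCoeff {Ω : Type*} [MeasurableSpace Ω] (P : Measure Ω) (𝒜 ℬ : MeasurableSpace Ω) : ℝ≥0∞ :=
  2⁻¹ * ⨆ (m : ℕ) (n : ℕ) (A : Fin m → Set Ω) (B : Fin n → Set Ω)
    (_ : IsFinitePartition 𝒜 A) (_ : IsFinitePartition ℬ B),
      ∑ i, ∑ j, ENNReal.ofReal |P.real (A i ∩ B j) - P.real (A i) * P.real (B j)|

section PointProcess

variable {d : ℕ} {Ω : Type*}

/-- The `σ`-algebra on point configurations generated by the counting maps `s ↦ |s ∩ B|`,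
`B` bounded Borel. -/
abbrev configSpace (d : ℕ) : MeasurableSpace (Set (EuclideanSpace ℝ (Fin d))) :=
  ⨆ (B : Set (EuclideanSpace ℝ (Fin d))) (_ : Bornology.IsBounded B) (_ : MeasurableSet B),
    MeasurableSpace.comap (fun s => (s ∩ B).encard) ⊤

/-- A simple point process on `ℝᵈ`: a random locally finite set of points, i.e. a measurable map
into the locally finite configurations. -/
structure IsSimplePointProcess [MeasurableSpace Ω]
    (X : Ω → Set (EuclideanSpace ℝ (Fin d))) : Prop where
  locallyFinite : ∀ ω, ∀ B : Set (EuclideanSpace ℝ (Fin d)),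
    Bornology.IsBounded B → (X ω ∩ B).Finite
  measurable : @Measurable Ω (Set (EuclideanSpace ℝ (Fin d))) _ (configSpace d) X

/-- `∑^{≠}_{x₁, …, xₙ ∈ s} f (x₁, …, xₙ)`, the sum over `n`-tuples of pairwise distinct points. -/
def sumDistinct {n : ℕ} (s : Set (EuclideanSpace ℝ (Fin d)))
    (f : (Fin n → EuclideanSpace ℝ (Fin d)) → ℝ≥0∞) : ℝ≥0∞ :=
  ∑' x : {x : Fin n → EuclideanSpace ℝ (Fin d) // Function.Injective x ∧ ∀ i, x i ∈ s}, f x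

/-- `ρ` is an `n`-th order intensity function of `X` with respect to `μ`: it is non-negative
(almost everywhere) and `E ∑^{≠} f (x₁, …, xₙ) = ∫ f ρ dμⁿ` for all measurable `f ≥ 0`. -/
def IsIntensity [MeasurableSpace Ω] (P : Measure Ω)
    (X : Ω → Set (EuclideanSpace ℝ (Fin d))) (μ : Measure (EuclideanSpace ℝ (Fin d)))
    (n : ℕ) (ρ : (Fin n → EuclideanSpace ℝ (Fin d)) → ℝ) : Prop :=
  (∀ᵐ x ∂(Measure.pi fun _ : Fin n => μ), 0 ≤ ρ x) ∧
  ∀ f : (Fin n → EuclideanSpace ℝ (Fin d)) → ℝ≥0∞, Measurable f →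
    ∫⁻ ω, sumDistinct (X ω) f ∂P =
      ∫⁻ x, f x * ENNReal.ofReal (ρ x) ∂(Measure.pi fun _ : Fin n => μ)

/-- `X` is a determinantal point process with kernel `K` with respect to `μ`:
`ρₙ (x₁, …, xₙ) = det (K (xᵢ, xⱼ))` for all `n ≥ 1`. -/
def IsDPP [MeasurableSpace Ω] (P : Measure Ω)
    (X : Ω → Set (EuclideanSpace ℝ (Fin d))) (μ : Measure (EuclideanSpace ℝ (Fin d)))
    (K : EuclideanSpace ℝ (Fin d) → EuclideanSpace ℝ (Fin d) → ℝ) : Prop :=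
  IsSimplePointProcess X ∧
  ∀ n : ℕ, 1 ≤ n →
    IsIntensity P X μ n fun x => (Matrix.of fun i j : Fin n => K (x i) (x j)).det

/-- The `σ`-algebra `ℰ(A)` generated by `X ∩ A`. -/
abbrev sigmaOn (X : Ω → Set (EuclideanSpace ℝ (Fin d))) (A : Set (EuclideanSpace ℝ (Fin d))) :
    MeasurableSpace Ω :=
  MeasurableSpace.comap (fun ω => X ω ∩ A) (configSpace d)

/-- `dist (A, B) = inf {‖y - x‖ : x ∈ A, y ∈ B}`, equal to `∞` if one of the sets is empty. -/
def setDist (A B : Set (EuclideanSpace ℝ (Fin d))) : ℝ≥0∞ :=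
  ⨅ (x ∈ A) (y ∈ B), edist x y

/-- Bounded Borel sets `A`, `B` with `μ A ≤ p`, `μ B ≤ q` and `dist (A, B) > r`. -/
structure Admissible (μ : Measure (EuclideanSpace ℝ (Fin d))) (p q r : ℝ)
    (A B : Set (EuclideanSpace ℝ (Fin d))) : Prop where
  bounded_left : Bornology.IsBounded A
  bounded_right : Bornology.IsBounded B
  measurable_left : MeasurableSet A
  measurable_right : MeasurableSet B
  volume_left : μ A ≤ ENNReal.ofReal p
  volume_right : μ B ≤ ENNReal.ofReal q
  dist_gt : ENNReal.ofReal r < setDist A B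

/-- The `β`-mixing coefficient `β_{p,q}(r)` of the point process `X`. -/
def betaMixing [MeasurableSpace Ω] (P : Measure Ω)
    (X : Ω → Set (EuclideanSpace ℝ (Fin d))) (μ : Measure (EuclideanSpace ℝ (Fin d)))
    (p q r : ℝ) : ℝ≥0∞ :=
  ⨆ (A : Set (EuclideanSpace ℝ (Fin d))) (B : Set (EuclideanSpace ℝ (Fin d)))
    (_ : Admissible μ p q r A B), betaCoeff P (sigmaOn X A) (sigmaOn X B)

/-- The integral of `|K|²` over `A × B`. -/
def kernelMass (μ : Measure (EuclideanSpace ℝ (Fin d)))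
    (K : EuclideanSpace ℝ (Fin d) → EuclideanSpace ℝ (Fin d) → ℝ)
    (A B : Set (EuclideanSpace ℝ (Fin d))) : ℝ≥0∞ :=
  ∫⁻ z in A ×ˢ B, ENNReal.ofReal (|K z.1 z.2| ^ 2) ∂(μ.prod μ)

/-- Supremum of the integral of `|K|²` over `A × B`, where `μ A ≤ p`, `μ B ≤ q`,
`dist (A, B) > r`. -/
def supMass (μ : Measure (EuclideanSpace ℝ (Fin d)))
    (K : EuclideanSpace ℝ (Fin d) → EuclideanSpace ℝ (Fin d) → ℝ) (p q r : ℝ) : ℝ≥0∞ :=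
  ⨆ (A : Set (EuclideanSpace ℝ (Fin d))) (B : Set (EuclideanSpace ℝ (Fin d)))
    (_ : Admissible μ p q r A B), kernelMass μ K A B

/-- Supremum of the integral of `|K|²` over `A × B`, where `μ A < p`, `μ B < q`,
`dist (A, B) > r`. -/
def supMassStrict (μ : Measure (EuclideanSpace ℝ (Fin d)))
    (K : EuclideanSpace ℝ (Fin d) → EuclideanSpace ℝ (Fin d) → ℝ) (p q r : ℝ) : ℝ≥0∞ :=
  ⨆ (A : Set (EuclideanSpace ℝ (Fin d))) (B : Set (EuclideanSpace ℝ (Fin d)))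
    (_ : Admissible μ p q r A B) (_ : μ A < ENNReal.ofReal p) (_ : μ B < ENNReal.ofReal q),
      kernelMass μ K A B

/-- The uniform norm of the kernel. -/
def supNorm (K : EuclideanSpace ℝ (Fin d) → EuclideanSpace ℝ (Fin d) → ℝ) : ℝ :=
  ⨆ z : EuclideanSpace ℝ (Fin d) × EuclideanSpace ℝ (Fin d), |K z.1 z.2|

/-- `T` is the integral operator `f ↦ ∫ K (·, y) f y dμ(y)` on `L²(μ)`. -/
def IsIntegralOperator (μ : Measure (EuclideanSpace ℝ (Fin d)))
    (K : EuclideanSpace ℝ (Fin d) → EuclideanSpace ℝ (Fin d) → ℝ)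
    (T : Lp ℝ 2 μ →L[ℝ] Lp ℝ 2 μ) : Prop :=
  ∀ f : Lp ℝ 2 μ, ∀ᵐ x ∂μ,
    Integrable (fun y => K x y * f y) μ ∧ T f x = ∫ y, K x y * f y ∂μ

end PointProcess

end DPPMixing

end

/-!
Both bounds rest on expansions of probabilities in the intensities `det (K (x i) (x j))`. A function
`f` of the finite configuration `X ∩ A` is the sum of its Möbius transform over all `n`-tuples of
distinct points, with weights `1 / n!`, so `E f (X ∩ A)` is a series of integrals of the transform against the intensities
(`hasSum_integral`), and the covariance of `f (X ∩ A)` and `g (X ∩ B)`, for disjoint `A` and `B`, is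
the corresponding series with the intensity replaced by
`det K(x, y) - det K(x) * det K(y)` (`hasSum_covariance`).

*Upper bound.* All principal minors of `(K (x i) (x j))` are intensities, so this matrix is positive
semidefinite for almost every tuple (`ae_posSemidef_kernelMatrix`). Fischer's inequality with a
remainder (`PosSemidef.det_mul_det_sub_det_fromBlocks`) bounds the decoupling error by the sum of
the squares `K (x i) (y j) ^ 2` of the off-diagonal entries. The Möbius transforms of the
indicators of a partition have total size at most `2 ^ n` at each `n`-tuple, whence the series can
be summed uniformly in the partitions (`sum_abs_covariance_le`).

*Lower bound.* The partitions `{X ∩ A = ∅}`, `{X ∩ A ≠ ∅}` and `{X ∩ B = ∅}`, `{X ∩ B ≠ ∅}` reduce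
the claim to the covariance of void events. The void probability of `E` is the Fredholm determinant
`∑ (-1) ^ n / n! ∫ det K` over `E`. Laplace expansion gives Newton's identities between its terms
and the traces `τ k` of the powers of the kernel restricted to `E` (`fredholm_newton`), hence, by the
differential equation `D' = -τ D`, the formula `exp (-∑ τ k / (k + 1))` (`void_eq_exp`). As `K ≥ 0`,
the traces are superadditive in `E`, and passing to `A ∪ B` adds `2 ∫ K ^ 2` over `A × B` to the
trace of the square; this yields the covariance bound (`void_covariance_ge`). The prefactor is a
lower bound for the void probability of `A ∪ B`, which follows from `τ (k + 1) ≤ M * τ k`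
(`iterTrace_succ_le`).

The last inequality is where the spectrum of the operator enters: `T` is self-adjoint with
`0 ≤ T ≤ M` (`quadFormBound_restrict`). For `k ≥ 1` the inequality is obtained by testing this with
the iterated kernels. For `k = 0` the values `K x x` on the diagonal are not determined by `T`;
there the almost sure positivity of the matrices `(K (x i) (x j))` is used
(`quadForm_dirac_add_nonneg`).

For a diffuse measure the suprema over `μ A ≤ p`, `μ B ≤ q` and over `μ A < p`, `μ B < q` agree, by
removing small balls and monotone convergence (`supMass_le_supMassStrict`).
-/


open MeasureTheory
open scoped ENNReal

namespace DPPMixing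

/-! ### Positive semidefinite matrices -/

section Matrices

open Matrix

/-- A real symmetric matrix with non-negative principal minors is positive semidefinite: up to a
sign, its characteristic polynomial has non-negative coefficients in `-X`, hence no negative
root. -/
theorem posSemidef_of_principal_minors_nonneg {ι : Type*} [Fintype ι] [DecidableEq ι]
    {M : Matrix ι ι ℝ} (hM : M.IsHermitian)
    (h : ∀ s : Finset ι, 0 ≤ (M.submatrix (Subtype.val : s → ι) Subtype.val).det) :
    M.PosSemidef := by
  rw [hM.posSemidef_iff_eigenvalues_nonneg]
  intro i
  by_contra hneg
  simp only [Pi.zero_apply, not_le] at hneg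
  set l := hM.eigenvalues i with hl
  have h0 : M.charpoly.eval l = 0 := by
    rw [hM.charpoly_eq, Polynomial.eval_prod]
    exact Finset.prod_eq_zero (Finset.mem_univ i) (by simp [hl])
  set N := Fintype.card ι with hN
  rw [Polynomial.eval_eq_sum_range, M.charpoly_natDegree_eq_dim, ← hN,
    ← Finset.sum_range_reflect] at h0
  have h1 : ∀ k ∈ Finset.range (N + 1),
      M.charpoly.coeff (N + 1 - 1 - k) * l ^ (N + 1 - 1 - k) = (-1) ^ N *
        ((∑ s ∈ Finset.univ.powersetCard k,
          (M.submatrix (Subtype.val : s → ι) Subtype.val).det) * (-l) ^ (N - k)) := by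
    intro k hk
    have hk' : k ≤ N := Nat.lt_succ_iff.mp (Finset.mem_range.mp hk)
    rw [Nat.add_sub_cancel, hN, M.charpoly_coeff_eq_sum_minors k hk', ← hN, neg_pow l]
    obtain ⟨j, hj⟩ := Nat.exists_eq_add_of_le hk'
    have : (-1 : ℝ) ^ (N + (N - k)) = (-1) ^ k := by
      rw [hj, Nat.add_sub_cancel_left, add_assoc, ← two_mul, pow_add, pow_mul]; simp
    rw [← this, pow_add]; ring
  rw [Finset.sum_congr rfl h1, ← Finset.mul_sum] at h0
  have h2 : 0 < ∑ k ∈ Finset.range (N + 1), (∑ s ∈ Finset.univ.powersetCard k,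
      (M.submatrix (Subtype.val : s → ι) Subtype.val).det) * (-l) ^ (N - k) := by
    refine Finset.sum_pos' (fun k _ => mul_nonneg (Finset.sum_nonneg fun s _ => h s)
      (pow_nonneg (by linarith) _)) ⟨0, by simp, ?_⟩
    simp only [Finset.powersetCard_zero, Finset.sum_singleton, det_isEmpty, one_mul]
    exact pow_pos (by linarith) _
  rcases mul_eq_zero.mp h0 with h3 | h3
  · exact absurd h3 (by positivity)
  · exact absurd h3 h2.ne'

/-- A weak form of Hadamard's inequality, from the inequality between the arithmetic and the
geometric mean of the eigenvalues. -/
theorem det_le_pow_card {ι : Type*} [Fintype ι] [DecidableEq ι] {M : Matrix ι ι ℝ}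
    (hM : M.PosSemidef) {c : ℝ} (hc : ∀ i, M i i ≤ c) : M.det ≤ c ^ Fintype.card ι := by
  rcases isEmpty_or_nonempty ι with hι | hι
  · simp
  set N := Fintype.card ι with hN
  have hNpos : (0 : ℝ) < N := by exact_mod_cast Fintype.card_pos
  have hdet : M.det = ∏ i, hM.1.eigenvalues i := by
    simpa using hM.1.det_eq_prod_eigenvalues
  have htr : ∑ i, hM.1.eigenvalues i ≤ N * c := by
    have := hM.1.trace_eq_sum_eigenvalues
    simp only [RCLike.ofReal_real_eq_id, id] at this
    rw [← this, Matrix.trace]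
    calc ∑ i, M.diag i ≤ ∑ _i : ι, c := Finset.sum_le_sum fun i _ => hc i
      _ = N * c := by simp [hN]
  have hev := hM.eigenvalues_nonneg
  have key := Real.geom_mean_le_arith_mean_weighted Finset.univ (fun _ : ι => (N : ℝ)⁻¹)
    hM.1.eigenvalues (fun _ _ => by positivity) (by simp [← hN])
    (fun i _ => hev i)
  rw [← Finset.mul_sum] at key
  have h2 : (∏ i, hM.1.eigenvalues i ^ (N : ℝ)⁻¹) ≤ c := key.trans (by
    rw [inv_mul_le_iff₀ hNpos]; exact htr)
  have h3 := pow_le_pow_left₀ (Finset.prod_nonneg fun i _ => Real.rpow_nonneg (hev i) _) h2 N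
  rw [← Finset.prod_pow] at h3
  rw [hdet]
  refine le_trans (le_of_eq ?_) h3
  refine Finset.prod_congr rfl fun i _ => ?_
  rw [← Real.rpow_natCast, ← Real.rpow_mul (hev i), inv_mul_cancel₀ hNpos.ne', Real.rpow_one]

/-- Weierstrass's product inequality. -/
theorem one_sub_sum_le_prod_one_sub {ι : Type*} (s : Finset ι) (f : ι → ℝ)
    (h0 : ∀ i, 0 ≤ f i) (h1 : ∀ i, f i ≤ 1) : 1 - ∑ i ∈ s, f i ≤ ∏ i ∈ s, (1 - f i) := by
  classical
  induction s using Finset.induction_on with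
  | empty => simp
  | insert a s ha ih =>
    rw [Finset.sum_insert ha, Finset.prod_insert ha]
    have hp : ∏ i ∈ s, (1 - f i) ≤ 1 :=
      Finset.prod_le_one (fun i _ => by linarith [h1 i]) (fun i _ => by linarith [h0 i])
    nlinarith [h0 a]

theorem PosSemidef.abs_apply_le {ι : Type*} [Fintype ι] {P : Matrix ι ι ℝ} (hP : P.PosSemidef)
    {c : ℝ} (hc : ∀ i, P i i ≤ c) (i j : ι) : |P i j| ≤ c := by
  have h := (hP.submatrix ![i, j]).det_nonneg
  simp only [det_fin_two, submatrix_apply, cons_val_zero, cons_val_one] at h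
  have hij : P j i = P i j := by simpa using hP.1.apply i j
  have hi : 0 ≤ P i i := hP.diag_nonneg
  have hj : 0 ≤ P j j := hP.diag_nonneg
  rw [hij] at h
  refine abs_le_of_sq_le_sq ?_ (hi.trans (hc i))
  nlinarith [hc i, hc j]

/-- The adjugate is again positive semidefinite, and its diagonal entries are principal minors. -/
theorem PosDef.abs_adjugate_apply_le {n : ℕ} {A : Matrix (Fin (n + 1)) (Fin (n + 1)) ℝ}
    (hA : A.PosDef) {c : ℝ} (hc : ∀ i, A i i ≤ c) (i j : Fin (n + 1)) :
    |A.adjugate i j| ≤ c ^ n := by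
  have hadj : A.adjugate.PosSemidef := by
    have hinv : A⁻¹.PosSemidef := hA.posSemidef.inv
    have : A.adjugate = A.det • A⁻¹ := by
      rw [Matrix.inv_def, smul_smul, Ring.mul_inverse_cancel _ hA.det_pos.ne'.isUnit, one_smul]
    rw [this]
    exact hinv.smul hA.det_pos.le
  refine PosSemidef.abs_apply_le hadj (fun i => ?_) i j
  rw [adjugate_fin_succ_eq_det_submatrix]
  have h := det_le_pow_card (hA.posSemidef.submatrix i.succAbove) (c := c) (fun k => hc _)
  rw [Fintype.card_fin] at h
  rw [← two_mul, pow_mul]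
  simpa using h

/-- If `0 ≤ D ≤ B`, then `det (B - D)` differs from `det B` at most by the first-order term. -/
theorem det_sub_bounds {ι : Type*} [Fintype ι] [DecidableEq ι] {B D : Matrix ι ι ℝ}
    (hB : B.PosDef) (hD : D.PosSemidef) (hBD : (B - D).PosSemidef) :
    0 ≤ B.det - (B - D).det ∧ B.det - (B - D).det ≤ (B.adjugate * D).trace := by
  obtain ⟨L, hL⟩ : ∃ L : Matrix ι ι ℝ, B = Lᴴ * L := by
    open scoped MatrixOrder in
    exact CStarAlgebra.nonneg_iff_eq_star_mul_self.mp hB.posSemidef.nonneg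
  have hdetB : B.det = L.det * L.det := by rw [hL, det_mul, det_conjTranspose]; simp
  have hLdet : IsUnit L.det := by
    rw [isUnit_iff_ne_zero]
    intro h
    have := hB.det_pos
    simp [hdetB, h] at this
  -- after conjugation by `L⁻¹` the pair `B`, `D` becomes `1`, `Q`, and the eigenvalues of `Q` lie
  -- in `[0, 1]`
  set W := L⁻¹ with hW
  have hLW : L * W = 1 := mul_nonsing_inv L hLdet
  have hWL : W * L = 1 := nonsing_inv_mul L hLdet
  have hWL' : Wᴴ * Lᴴ = 1 := by rw [← conjTranspose_mul, hLW, conjTranspose_one]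
  have hLW' : Lᴴ * Wᴴ = 1 := by rw [← conjTranspose_mul, hWL, conjTranspose_one]
  set Q := Wᴴ * D * W with hQ
  have hQpsd : Q.PosSemidef := hD.conjTranspose_mul_mul_same W
  have hWB : Wᴴ * B * W = 1 := by
    rw [hL, ← mul_assoc Wᴴ, hWL', one_mul, hLW]
  have h1Q : (1 - Q).PosSemidef := by
    have := hBD.conjTranspose_mul_mul_same W
    rwa [mul_sub, sub_mul, hWB] at this
  have hLQL : Lᴴ * Q * L = D := by
    calc Lᴴ * Q * L = (Lᴴ * Wᴴ) * D * (W * L) := by rw [hQ]; simp only [mul_assoc]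
      _ = D := by rw [hLW', hWL, one_mul, mul_one]
  have hBDeq : B - D = Lᴴ * (1 - Q) * L := by rw [mul_sub, sub_mul, hLQL, mul_one, ← hL]
  have hdet1 : (B - D).det = B.det * (1 - Q).det := by
    rw [hBDeq, det_mul, det_mul, det_conjTranspose, hdetB]; simp; ring
  set q := hQpsd.1.eigenvalues with hq
  have hq0 : ∀ i, 0 ≤ q i := hQpsd.eigenvalues_nonneg
  have hq1 : ∀ i, q i ≤ 1 := by
    intro i
    have h1 := (posSemidef_iff_isHermitian_and_spectrum_nonneg.mp h1Q).2
    have h2 : q i ∈ spectrum ℝ Q := hQpsd.1.eigenvalues_mem_spectrum_real i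
    have h3 : 1 - q i ∈ spectrum ℝ (1 - Q) := by
      have := spectrum.singleton_sub_eq Q (1 : ℝ)
      rw [map_one] at this
      rw [← this]
      exact Set.sub_mem_sub rfl h2
    have h4 := h1 h3
    simp only [Set.mem_ofPred_eq] at h4
    linarith
  have hdetQ : (1 - Q).det = ∏ i, (1 - q i) := by
    have h1 : Q.charpoly.eval 1 = (1 - Q).det := by
      rw [Matrix.eval_charpoly]; simp
    rw [← h1, hQpsd.1.charpoly_eq, Polynomial.eval_prod]
    simp [hq]
  have htrQ : Q.trace = ∑ i, q i := by simpa using hQpsd.1.trace_eq_sum_eigenvalues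
  have htr : (B.adjugate * D).trace = B.det * Q.trace := by
    have hBinv : B⁻¹ = W * Wᴴ := by
      refine Matrix.inv_eq_left_inv ?_
      rw [hL, mul_assoc, ← mul_assoc Wᴴ, hWL', one_mul, hWL]
    have : B.adjugate = B.det • B⁻¹ := by
      rw [Matrix.inv_def, smul_smul, Ring.mul_inverse_cancel _ hB.det_pos.ne'.isUnit, one_smul]
    rw [this, smul_mul_assoc, trace_smul, smul_eq_mul, hBinv, hQ, Matrix.trace_mul_comm (Wᴴ * D),
      mul_assoc]
  have hBpos := hB.det_pos
  have hp1 : ∏ i, (1 - q i) ≤ 1 :=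
    Finset.prod_le_one (fun i _ => by linarith [hq1 i]) (fun i _ => by linarith [hq0 i])
  have hp2 := one_sub_sum_le_prod_one_sub Finset.univ q hq0 hq1
  rw [hdet1, htr, hdetQ, htrQ]
  constructor <;> nlinarith

/-- By the Schur complement, the defect in Fischer's inequality is
`det A * (det B - det (B - Cᵀ A⁻¹ C))`, and its first-order bound is a quadratic form in the entries
of `C` whose coefficients are products of entries of adjugates. -/
theorem PosDef.det_mul_det_sub_det_fromBlocks {m n : ℕ}
    {A : Matrix (Fin (m + 1)) (Fin (m + 1)) ℝ} {B : Matrix (Fin (n + 1)) (Fin (n + 1)) ℝ}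
    {C : Matrix (Fin (m + 1)) (Fin (n + 1)) ℝ} {c : ℝ}
    (hM : (fromBlocks A C Cᵀ B).PosDef) (hA : ∀ i, A i i ≤ c) (hB : ∀ i, B i i ≤ c) :
    0 ≤ A.det * B.det - (fromBlocks A C Cᵀ B).det ∧
    A.det * B.det - (fromBlocks A C Cᵀ B).det ≤
      c ^ m * c ^ n * ((m + 1) * (n + 1)) * ∑ i, ∑ j, C i j ^ 2 := by
  have hApd : A.PosDef := by
    simpa using! hM.submatrix (e := Sum.inl) Sum.inl_injective
  have hBpd : B.PosDef := by
    simpa using! hM.submatrix (e := Sum.inr) Sum.inr_injective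
  have hinv : Invertible A := A.invertibleOfIsUnitDet hApd.det_pos.ne'.isUnit
  have hS : (B - Cᵀ * A⁻¹ * C).PosSemidef := by
    have := (Matrix.PosDef.fromBlocks₁₁ C B hApd).mp (by simpa using hM.posSemidef)
    simpa using this
  have hD : (Cᵀ * A⁻¹ * C).PosSemidef := by
    simpa using hApd.posSemidef.inv.conjTranspose_mul_mul_same C
  have hdet : (fromBlocks A C Cᵀ B).det = A.det * (B - Cᵀ * A⁻¹ * C).det := by
    rw [det_fromBlocks₁₁, invOf_eq_nonsing_inv]
  obtain ⟨h1, h2⟩ := det_sub_bounds hBpd hD hS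
  have hApos := hApd.det_pos
  rw [hdet, ← mul_sub]
  refine ⟨mul_nonneg hApos.le h1, (mul_le_mul_of_nonneg_left h2 hApos.le).trans ?_⟩
  have hadj : A.adjugate = A.det • A⁻¹ := by
    rw [Matrix.inv_def, smul_smul, Ring.mul_inverse_cancel _ hApos.ne'.isUnit, one_smul]
  have htr : A.det * (B.adjugate * (Cᵀ * A⁻¹ * C)).trace =
      ∑ j, ∑ j', ∑ i', ∑ i, B.adjugate j j' * (C i j' * A.adjugate i i' * C i' j) := by
    rw [← smul_eq_mul, ← trace_smul, ← Matrix.mul_smul, ← Matrix.smul_mul, ← Matrix.mul_smul,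
      ← hadj]
    simp only [trace, diag, mul_apply, Finset.mul_sum, Finset.sum_mul, transpose_apply]
  have hc : 0 ≤ c := (hApd.diag_pos (i := 0)).le.trans (hA 0)
  have hcs : (∑ i, ∑ j, |C i j|) ^ 2 ≤ ((m + 1) * (n + 1)) * ∑ i, ∑ j, C i j ^ 2 := by
    have := sq_sum_le_card_mul_sum_sq (s := (Finset.univ : Finset (Fin (m + 1) × Fin (n + 1))))
      (f := fun z => |C z.1 z.2|)
    simpa [Fintype.sum_prod_type] using this
  rw [htr]
  calc ∑ j, ∑ j', ∑ i', ∑ i, B.adjugate j j' * (C i j' * A.adjugate i i' * C i' j)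
      ≤ ∑ j, ∑ j', ∑ i', ∑ i, c ^ n * (|C i j'| * c ^ m * |C i' j|) := by
        refine Finset.sum_le_sum fun j _ => Finset.sum_le_sum fun j' _ =>
          Finset.sum_le_sum fun i' _ => Finset.sum_le_sum fun i _ => ?_
        refine (le_abs_self _).trans ?_
        rw [abs_mul, abs_mul, abs_mul]
        have ha := PosDef.abs_adjugate_apply_le hApd hA i i'
        have hb := PosDef.abs_adjugate_apply_le hBpd hB j j'
        gcongr
    _ = c ^ m * c ^ n * (∑ i, ∑ j, |C i j|) ^ 2 := by
        have e1 : ∀ j : Fin (n + 1), ∀ j' : Fin (n + 1),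
            ∑ i', ∑ i, c ^ n * (|C i j'| * c ^ m * |C i' j|) =
              c ^ m * c ^ n * ((∑ i', |C i' j|) * ∑ i, |C i j'|) := by
          intro j j'
          rw [Finset.sum_mul_sum, Finset.mul_sum]
          refine Finset.sum_congr rfl fun i' _ => ?_
          rw [Finset.mul_sum]
          refine Finset.sum_congr rfl fun i _ => ?_
          ring
        simp_rw [e1, ← Finset.mul_sum, ← Finset.sum_mul]
        rw [Finset.sum_comm, sq]
    _ ≤ c ^ m * c ^ n * (((m + 1) * (n + 1)) * ∑ i, ∑ j, C i j ^ 2) := by gcongr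
    _ = _ := by ring

/-- A quantitative form of Fischer's inequality, with an upper bound for the defect. -/
theorem PosSemidef.det_mul_det_sub_det_fromBlocks {m n : ℕ}
    {A : Matrix (Fin (m + 1)) (Fin (m + 1)) ℝ} {B : Matrix (Fin (n + 1)) (Fin (n + 1)) ℝ}
    {C : Matrix (Fin (m + 1)) (Fin (n + 1)) ℝ} {c : ℝ}
    (hM : (fromBlocks A C Cᵀ B).PosSemidef) (hA : ∀ i, A i i ≤ c) (hB : ∀ i, B i i ≤ c) :
    0 ≤ A.det * B.det - (fromBlocks A C Cᵀ B).det ∧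
    A.det * B.det - (fromBlocks A C Cᵀ B).det ≤
      c ^ m * c ^ n * ((m + 1) * (n + 1)) * ∑ i, ∑ j, C i j ^ 2 := by
  -- The positive definite case applies to `M + ε`, and both sides are continuous in `ε`.
  have hpd : ∀ ε : ℝ, 0 < ε → (fromBlocks (A + ε • 1) C Cᵀ (B + ε • 1)).PosDef := by
    intro ε hε
    have : fromBlocks (A + ε • 1) C Cᵀ (B + ε • 1) = fromBlocks A C Cᵀ B + ε • 1 := by
      rw [← fromBlocks_one, fromBlocks_smul, fromBlocks_add]; simp
    rw [this]
    exact Matrix.PosDef.posSemidef_add hM (Matrix.PosDef.one.smul hε)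
  have key := fun (ε : ℝ) (hε : 0 < ε) =>
    PosDef.det_mul_det_sub_det_fromBlocks (c := c + ε) (hpd ε hε)
    (fun i => by simpa using hA i) (fun i => by simpa using hB i)
  have hcont : Continuous fun ε : ℝ =>
      (A + ε • (1 : Matrix _ _ ℝ)).det * (B + ε • (1 : Matrix _ _ ℝ)).det -
        (fromBlocks (A + ε • (1 : Matrix _ _ ℝ)) C Cᵀ (B + ε • (1 : Matrix _ _ ℝ))).det := by
    have hA' : Continuous fun ε : ℝ => A + ε • (1 : Matrix _ _ ℝ) := by fun_prop
    have hB' : Continuous fun ε : ℝ => B + ε • (1 : Matrix _ _ ℝ) := by fun_prop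
    exact (hA'.matrix_det.mul hB'.matrix_det).sub
      ((hA'.matrix_fromBlocks continuous_const continuous_const hB').matrix_det)
  have hlim := (hcont.tendsto 0).mono_left (nhdsWithin_le_nhds (s := Set.Ioi 0))
  have hcont2 : Continuous fun ε : ℝ =>
      (c + ε) ^ m * (c + ε) ^ n * ((m + 1) * (n + 1)) * ∑ i, ∑ j, C i j ^ 2 := by fun_prop
  have hlim2 := (hcont2.tendsto 0).mono_left (nhdsWithin_le_nhds (s := Set.Ioi 0))
  simp only [zero_smul, add_zero] at hlim hlim2
  constructor
  · refine ge_of_tendsto hlim ?_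
    filter_upwards [self_mem_nhdsWithin] with ε hε using (key ε hε).1
  · refine le_of_tendsto_of_tendsto hlim hlim2 ?_
    filter_upwards [self_mem_nhdsWithin] with ε hε using (key ε hε).2

end Matrices

/-! ### Kernels whose determinants are almost everywhere non-negative -/

section AlmostEverywhere

variable {α : Type*} [MeasurableSpace α]

/-- The matrix `(K (x i) (x j))`. -/
abbrev kernelMatrix {ι : Type*} (K : α → α → ℝ) (x : ι → α) : Matrix ι ι ℝ :=
  Matrix.of fun i j => K (x i) (x j)

/-- Restricting a tuple to some of its coordinates is quasi-measure-preserving. -/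
theorem quasiMeasurePreserving_subtype_comp_equiv (μ : Measure α) [SigmaFinite μ] {n k : ℕ}
    (p : Fin n → Prop) [DecidablePred p] (e : {i // p i} ≃ Fin k) :
    Measure.QuasiMeasurePreserving (fun (x : Fin n → α) (j : Fin k) => x (e.symm j))
      (Measure.pi fun _ => μ) (Measure.pi fun _ => μ) := by
  have h1 := (measurePreserving_piEquivPiSubtypeProd (fun _ : Fin n => μ) p).quasiMeasurePreserving
  have h2 : Measure.QuasiMeasurePreserving
      (Prod.fst : ({i // p i} → α) × ({i // ¬ p i} → α) → _) _ _ :=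
    Measure.quasiMeasurePreserving_fst (μ := Measure.pi fun _ : {i // p i} => μ)
      (ν := Measure.pi fun _ : {i // ¬ p i} => μ)
  have h3 := (measurePreserving_piCongrLeft (fun _ : Fin k => μ) e).quasiMeasurePreserving
  convert h3.comp (h2.comp h1) using 1
  ext x j
  obtain ⟨i, rfl⟩ := e.surjective j
  simp [MeasurableEquiv.coe_piCongrLeft, Equiv.piCongrLeft_apply_apply,
    MeasurableEquiv.piEquivPiSubtypeProd, Equiv.piEquivPiSubtypeProd]

/-- If all the intensities `det (K (x i) (x j))` are almost everywhere non-negative, then the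
matrices `(K (x i) (x j))` are almost everywhere positive semidefinite, since their principal minors
are intensities evaluated at subtuples. -/
theorem ae_posSemidef_kernelMatrix (μ : Measure α) [SigmaFinite μ] {K : α → α → ℝ}
    (hsymm : ∀ x y, K x y = K y x)
    (h : ∀ n : ℕ, 1 ≤ n → ∀ᵐ x ∂(Measure.pi fun _ : Fin n => μ), 0 ≤ (kernelMatrix K x).det)
    (n : ℕ) : ∀ᵐ x ∂(Measure.pi fun _ : Fin n => μ), (kernelMatrix K x).PosSemidef := by
  have hs : ∀ s : Finset (Fin n), ∀ᵐ x ∂(Measure.pi fun _ : Fin n => μ),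
      0 ≤ ((kernelMatrix K x).submatrix (Subtype.val : s → Fin n) Subtype.val).det := by
    intro s
    have h' : ∀ n : ℕ, ∀ᵐ x ∂(Measure.pi fun _ : Fin n => μ), 0 ≤ (kernelMatrix K x).det := by
      intro n
      rcases Nat.eq_zero_or_pos n with rfl | hn
      · exact Filter.Eventually.of_forall fun x => by simp
      · exact h n hn
    have hq := quasiMeasurePreserving_subtype_comp_equiv μ (fun i => i ∈ s) s.equivFin
    filter_upwards [hq.ae (h' s.card)] with x hx
    have : ((kernelMatrix K x).submatrix (Subtype.val : s → Fin n) Subtype.val) =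
        (kernelMatrix K fun j => x (s.equivFin.symm j)).submatrix s.equivFin s.equivFin := by
      ext i j; simp
    rw [this, Matrix.det_submatrix_equiv_self]
    exact hx
  filter_upwards [ae_all_iff.mpr hs] with x hx
  exact posSemidef_of_principal_minors_nonneg (by ext i j; simp [hsymm (x j)]) hx

theorem ae_pi_restrict_of_ae (μ : Measure α) [SigmaFinite μ] (E : Set α) {ι : Type*} [Fintype ι]
    {p : (ι → α) → Prop} (h : ∀ᵐ x ∂(Measure.pi fun _ : ι => μ), p x) :
    ∀ᵐ x ∂(Measure.pi fun _ : ι => μ.restrict E), p x := by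
  have := Measure.restrict_pi_pi (fun _ : ι => μ) (fun _ => E)
  rw [← this]
  exact ae_restrict_of_ae h

end AlmostEverywhere

/-! ### Möbius inversion on finite configurations -/

section Moebius

variable {α : Type*}

/-- The Möbius transform `∑_{S ⊆ {1, …, n}} (-1)^(n - |S|) f (x '' S)` of a function `f` of
configurations, as a function of `n`-tuples. -/
def moebius (f : Set α → ℝ) {n : ℕ} (x : Fin n → α) : ℝ :=
  ∑ S : Finset (Fin n), (-1) ^ (n + S.card) * f (x '' S)

/-- The injective `n`-tuples of points of a finite set. -/
def tuples [DecidableEq α] (n : ℕ) (Y : Finset α) : Finset (Fin n → α) :=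
  (Fintype.piFinset fun _ => Y).filter Function.Injective

theorem mem_tuples [DecidableEq α] {n : ℕ} {Y : Finset α} {x : Fin n → α} :
    x ∈ tuples n Y ↔ Function.Injective x ∧ ∀ i, x i ∈ Y := by
  simp [tuples, and_comm]

theorem abs_moebius_le {f : Set α → ℝ} (hf : ∀ s, |f s| ≤ 1) {n : ℕ} (x : Fin n → α) :
    |moebius f x| ≤ 2 ^ n := by
  refine (Finset.abs_sum_le_sum_abs _ _).trans ?_
  calc ∑ S : Finset (Fin n), |(-1) ^ (n + S.card) * f (x '' S)|
      ≤ ∑ _S : Finset (Fin n), (1 : ℝ) := by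
        refine Finset.sum_le_sum fun S _ => ?_
        rw [abs_mul, abs_pow, abs_neg, abs_one, one_pow, one_mul]
        exact hf _
    _ = 2 ^ n := by simp

theorem moebius_const_one_of_pos {n : ℕ} (hn : n ≠ 0) (x : Fin n → α) :
    moebius (fun _ => 1) x = 0 := by
  have h := Finset.sum_powerset_neg_one_pow_card_of_nonempty
    (x := (Finset.univ : Finset (Fin n))) ⟨⟨0, Nat.pos_of_ne_zero hn⟩, Finset.mem_univ _⟩
  have h' : (∑ S : Finset (Fin n), (-1 : ℝ) ^ S.card) = 0 := by
    rw [Finset.powerset_univ] at h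
    exact_mod_cast h
  simp [moebius, pow_add, ← Finset.mul_sum, h']

theorem moebius_fin_zero (f : Set α → ℝ) (x : Fin 0 → α) : moebius f x = f ∅ := by
  simp [moebius, Finset.univ_unique, Finset.eq_empty_of_isEmpty]

theorem moebius_indicator_empty {n : ℕ} (x : Fin n → α) :
    moebius (Set.indicator {∅} fun _ => 1) x = (-1) ^ n := by
  rw [moebius, Finset.sum_eq_single ∅]
  · simp
  · intro S _ hS
    have : x '' (S : Set (Fin n)) ≠ ∅ := by simpa using hS
    simp [Set.indicator, this]
  · simp

/-- Möbius inversion over the lattice of subsets of a finite set. -/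
theorem sum_powerset_sum_powerset_neg_one_pow [DecidableEq α] (Y : Finset α) (f : Finset α → ℝ) :
    ∑ Z ∈ Y.powerset, ∑ W ∈ Z.powerset, (-1) ^ (Z.card + W.card) * f W = f Y := by
  induction Y using Finset.induction_on generalizing f with
  | empty => simp
  | insert a Y ha ih =>
    rw [Finset.sum_powerset_insert ha, ← Finset.sum_add_distrib, ← ih fun W => f (insert a W)]
    refine Finset.sum_congr rfl fun Z hZ => ?_
    have haZ : a ∉ Z := fun h => ha (Finset.mem_powerset.mp hZ h)
    rw [Finset.sum_powerset_insert haZ, ← add_assoc, ← Finset.sum_add_distrib]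
    have h1 : ∑ W ∈ Z.powerset, ((-1 : ℝ) ^ (Z.card + W.card) * f W +
        (-1) ^ ((insert a Z).card + W.card) * f W) = 0 := by
      refine Finset.sum_eq_zero fun W _ => ?_
      rw [Finset.card_insert_of_notMem haZ]
      ring
    rw [h1, zero_add]
    refine Finset.sum_congr rfl fun W hW => ?_
    have haW : a ∉ W := fun h => haZ (Finset.mem_powerset.mp hW h)
    rw [Finset.card_insert_of_notMem haZ, Finset.card_insert_of_notMem haW]
    ring

/-- Each finite set with `n` elements is enumerated by `n!` injective tuples. -/
theorem card_filter_image_eq [DecidableEq α] {n : ℕ} {Z : Finset α} (hZ : Z.card = n) :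
    ((tuples n Z).filter fun x => Finset.univ.image x = Z).card = n.factorial := by
  classical
  have e : {x // x ∈ (tuples n Z).filter fun x => Finset.univ.image x = Z} ≃ (Fin n ≃ Z) :=
    { toFun := fun x => Equiv.ofBijective
        (fun i => ⟨x.1 i, (mem_tuples.mp (Finset.mem_filter.mp x.2).1).2 i⟩)
        ((Fintype.bijective_iff_injective_and_card _).mpr
          ⟨fun i j hij => (mem_tuples.mp (Finset.mem_filter.mp x.2).1).1
            (by simpa using hij), by simp [hZ]⟩)
      invFun := fun e => ⟨fun i => e i, by
        rw [Finset.mem_filter, mem_tuples]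
        refine ⟨⟨fun i j hij => e.injective (Subtype.ext hij), fun i => (e i).2⟩, ?_⟩
        ext z
        simp only [Finset.mem_image, Finset.mem_univ, true_and]
        exact ⟨fun ⟨i, hi⟩ => hi ▸ (e i).2, fun hz => ⟨e.symm ⟨z, hz⟩, by simp⟩⟩⟩
      left_inv := fun x => by ext; rfl
      right_inv := fun e => by ext; rfl }
  rw [← Fintype.card_coe, Fintype.card_congr e, Fintype.card_equiv (Z.equivFinOfCardEq hZ).symm]
  simp

theorem moebius_eq_sum_powerset [DecidableEq α] (f : Set α → ℝ) {n : ℕ} {x : Fin n → α}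
    (hx : Function.Injective x) :
    moebius f x = ∑ W ∈ (Finset.univ.image x).powerset,
      (-1) ^ ((Finset.univ.image x).card + W.card) * f W := by
  have h : (Finset.univ.image x).powerset =
      (Finset.univ : Finset (Finset (Fin n))).image fun S => S.image x := by
    rw [← Finset.powerset_univ, Finset.powerset_image]
  rw [h, Finset.sum_image (Finset.image_injective hx).injOn, Finset.card_image_of_injective _ hx]
  refine Finset.sum_congr rfl fun S _ => ?_
  rw [Finset.card_image_of_injective _ hx, Finset.card_fin, Finset.coe_image]

/-- A function of finite configurations is recovered from its Möbius transform by summing over the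
injective tuples. -/
theorem sum_range_sum_tuples_moebius [DecidableEq α] (f : Set α → ℝ) (Y : Finset α) :
    ∑ n ∈ Finset.range (Y.card + 1), (n.factorial : ℝ)⁻¹ * ∑ x ∈ tuples n Y, moebius f x =
      f Y := by
  set g : Finset α → ℝ := fun Z => ∑ W ∈ Z.powerset, (-1) ^ (Z.card + W.card) * f W with hg
  have h1 : ∀ n, (n.factorial : ℝ)⁻¹ * ∑ x ∈ tuples n Y, moebius f x =
      ∑ Z ∈ Y.powersetCard n, g Z := by
    intro n
    have hmaps : ∀ x ∈ tuples n Y, Finset.univ.image x ∈ Y.powersetCard n := by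
      intro x hx
      obtain ⟨hinj, hmem⟩ := mem_tuples.mp hx
      rw [Finset.mem_powersetCard]
      exact ⟨Finset.image_subset_iff.mpr fun i _ => hmem i,
        by rw [Finset.card_image_of_injective _ hinj, Finset.card_fin]⟩
    rw [← Finset.sum_fiberwise_of_maps_to hmaps, Finset.mul_sum]
    refine Finset.sum_congr rfl fun Z hZ => ?_
    obtain ⟨hZY, hZn⟩ := Finset.mem_powersetCard.mp hZ
    have h2 : ∀ x ∈ (tuples n Y).filter (fun x => Finset.univ.image x = Z),
        moebius f x = g Z := by
      intro x hx
      obtain ⟨hx1, hx2⟩ := Finset.mem_filter.mp hx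
      rw [moebius_eq_sum_powerset f (mem_tuples.mp hx1).1, hx2]
    have h3 : (tuples n Y).filter (fun x => Finset.univ.image x = Z) =
        (tuples n Z).filter (fun x => Finset.univ.image x = Z) := by
      ext x
      simp only [Finset.mem_filter, mem_tuples]
      constructor
      · rintro ⟨⟨h, -⟩, h'⟩
        exact ⟨⟨h, fun i => h' ▸ Finset.mem_image_of_mem x (Finset.mem_univ i)⟩, h'⟩
      · rintro ⟨⟨h, h''⟩, h'⟩
        exact ⟨⟨h, fun i => hZY (h'' i)⟩, h'⟩
    rw [Finset.sum_congr rfl h2, Finset.sum_const, h3, card_filter_image_eq hZn, nsmul_eq_mul,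
      ← mul_assoc, inv_mul_cancel₀ (by positivity), one_mul]
  simp_rw [h1]
  rw [← sum_powerset_sum_powerset_neg_one_pow Y fun W => f W]
  exact (Finset.sum_powerset Y g).symm

theorem tuples_eq_empty [DecidableEq α] {n : ℕ} {Y : Finset α} (h : Y.card < n) :
    tuples n Y = ∅ := by
  ext x
  simp only [mem_tuples, Finset.notMem_empty, iff_false, not_and]
  intro hx hmem
  have := Finset.card_le_card_of_injOn x (s := Finset.univ) (t := Y) (fun i _ => hmem i) hx.injOn
  rw [Finset.card_fin] at this
  omega

theorem hasSum_sum_tuples_moebius [DecidableEq α] (f : Set α → ℝ) (Y : Finset α) :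
    HasSum (fun n : ℕ => (n.factorial : ℝ)⁻¹ * ∑ x ∈ tuples n Y, moebius f x) (f Y) := by
  rw [← sum_range_sum_tuples_moebius f Y]
  refine hasSum_sum_of_ne_finset_zero fun n hn => ?_
  rw [tuples_eq_empty (by simpa using hn)]
  simp

end Moebius

/-! ### Sums over tuples of points of a random finite set -/

section Tuples

variable {α : Type*} [MeasurableSpace α]

theorem measurable_append (m n : ℕ) :
    Measurable fun z : (Fin m → α) × (Fin n → α) => Fin.append z.1 z.2 := by
  refine measurable_pi_iff.mpr fun i => ?_
  refine Fin.addCases (fun i => ?_) (fun i => ?_) i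
  · simp only [Fin.append_left]; fun_prop
  · simp only [Fin.append_right]; fun_prop

theorem measurePreserving_append (μ : Measure α) [SigmaFinite μ] (m n : ℕ) :
    MeasurePreserving (fun z : (Fin m → α) × (Fin n → α) => Fin.append z.1 z.2)
      ((Measure.pi fun _ => μ).prod (Measure.pi fun _ => μ)) (Measure.pi fun _ => μ) := by
  refine ⟨measurable_append m n, (Measure.pi_eq fun s hs => ?_).symm⟩
  rw [Measure.map_apply (measurable_append m n) (MeasurableSet.univ_pi hs)]
  have : (fun z : (Fin m → α) × (Fin n → α) => Fin.append z.1 z.2) ⁻¹' (Set.univ.pi s) =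
      (Set.univ.pi fun i => s (Fin.castAdd n i)) ×ˢ (Set.univ.pi fun i => s (Fin.natAdd m i)) := by
    ext z
    simp only [Set.mem_preimage, Set.mem_pi, Set.mem_univ, forall_const, Set.mem_prod]
    constructor
    · intro h
      exact ⟨fun i => by simpa using h (Fin.castAdd n i),
        fun i => by simpa using h (Fin.natAdd m i)⟩
    · rintro ⟨h1, h2⟩ i
      refine Fin.addCases (fun i => ?_) (fun i => ?_) i
      · simpa using h1 i
      · simpa using h2 i
  rw [this, Measure.prod_prod, Measure.pi_pi, Measure.pi_pi, Fin.prod_univ_add]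

omit [MeasurableSpace α] in
/-- A sum over concatenated tuples factorizes when the two parts are confined to disjoint sets. -/
theorem sum_tuples_append [DecidableEq α] {A B : Set α} (hAB : Disjoint A B)
    [DecidablePred (· ∈ A)] [DecidablePred (· ∈ B)] (Y : Finset α) {m n : ℕ}
    (F : (Fin m → α) → ℝ) (G : (Fin n → α) → ℝ) :
    ∑ w ∈ tuples (m + n) Y,
      (Set.univ.pi fun _ => A).indicator F (fun i => w (Fin.castAdd n i)) *
        (Set.univ.pi fun _ => B).indicator G (fun i => w (Fin.natAdd m i)) =
    (∑ x ∈ tuples m (Y.filter (· ∈ A)), F x) * ∑ y ∈ tuples n (Y.filter (· ∈ B)), G y := by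
  classical
  rw [Finset.sum_mul_sum, ← Finset.sum_product']
  symm
  refine Finset.sum_of_injOn (fun z => Fin.append z.1 z.2) ?_ ?_ ?_ ?_
  · intro z _ z' _ h
    have h' : Fin.append z.1 z.2 = Fin.append z'.1 z'.2 := h
    ext i
    · simpa using congrFun h' (Fin.castAdd n i)
    · simpa using congrFun h' (Fin.natAdd m i)
  · rintro ⟨x, y⟩ h
    simp only [Finset.coe_product, Set.mem_prod, Finset.mem_coe, mem_tuples,
      Finset.mem_filter] at h ⊢
    obtain ⟨⟨hx, hxA⟩, hy, hyB⟩ := h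
    refine ⟨?_, fun i => ?_⟩
    · rw [Fin.append_injective_iff]
      refine ⟨hx, hy, fun i j hij => ?_⟩
      exact Set.disjoint_left.mp hAB (hxA i).2 (hij ▸ (hyB j).2)
    · refine Fin.addCases (fun i => ?_) (fun i => ?_) i
      · simpa using (hxA i).1
      · simpa using (hyB i).1
  · intro w hw hwn
    by_contra hne
    have h1 := left_ne_zero_of_mul hne
    have h2 := right_ne_zero_of_mul hne
    have h1' := Set.mem_of_indicator_ne_zero h1
    have h2' := Set.mem_of_indicator_ne_zero h2
    simp only [Set.mem_pi, Set.mem_univ, forall_const] at h1' h2'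
    obtain ⟨hwi, hwY⟩ := mem_tuples.mp hw
    refine hwn ⟨(fun i => w (Fin.castAdd n i), fun i => w (Fin.natAdd m i)), ?_, ?_⟩
    · simp only [Finset.coe_product, Set.mem_prod, Finset.mem_coe, mem_tuples, Finset.mem_filter]
      exact ⟨⟨hwi.comp (Fin.castAdd_injective m n), fun i => ⟨hwY _, h1' i⟩⟩,
        hwi.comp (Fin.natAdd_injective n m), fun i => ⟨hwY _, h2' i⟩⟩
    · exact Fin.append_castAdd_natAdd
  · rintro ⟨x, y⟩ h
    simp only [Finset.mem_product, mem_tuples, Finset.mem_filter] at h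
    simp only [Fin.append_left, Fin.append_right]
    rw [Set.indicator_of_mem (by simpa using fun i => (h.1.2 i).2),
      Set.indicator_of_mem (by simpa using fun i => (h.2.2 i).2)]

variable {Ω : Type*} [MeasurableSpace Ω]

open ProbabilityTheory in
/-- If the number of points of the random finite set `Y` in every measurable set is measurable,
then so are the sums of measurable functions over all tuples of points of `Y`. -/
theorem measurable_sum_piFinset {Y : Ω → Finset α}
    (hY : ∀ s, MeasurableSet s → Measurable fun ω => ∑ z ∈ Y ω, s.indicator (1 : α → ℝ≥0∞) z)
    (n : ℕ) (f : Ω × (Fin n → α) → ℝ≥0∞) (hf : Measurable f) :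
    Measurable fun ω => ∑ x ∈ Fintype.piFinset fun _ : Fin n => Y ω, f (ω, x) := by
  -- the counting measure of `Y` as a kernel; it is s-finite because its restrictions to the events
  -- of a fixed number of points are finite, and integrating against it `n` times gives the sum
  let η : Kernel Ω α :=
    ⟨fun ω => ∑ z ∈ Y ω, Measure.dirac z, Measure.measurable_of_measurable_coe _ fun s hs => by
      simp only [Measure.coe_finsetSum, Finset.sum_apply, Measure.dirac_apply' _ hs]
      exact hY s hs⟩
  have hη : ∀ ω, η ω = ∑ z ∈ Y ω, Measure.dirac z := fun _ => rfl
  have hcard : ∀ ω, η ω Set.univ = (Y ω).card := fun ω => by simp [hη]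
  have hS : ∀ k : ℕ, MeasurableSet {ω | η ω Set.univ = k} := fun k =>
    (Kernel.measurable_coe η MeasurableSet.univ) (measurableSet_singleton _)
  have hsf : IsSFiniteKernel η := by
    classical
    refine ⟨fun k => Kernel.piecewise (hS k) η 0, fun k =>
      ⟨⟨k, ENNReal.natCast_lt_top k, fun ω => ?_⟩⟩, ?_⟩
    · rw [Kernel.piecewise_apply]
      split_ifs with h
      · exact le_of_eq h
      · simp
    · ext ω s hs
      rw [Kernel.sum_apply' _ _ hs, tsum_eq_single (Y ω).card]
      · rw [Kernel.piecewise_apply,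
          if_pos (show ω ∈ {ω' | η ω' Set.univ = (Y ω).card} from hcard ω)]
      · intro k hk
        rw [Kernel.piecewise_apply, if_neg]
        · simp
        · simp only [Set.mem_ofPred_eq, hcard]
          exact_mod_cast hk.symm
  induction n with
  | zero =>
    have : ∀ ω, ∑ x ∈ Fintype.piFinset fun _ : Fin 0 => Y ω, f (ω, x) = f (ω, Fin.elim0) := by
      intro ω
      rw [Finset.sum_eq_single Fin.elim0]
      · intro b _ hb; exact absurd (Subsingleton.elim _ _) hb
      · intro h; exact absurd (Fintype.mem_piFinset.mpr fun i => i.elim0) h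
    simp_rw [this]
    fun_prop
  | succ n ih =>
    have hcons : Measurable fun p : (Ω × (Fin n → α)) × α => f (p.1.1, Fin.cons p.2 p.1.2) := by
      refine hf.comp (Measurable.prodMk (by fun_prop) (measurable_pi_iff.mpr fun i => ?_))
      refine Fin.cases ?_ (fun i => ?_) i
      · simp only [Fin.cons_zero]; fun_prop
      · simp only [Fin.cons_succ]; fun_prop
    have hg := ih _ (Measurable.lintegral_kernel_prod_right' (κ := η.comap Prod.fst measurable_fst)
      hcons)
    convert hg using 2 with ω
    have h1 : ∀ x : Fin n → α, ∫⁻ z, f (ω, Fin.cons z x) ∂(η ω) =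
        ∑ z ∈ Y ω, f (ω, Fin.cons z x) := by
      intro x
      rw [hη, lintegral_finsetSum_measure]
      refine Finset.sum_congr rfl fun z _ => ?_
      exact lintegral_dirac' _ (hcons.comp (measurable_prodMk_left (x := (ω, x))))
    simp only [Kernel.comap_apply, h1]
    rw [← Finset.sum_product']
    refine Finset.sum_nbij' (fun x => (Fin.tail x, x 0)) (fun p => Fin.cons p.2 p.1) ?_ ?_ ?_ ?_ ?_
    · intro x hx
      simp only [Fintype.mem_piFinset, Finset.mem_product] at hx ⊢
      exact ⟨fun i => hx i.succ, hx 0⟩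
    · intro p hp
      simp only [Fintype.mem_piFinset, Finset.mem_product] at hp ⊢
      intro i
      refine Fin.cases ?_ (fun i => ?_) i
      · simpa using hp.2
      · simpa using hp.1 i
    · intro x _; simp
    · intro p _; simp
    · intro x _; simp

theorem measurableSet_injective [MeasurableEq α] (n : ℕ) :
    MeasurableSet {x : Fin n → α | Function.Injective x} := by
  have : {x : Fin n → α | Function.Injective x} = ⋂ i, ⋂ j, {x | x i = x j → i = j} := by
    ext x; simp [Function.Injective]
  rw [this]
  refine MeasurableSet.iInter fun i => MeasurableSet.iInter fun j => ?_
  by_cases hij : i = j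
  · simp [hij]
  · simp only [hij, imp_false]
    exact (measurableSet_eq_fun (measurable_pi_apply i) (measurable_pi_apply j)).compl

theorem measurable_sum_tuples [DecidableEq α] [MeasurableEq α]
    {Y : Ω → Finset α}
    (hY : ∀ s, MeasurableSet s → Measurable fun ω => ∑ z ∈ Y ω, s.indicator (1 : α → ℝ≥0∞) z)
    {n : ℕ} {f : (Fin n → α) → ℝ≥0∞} (hf : Measurable f) :
    Measurable fun ω => ∑ x ∈ tuples n (Y ω), f x := by
  have h := measurable_sum_piFinset hY n
    (fun p => {x : Fin n → α | Function.Injective x}.indicator f p.2)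
    ((hf.indicator (measurableSet_injective n)).comp measurable_snd)
  convert h using 2 with ω
  rw [tuples, Finset.sum_filter]
  refine Finset.sum_congr rfl fun x _ => ?_
  simp [Set.indicator_apply]

end Tuples

/-! ### Expectations of functionals of a determinantal point process -/

section Expectation

variable {d : ℕ}

local notation "𝔼" => EuclideanSpace ℝ (Fin d)

theorem measurable_encard_inter {B : Set 𝔼} (hB : Bornology.IsBounded B) (hBm : MeasurableSet B) :
    @Measurable _ _ (configSpace d) ⊤ fun s : Set 𝔼 => (s ∩ B).encard := by
  rw [measurable_iff_comap_le]
  exact le_iSup_of_le B (le_iSup_of_le hB (le_iSup_of_le hBm le_rfl))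

/-- A map into the space of configurations is measurable as soon as the numbers of points in
bounded Borel sets are. -/
theorem measurable_configSpace {β : Type*} [MeasurableSpace β] {F : β → Set 𝔼}
    (h : ∀ B : Set 𝔼, Bornology.IsBounded B → MeasurableSet B →
      @Measurable _ _ _ ⊤ fun b => (F b ∩ B).encard) :
    @Measurable _ _ _ (configSpace d) F := by
  rw [measurable_iff_comap_le, MeasurableSpace.comap_iSup]
  refine iSup_le fun B => ?_
  rw [MeasurableSpace.comap_iSup]
  refine iSup_le fun hB => ?_
  rw [MeasurableSpace.comap_iSup]
  refine iSup_le fun hBm => ?_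
  rw [MeasurableSpace.comap_comp]
  exact (h B hB hBm).comap_le

/-- Repeated points are counted at their first occurrence in the tuple. -/
theorem encard_image_inter {α : Type*} {n : ℕ} (x : Fin n → α) (S : Finset (Fin n)) (B : Set α)
    [DecidablePred (· ∈ B)] [DecidableEq α] :
    (x '' S ∩ B).encard =
      ((∑ i ∈ S, if x i ∈ B ∧ ∀ j ∈ S, j < i → x j ≠ x i then 1 else 0 : ℕ) : ℕ∞) := by
  rw [← Finset.card_filter]
  set F := S.filter fun i => x i ∈ B ∧ ∀ j ∈ S, j < i → x j ≠ x i with hF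
  have hinj : Set.InjOn x F := by
    intro i hi j hj hij
    have hi' := Finset.mem_filter.mp (Finset.mem_coe.mp hi)
    have hj' := Finset.mem_filter.mp (Finset.mem_coe.mp hj)
    rcases lt_trichotomy i j with h | h | h
    · exact absurd hij (hj'.2.2 i hi'.1 h)
    · exact h
    · exact absurd hij.symm (hi'.2.2 j hj'.1 h)
  have himg : x '' S ∩ B = x '' F := by
    ext z
    constructor
    · rintro ⟨⟨i, hi, rfl⟩, hB⟩
      have hne : (S.filter fun j => x j = x i).Nonempty := ⟨i, by simpa using hi⟩
      set i₀ := (S.filter fun j => x j = x i).min' hne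
      have hi₀ := Finset.mem_filter.mp (Finset.min'_mem _ hne)
      refine ⟨i₀, ?_, hi₀.2⟩
      rw [Finset.mem_coe, hF, Finset.mem_filter]
      refine ⟨hi₀.1, by rw [hi₀.2]; exact hB, fun j hj hlt heq => ?_⟩
      exact absurd (Finset.min'_le _ j (Finset.mem_filter.mpr ⟨hj, heq.trans hi₀.2⟩))
        (not_le.mpr hlt)
    · rintro ⟨i, hi, rfl⟩
      have hi' := Finset.mem_filter.mp (Finset.mem_coe.mp hi)
      exact ⟨⟨i, hi'.1, rfl⟩, hi'.2.1⟩
  rw [himg, hinj.encard_image, Set.encard_coe_eq_coe_finsetCard]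

theorem measurable_image_tuple {n : ℕ} (S : Finset (Fin n)) :
    @Measurable _ _ _ (configSpace d) fun x : Fin n → 𝔼 => x '' S := by
  classical
  refine measurable_configSpace fun B _ hBm => ?_
  simp_rw [encard_image_inter]
  have h : Measurable fun x : Fin n → 𝔼 =>
      (∑ i ∈ S, if x i ∈ B ∧ ∀ j ∈ S, j < i → x j ≠ x i then 1 else 0 : ℕ) := by
    refine Finset.measurable_sum _ fun i _ => Measurable.ite ?_ measurable_const measurable_const
    refine MeasurableSet.inter (measurable_pi_apply i hBm) ?_
    have : {x : Fin n → 𝔼 | ∀ j ∈ S, j < i → x j ≠ x i} =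
        ⋂ j, ⋂ (_ : j ∈ S), ⋂ (_ : j < i), {x | x j = x i}ᶜ := by
      ext x; simp
    change MeasurableSet {x : Fin n → 𝔼 | ∀ j ∈ S, j < i → x j ≠ x i}
    rw [this]
    exact MeasurableSet.iInter fun j => MeasurableSet.iInter fun _ => MeasurableSet.iInter fun _ =>
      (measurableSet_eq_fun (measurable_pi_apply j) (measurable_pi_apply i)).compl
  exact (measurable_from_top (f := fun k : ℕ => (k : ℕ∞))).comp h

theorem measurable_moebius {f : Set 𝔼 → ℝ} (hf : Measurable[configSpace d] f) (n : ℕ) :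
    Measurable fun x : Fin n → 𝔼 => moebius f x := by
  refine Finset.measurable_sum _ fun S _ => ?_
  exact (hf.comp (measurable_image_tuple S)).const_mul _

variable {Ω : Type*} [MeasurableSpace Ω] {P : Measure Ω} {X : Ω → Set (EuclideanSpace ℝ (Fin d))}
  {μ : Measure (EuclideanSpace ℝ (Fin d))}
  {K : EuclideanSpace ℝ (Fin d) → EuclideanSpace ℝ (Fin d) → ℝ}

/-- The points of a point process in a bounded set, as a finite set. -/
noncomputable def pointsIn (hX : IsSimplePointProcess X) {Q : Set 𝔼}
    (hQ : Bornology.IsBounded Q) (ω : Ω) : Finset 𝔼 :=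
  (hX.locallyFinite ω Q hQ).toFinset

theorem measurable_sum_pointsIn (hX : IsSimplePointProcess X) {Q : Set 𝔼}
    (hQ : Bornology.IsBounded Q) (hQm : MeasurableSet Q) (s : Set 𝔼) (hs : MeasurableSet s) :
    Measurable fun ω => ∑ z ∈ pointsIn hX hQ ω, s.indicator (1 : 𝔼 → ℝ≥0∞) z := by
  classical
  have h : ∀ ω, ∑ z ∈ pointsIn hX hQ ω, s.indicator (1 : 𝔼 → ℝ≥0∞) z =
      (((X ω ∩ (Q ∩ s)).encard : ℕ∞) : ℝ≥0∞) := by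
    intro ω
    have : X ω ∩ (Q ∩ s) = ((pointsIn hX hQ ω).filter (· ∈ s) : Finset 𝔼) := by
      ext z
      simp only [pointsIn, Finset.coe_filter, Set.Finite.mem_toFinset, Set.mem_inter_iff,
        Set.mem_ofPred_eq, and_assoc]
    rw [this, Set.encard_coe_eq_coe_finsetCard, Finset.card_filter]
    simp [Set.indicator_apply]
  simp_rw [h]
  have h1 := (measurable_encard_inter (hQ.subset Set.inter_subset_left)
    (hQm.inter hs)).comp hX.measurable
  exact (measurable_from_top (f := fun k : ℕ∞ => (k : ℝ≥0∞))).comp h1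

theorem sumDistinct_indicator (hX : IsSimplePointProcess X) {Q : Set 𝔼}
    (hQ : Bornology.IsBounded Q) (ω : Ω) {n : ℕ} {f : (Fin n → 𝔼) → ℝ≥0∞}
    (hf : ∀ x, f x ≠ 0 → ∀ i, x i ∈ Q) :
    sumDistinct (X ω) f = ∑ x ∈ tuples n (pointsIn hX hQ ω), f x := by
  rw [sumDistinct, ← Finset.tsum_subtype]
  have h1 := tsum_subtype {x : Fin n → 𝔼 | Function.Injective x ∧ ∀ i, x i ∈ X ω} f
  have h2 := tsum_subtype ((tuples n (pointsIn hX hQ ω) : Finset _) : Set (Fin n → 𝔼)) f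
  refine h1.trans (Eq.trans ?_ h2.symm)
  congr 1
  ext x
  by_cases hx : f x = 0
  · simp [Set.indicator_apply, hx]
  · have hQx := hf x hx
    have hiff : (x ∈ {x : Fin n → 𝔼 | Function.Injective x ∧ ∀ i, x i ∈ X ω}) ↔
        x ∈ ((tuples n (pointsIn hX hQ ω) : Finset _) : Set (Fin n → 𝔼)) := by
      simp only [Set.mem_ofPred_eq, Finset.mem_coe, mem_tuples, pointsIn,
        Set.Finite.mem_toFinset, Set.mem_inter_iff, hQx, and_true]
    by_cases h : x ∈ ((tuples n (pointsIn hX hQ ω) : Finset _) : Set (Fin n → 𝔼))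
    · rw [Set.indicator_of_mem h, Set.indicator_of_mem (hiff.mpr h)]
    · rw [Set.indicator_of_notMem h, Set.indicator_of_notMem (fun h' => h (hiff.mp h'))]

/-- The intensity formula, also for `n = 0`, for functions supported in a bounded set. -/
theorem lintegral_sum_tuples [IsProbabilityMeasure P] [SigmaFinite μ] (hX : IsDPP P X μ K)
    {Q : Set 𝔼} (hQ : Bornology.IsBounded Q) {n : ℕ} {f : (Fin n → 𝔼) → ℝ≥0∞} (hfm : Measurable f)
    (hf : ∀ x, f x ≠ 0 → ∀ i, x i ∈ Q) :
    ∫⁻ ω, ∑ x ∈ tuples n (pointsIn hX.1 hQ ω), f x ∂P =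
      ∫⁻ x, f x * ENNReal.ofReal (kernelMatrix K x).det ∂(Measure.pi fun _ => μ) := by
  rcases Nat.eq_zero_or_pos n with rfl | hn
  · have h1 : ∀ ω, ∑ x ∈ tuples 0 (pointsIn hX.1 hQ ω), f x = f Fin.elim0 := by
      intro ω
      rw [Finset.sum_eq_single Fin.elim0]
      · intro b _ hb; exact absurd (Subsingleton.elim _ _) hb
      · intro h
        exact absurd (mem_tuples.mpr ⟨fun i => i.elim0, fun i => i.elim0⟩) h
    have h2 : ∀ x : Fin 0 → 𝔼, f x = f Fin.elim0 := fun x => congrArg f (Subsingleton.elim _ _)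
    simp_rw [h1]
    simp [h2]
  · rw [← (hX.2 n hn).2 f hfm]
    refine lintegral_congr fun ω => ?_
    rw [sumDistinct_indicator hX.1 hQ ω hf]

end Expectation

section Expectation

variable {d : ℕ}

local notation "𝔼" => EuclideanSpace ℝ (Fin d)

theorem measurable_det_kernelMatrix {α β : Type*} [MeasurableSpace α] [MeasurableSpace β]
    {ι : Type*} [Fintype ι] [DecidableEq ι] {K : α → α → ℝ}
    (hK : Measurable (Function.uncurry K)) {g : β → ι → α} (hg : Measurable g) :
    Measurable fun b => (kernelMatrix K (g b)).det := by
  simp_rw [Matrix.det_apply']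
  refine Finset.measurable_sum _ fun σ _ => Measurable.const_mul ?_ _
  refine Finset.measurable_prod _ fun i _ => ?_
  exact hK.comp (((measurable_pi_apply _).comp hg).prodMk ((measurable_pi_apply _).comp hg))

variable {Ω : Type*} [MeasurableSpace Ω] {P : Measure Ω} {X : Ω → Set (EuclideanSpace ℝ (Fin d))}
  {μ : Measure (EuclideanSpace ℝ (Fin d))}
  {K : EuclideanSpace ℝ (Fin d) → EuclideanSpace ℝ (Fin d) → ℝ}

/-- Bounds of the intensities `det (K (x i) (x j))`, valid almost everywhere for a determinantal
point process with kernel at most `c`. -/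
def IntensityBound (μ : Measure 𝔼) (K : 𝔼 → 𝔼 → ℝ) (c : ℝ) : Prop :=
  ∀ n : ℕ, ∀ᵐ x ∂(Measure.pi fun _ : Fin n => μ),
    0 ≤ (kernelMatrix K x).det ∧ (kernelMatrix K x).det ≤ c ^ n

theorem integrable_mul_det [SigmaFinite μ] (hKm : Measurable (Function.uncurry K)) {c : ℝ}
    (hρ : IntensityBound μ K c) {Q : Set 𝔼} (hQ : μ Q ≠ ∞) {n : ℕ}
    {φ : (Fin n → 𝔼) → ℝ} (hφm : Measurable φ) {C : ℝ} (hC : ∀ x, |φ x| ≤ C)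
    (hφ : ∀ x, φ x ≠ 0 → ∀ i, x i ∈ Q) :
    Integrable (fun x => φ x * (kernelMatrix K x).det) (Measure.pi fun _ => μ) := by
  have hmeas : Measurable fun x => φ x * (kernelMatrix K x).det :=
    hφm.mul (measurable_det_kernelMatrix hKm measurable_id)
  have hsupp : Function.support (fun x => φ x * (kernelMatrix K x).det) ⊆
      Set.univ.pi fun _ => Q := by
    intro x hx i _
    exact hφ x (left_ne_zero_of_mul hx) i
  rw [← integrableOn_iff_integrable_of_support_subset hsupp]
  refine Measure.integrableOn_of_bounded (M := C * c ^ n) ?_ hmeas.aestronglyMeasurable ?_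
  · rw [Measure.pi_pi]
    exact ENNReal.prod_ne_top fun _ _ => hQ
  · refine ae_restrict_of_ae ?_
    filter_upwards [hρ n] with x hx
    rw [Real.norm_eq_abs, abs_mul, abs_of_nonneg hx.1]
    exact mul_le_mul (hC x) hx.2 hx.1 ((abs_nonneg _).trans (hC x))

theorem integral_sum_tuples [IsProbabilityMeasure P] [SigmaFinite μ] (hX : IsDPP P X μ K)
    (hKm : Measurable (Function.uncurry K)) {c : ℝ} (hρ : IntensityBound μ K c)
    {Q : Set 𝔼} (hQb : Bornology.IsBounded Q) (hQm : MeasurableSet Q) (hQ : μ Q ≠ ∞) {n : ℕ}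
    {φ : (Fin n → 𝔼) → ℝ} (hφm : Measurable φ) {C : ℝ} (hC : ∀ x, |φ x| ≤ C)
    (hφ : ∀ x, φ x ≠ 0 → ∀ i, x i ∈ Q) :
    Integrable (fun ω => ∑ x ∈ tuples n (pointsIn hX.1 hQb ω), φ x) P ∧
    ∫ ω, ∑ x ∈ tuples n (pointsIn hX.1 hQb ω), φ x ∂P =
      ∫ x, φ x * (kernelMatrix K x).det ∂(Measure.pi fun _ => μ) := by
  have hint := integrable_mul_det hKm hρ hQ hφm hC hφ
  -- The claim holds for the positive and for the negative part of `φ`.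
  have part : ∀ ψ : (Fin n → 𝔼) → ℝ, Measurable ψ → (∀ x, ψ x ≠ 0 → ∀ i, x i ∈ Q) →
      Integrable (fun x => ψ x * (kernelMatrix K x).det) (Measure.pi fun _ => μ) →
      Integrable (fun ω => (∑ x ∈ tuples n (pointsIn hX.1 hQb ω), ENNReal.ofReal (ψ x)).toReal) P ∧
      ∫ ω, (∑ x ∈ tuples n (pointsIn hX.1 hQb ω), ENNReal.ofReal (ψ x)).toReal ∂P =
        (∫⁻ x, ENNReal.ofReal (ψ x * (kernelMatrix K x).det) ∂(Measure.pi fun _ => μ)).toReal := by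
    intro ψ hψm hψ hψi
    have h1 := lintegral_sum_tuples hX hQb (f := fun x => ENNReal.ofReal (ψ x))
      hψm.ennreal_ofReal (fun x hx => hψ x fun h => hx (by simp [h]))
    have h2 : ∫⁻ x, ENNReal.ofReal (ψ x) * ENNReal.ofReal (kernelMatrix K x).det
        ∂(Measure.pi fun _ => μ) =
        ∫⁻ x, ENNReal.ofReal (ψ x * (kernelMatrix K x).det) ∂(Measure.pi fun _ => μ) := by
      refine lintegral_congr_ae ?_
      filter_upwards [hρ n] with x hx
      rw [ENNReal.ofReal_mul' hx.1]
    have h3 : ∫⁻ x, ENNReal.ofReal (ψ x * (kernelMatrix K x).det) ∂(Measure.pi fun _ => μ) ≠ ∞ :=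
      hψi.lintegral_lt_top.ne
    rw [h2] at h1
    have hm : Measurable fun ω => ∑ x ∈ tuples n (pointsIn hX.1 hQb ω), ENNReal.ofReal (ψ x) :=
      measurable_sum_tuples (measurable_sum_pointsIn hX.1 hQb hQm) hψm.ennreal_ofReal
    refine ⟨integrable_toReal_of_lintegral_ne_top hm.aemeasurable (h1 ▸ h3), ?_⟩
    rw [integral_toReal hm.aemeasurable, h1]
    exact Filter.Eventually.of_forall fun ω => ENNReal.sum_lt_top.mpr fun _ _ =>
      ENNReal.ofReal_lt_top
  obtain ⟨hp1, hp2⟩ := part φ hφm hφ hint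
  obtain ⟨hn1, hn2⟩ := part (fun x => -φ x) hφm.neg (fun x hx => hφ x (by simpa using hx))
    (by simpa using hint.neg)
  have hsplit : ∀ ω, ∑ x ∈ tuples n (pointsIn hX.1 hQb ω), φ x =
      (∑ x ∈ tuples n (pointsIn hX.1 hQb ω), ENNReal.ofReal (φ x)).toReal -
      (∑ x ∈ tuples n (pointsIn hX.1 hQb ω), ENNReal.ofReal (-φ x)).toReal := by
    intro ω
    rw [ENNReal.toReal_sum fun _ _ => ENNReal.ofReal_ne_top,
      ENNReal.toReal_sum fun _ _ => ENNReal.ofReal_ne_top, ← Finset.sum_sub_distrib]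
    refine Finset.sum_congr rfl fun x _ => ?_
    rw [ENNReal.toReal_ofReal', ENNReal.toReal_ofReal']
    exact (max_zero_sub_max_neg_zero_eq_self _).symm
  simp_rw [hsplit]
  refine ⟨hp1.sub hn1, ?_⟩
  rw [integral_sub hp1 hn1, hp2, hn2, integral_eq_lintegral_pos_part_sub_lintegral_neg_part hint]
  simp only [neg_mul]

/-- The weight of a pair of tuples, one in `A` and one in `B`, in the expansion of
`E f(X ∩ A) g(X ∩ B)`. -/
noncomputable def moebiusPair (f g : Set 𝔼 → ℝ) (A B : Set 𝔼) (m n : ℕ)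
    (w : Fin (m + n) → 𝔼) : ℝ :=
  (Set.univ.pi fun _ => A).indicator (fun x : Fin m → 𝔼 => moebius f x)
      (fun i => w (Fin.castAdd n i)) *
    (Set.univ.pi fun _ => B).indicator (fun y : Fin n → 𝔼 => moebius g y)
      (fun i => w (Fin.natAdd m i))

theorem measurable_moebiusPair {f g : Set 𝔼 → ℝ} (hf : Measurable[configSpace d] f)
    (hg : Measurable[configSpace d] g) {A B : Set 𝔼} (hA : MeasurableSet A) (hB : MeasurableSet B)
    (m n : ℕ) : Measurable (moebiusPair f g A B m n) := by
  refine Measurable.mul ?_ ?_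
  · exact ((measurable_moebius hf m).indicator (MeasurableSet.univ_pi fun _ => hA)).comp
      (measurable_pi_iff.mpr fun i => measurable_pi_apply _)
  · exact ((measurable_moebius hg n).indicator (MeasurableSet.univ_pi fun _ => hB)).comp
      (measurable_pi_iff.mpr fun i => measurable_pi_apply _)

theorem abs_moebiusPair_le {f g : Set 𝔼 → ℝ} (hf : ∀ s, |f s| ≤ 1) (hg : ∀ s, |g s| ≤ 1)
    (A B : Set 𝔼) (m n : ℕ) (w : Fin (m + n) → 𝔼) :
    |moebiusPair f g A B m n w| ≤ 2 ^ m * 2 ^ n := by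
  rw [moebiusPair, abs_mul]
  have h1 : ∀ {k : ℕ} {h : Set 𝔼 → ℝ} (_ : ∀ s, |h s| ≤ 1) (s : Set (Fin k → 𝔼)) (x : Fin k → 𝔼),
      |s.indicator (fun x => moebius h x) x| ≤ 2 ^ k := by
    classical
    intro k h hh s x
    rw [Set.indicator_apply]
    split_ifs
    · exact abs_moebius_le hh x
    · simp
  exact mul_le_mul (h1 hf _ _) (h1 hg _ _) (abs_nonneg _) (by positivity)

theorem mem_of_moebiusPair_ne_zero {f g : Set 𝔼 → ℝ} {A B : Set 𝔼} {m n : ℕ}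
    {w : Fin (m + n) → 𝔼} (h : moebiusPair f g A B m n w ≠ 0) (i : Fin (m + n)) : w i ∈ A ∪ B := by
  have h1 := Set.mem_of_indicator_ne_zero (left_ne_zero_of_mul h)
  have h2 := Set.mem_of_indicator_ne_zero (right_ne_zero_of_mul h)
  simp only [Set.mem_pi, Set.mem_univ, forall_const] at h1 h2
  refine Fin.addCases (fun i => Or.inl (h1 i)) (fun i => Or.inr (h2 i)) i

theorem integral_moebiusPair_mul_det [SigmaFinite μ] (f g : Set 𝔼 → ℝ)
    {A B : Set 𝔼} (hA : MeasurableSet A) (hB : MeasurableSet B) (m n : ℕ)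
    (hKm : Measurable (Function.uncurry K))
    (hf : Measurable[configSpace d] f) (hg : Measurable[configSpace d] g) :
    ∫ w, moebiusPair f g A B m n w * (kernelMatrix K w).det ∂(Measure.pi fun _ => μ) =
      ∫ z : (Fin m → 𝔼) × (Fin n → 𝔼),
        moebius f z.1 * moebius g z.2 * (kernelMatrix K (Fin.append z.1 z.2)).det
        ∂((Measure.pi fun _ => μ.restrict A).prod (Measure.pi fun _ => μ.restrict B)) := by
  have hmeas : Measurable fun w => moebiusPair f g A B m n w * (kernelMatrix K w).det :=
    (measurable_moebiusPair hf hg hA hB m n).mul (measurable_det_kernelMatrix hKm measurable_id)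
  rw [← (measurePreserving_append μ m n).map_eq,
    integral_map (measurable_append m n).aemeasurable hmeas.aestronglyMeasurable]
  have hr : (Measure.pi fun _ : Fin m => μ.restrict A).prod
      (Measure.pi fun _ : Fin n => μ.restrict B) =
      ((Measure.pi fun _ : Fin m => μ).prod (Measure.pi fun _ : Fin n => μ)).restrict
        ((Set.univ.pi fun _ => A) ×ˢ (Set.univ.pi fun _ => B)) := by
    rw [← Measure.prod_restrict, Measure.restrict_pi_pi, Measure.restrict_pi_pi]
  rw [hr, ← integral_indicator
    ((MeasurableSet.univ_pi fun _ => hA).prod (MeasurableSet.univ_pi fun _ => hB))]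
  congr 1
  ext ⟨x, y⟩
  by_cases hx : x ∈ Set.univ.pi fun _ => A <;> by_cases hy : y ∈ Set.univ.pi fun _ => B <;>
    simp only [moebiusPair, Fin.append_left, Fin.append_right, Set.indicator, Set.mem_prod, hx, hy,
      and_true, and_false, if_true, if_false, mul_zero, zero_mul]

theorem integral_abs_moebiusPair_mul_det_le [SigmaFinite μ] {f g : Set 𝔼 → ℝ}
    (hf1 : ∀ s, |f s| ≤ 1) (hg1 : ∀ s, |g s| ≤ 1)
    {A B : Set 𝔼} (hA : MeasurableSet A) (hB : MeasurableSet B) (hAfin : μ A ≠ ∞) (hBfin : μ B ≠ ∞)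
    (m n : ℕ) {c : ℝ} (hρ : IntensityBound μ K c) :
    ∫ w, |moebiusPair f g A B m n w| * (kernelMatrix K w).det ∂(Measure.pi fun _ => μ) ≤
      (2 * c * μ.real A) ^ m * (2 * c * μ.real B) ^ n := by
  set S : Set (Fin (m + n) → 𝔼) := Set.univ.pi (Fin.append (fun _ : Fin m => A) fun _ : Fin n => B)
    with hS
  have hSm : MeasurableSet S := MeasurableSet.univ_pi fun i => by
    refine Fin.addCases (fun i => ?_) (fun i => ?_) i <;> simpa
  have hSμ : (Measure.pi fun _ : Fin (m + n) => μ) S = μ A ^ m * μ B ^ n := by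
    rw [hS, Measure.pi_pi, Fin.prod_univ_add]; simp
  have hSfin : (Measure.pi fun _ : Fin (m + n) => μ) S ≠ ∞ := by
    rw [hSμ]; exact ENNReal.mul_ne_top (ENNReal.pow_ne_top hAfin) (ENNReal.pow_ne_top hBfin)
  calc ∫ w, |moebiusPair f g A B m n w| * (kernelMatrix K w).det ∂(Measure.pi fun _ => μ)
      ≤ ∫ w, S.indicator (fun _ => 2 ^ m * 2 ^ n * c ^ (m + n)) w ∂(Measure.pi fun _ => μ) := by
        refine integral_mono_of_nonneg ?_ ?_ ?_
        · filter_upwards [hρ (m + n)] with w hw using mul_nonneg (abs_nonneg _) hw.1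
        · exact (integrable_indicator_iff hSm).mpr (integrableOn_const hSfin)
        · filter_upwards [hρ (m + n)] with w hw
          by_cases hwS : w ∈ S
          · rw [Set.indicator_of_mem hwS]
            exact mul_le_mul (abs_moebiusPair_le hf1 hg1 A B m n w) hw.2 hw.1 (by positivity)
          · rw [Set.indicator_of_notMem hwS]
            have : moebiusPair f g A B m n w = 0 := by
              by_contra h
              have h1 := Set.mem_of_indicator_ne_zero (left_ne_zero_of_mul h)
              have h2 := Set.mem_of_indicator_ne_zero (right_ne_zero_of_mul h)
              simp only [Set.mem_pi, Set.mem_univ, forall_const] at h1 h2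
              refine hwS fun i _ => ?_
              refine Fin.addCases (fun i => ?_) (fun i => ?_) i
              · simpa using h1 i
              · simpa using h2 i
            simp [this]
    _ = (2 * c * μ.real A) ^ m * (2 * c * μ.real B) ^ n := by
        rw [integral_indicator hSm, setIntegral_const, Measure.real, hSμ, ENNReal.toReal_mul,
          ENNReal.toReal_pow, ENNReal.toReal_pow, smul_eq_mul, mul_pow, mul_pow, mul_pow, mul_pow,
          pow_add, Measure.real, Measure.real]
        ring

theorem summable_pow_mul_pow_div_factorial (a b : ℝ) :
    Summable fun z : ℕ × ℕ =>
      (z.1.factorial : ℝ)⁻¹ * (z.2.factorial : ℝ)⁻¹ * (a ^ z.1 * b ^ z.2) := by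
  have h := summable_mul_of_summable_norm (Real.summable_pow_div_factorial a).norm
    (Real.summable_pow_div_factorial b).norm
  refine h.congr fun z => ?_
  field_simp

/-- The expectation of a product of functionals of `X ∩ A` and `X ∩ B` in terms of the
intensities, for disjoint bounded sets `A`, `B`. -/
theorem hasSum_integral_mul [IsProbabilityMeasure P] [SigmaFinite μ] (hX : IsDPP P X μ K)
    (hKm : Measurable (Function.uncurry K)) {c : ℝ} (hρ : IntensityBound μ K c)
    {A B : Set 𝔼} (hAB : Disjoint A B) (hAb : Bornology.IsBounded A) (hBb : Bornology.IsBounded B)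
    (hA : MeasurableSet A) (hB : MeasurableSet B) (hAfin : μ A ≠ ∞) (hBfin : μ B ≠ ∞)
    {f g : Set 𝔼 → ℝ} (hf : Measurable[configSpace d] f) (hg : Measurable[configSpace d] g)
    (hf1 : ∀ s, |f s| ≤ 1) (hg1 : ∀ s, |g s| ≤ 1) :
    HasSum (fun k : ℕ × ℕ => (k.1.factorial : ℝ)⁻¹ * (k.2.factorial : ℝ)⁻¹ *
      ∫ z : (Fin k.1 → 𝔼) × (Fin k.2 → 𝔼),
        moebius f z.1 * moebius g z.2 * (kernelMatrix K (Fin.append z.1 z.2)).det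
        ∂((Measure.pi fun _ => μ.restrict A).prod (Measure.pi fun _ => μ.restrict B)))
      (∫ ω, f (X ω ∩ A) * g (X ω ∩ B) ∂P) := by
  classical
  have hQb : Bornology.IsBounded (A ∪ B) := hAb.union hBb
  have hQm : MeasurableSet (A ∪ B) := hA.union hB
  have hQ : μ (A ∪ B) ≠ ∞ := (measure_union_lt_top hAfin.lt_top hBfin.lt_top).ne
  set F : ℕ × ℕ → Ω → ℝ := fun k ω => (k.1.factorial : ℝ)⁻¹ * (k.2.factorial : ℝ)⁻¹ *
    ∑ w ∈ tuples (k.1 + k.2) (pointsIn hX.1 hQb ω), moebiusPair f g A B k.1 k.2 w with hF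
  have key := fun k : ℕ × ℕ => integral_sum_tuples hX hKm hρ hQb hQm hQ
    (measurable_moebiusPair hf hg hA hB k.1 k.2) (abs_moebiusPair_le hf1 hg1 A B k.1 k.2)
    (fun w hw => mem_of_moebiusPair_ne_zero hw)
  have keyabs := fun k : ℕ × ℕ => integral_sum_tuples hX hKm hρ hQb hQm hQ
    (φ := fun w => |moebiusPair f g A B k.1 k.2 w|)
    (measurable_moebiusPair hf hg hA hB k.1 k.2).abs
    (fun w => (abs_abs _).le.trans (abs_moebiusPair_le hf1 hg1 A B k.1 k.2 w))
    (fun w hw => mem_of_moebiusPair_ne_zero (by simpa using hw))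
  have hFint : ∀ k, Integrable (F k) P := fun k => (key k).1.const_mul _
  have hFsum : Summable fun k => ∫ ω, ‖F k ω‖ ∂P := by
    refine Summable.of_nonneg_of_le (fun k => integral_nonneg fun ω => norm_nonneg _) (fun k => ?_)
      (summable_pow_mul_pow_div_factorial (2 * c * μ.real A) (2 * c * μ.real B))
    calc ∫ ω, ‖F k ω‖ ∂P ≤ ∫ ω, (k.1.factorial : ℝ)⁻¹ * (k.2.factorial : ℝ)⁻¹ *
          ∑ w ∈ tuples (k.1 + k.2) (pointsIn hX.1 hQb ω), |moebiusPair f g A B k.1 k.2 w| ∂P := by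
          refine integral_mono (hFint k).norm ((keyabs k).1.const_mul _) fun ω => ?_
          simp only [hF]
          rw [norm_mul, Real.norm_of_nonneg (by positivity : (0:ℝ) ≤
            (k.1.factorial : ℝ)⁻¹ * (k.2.factorial : ℝ)⁻¹), Real.norm_eq_abs]
          gcongr
          exact Finset.abs_sum_le_sum_abs _ _
      _ ≤ _ := by
          rw [integral_const_mul, (keyabs k).2]
          gcongr
          exact integral_abs_moebiusPair_mul_det_le hf1 hg1 hA hB hAfin hBfin k.1 k.2 hρ
  have hmain := hasSum_integral_of_summable_integral_norm hFint hFsum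
  have h1 : ∀ ω, ∑' k, F k ω = f (X ω ∩ A) * g (X ω ∩ B) := by
    intro ω
    set Y := pointsIn hX.1 hQb ω
    have hYA : ((Y.filter (· ∈ A) : Finset 𝔼) : Set 𝔼) = X ω ∩ A := by
      ext z
      simp only [Y, pointsIn, Finset.coe_filter, Set.Finite.mem_toFinset, Set.mem_inter_iff,
        Set.mem_ofPred_eq, Set.mem_union]
      tauto
    have hYB : ((Y.filter (· ∈ B) : Finset 𝔼) : Set 𝔼) = X ω ∩ B := by
      ext z
      simp only [Y, pointsIn, Finset.coe_filter, Set.Finite.mem_toFinset, Set.mem_inter_iff,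
        Set.mem_ofPred_eq, Set.mem_union]
      tauto
    have hsA := hasSum_sum_tuples_moebius f (Y.filter (· ∈ A))
    have hsB := hasSum_sum_tuples_moebius g (Y.filter (· ∈ B))
    rw [hYA] at hsA
    rw [hYB] at hsB
    have hs := hsA.mul hsB (summable_mul_of_summable_norm
      (f := fun m : ℕ => (m.factorial : ℝ)⁻¹ * ∑ x ∈ tuples m (Y.filter (· ∈ A)), moebius f x)
      (g := fun n : ℕ => (n.factorial : ℝ)⁻¹ * ∑ x ∈ tuples n (Y.filter (· ∈ B)), moebius g x)
      hsA.summable.norm hsB.summable.norm)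
    rw [← hs.tsum_eq]
    refine tsum_congr fun k => ?_
    simp only [hF, moebiusPair]
    rw [sum_tuples_append hAB]
    ring
  simp_rw [h1] at hmain
  have h2 : ∀ k, ∫ ω, F k ω ∂P = _ := fun k => by
    simp only [hF]
    rw [integral_const_mul, (key k).2, integral_moebiusPair_mul_det f g hA hB k.1 k.2 hKm hf hg]
  simpa only [h2] using hmain

end Expectation

/-! ### The upper bound -/

section UpperBound

variable {d : ℕ}

local notation "𝔼" => EuclideanSpace ℝ (Fin d)

theorem det_kernelMatrix_append {α : Type*} {K : α → α → ℝ} (hsymm : ∀ x y, K x y = K y x)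
    {m n : ℕ} (x : Fin m → α) (y : Fin n → α) :
    (kernelMatrix K (Fin.append x y)).submatrix finSumFinEquiv finSumFinEquiv =
      Matrix.fromBlocks (kernelMatrix K x) (Matrix.of fun i j => K (x i) (y j))
        (Matrix.of fun i j => K (x i) (y j)).transpose (kernelMatrix K y) := by
  ext i j
  rcases i with i | i <;> rcases j with j | j <;> simp [hsymm (y _) (x _)]

/-- The decoupling error of the intensities is quadratic in the interaction `K (x i) (y j)`. -/
theorem abs_det_append_sub_le {α : Type*} {K : α → α → ℝ} (hsymm : ∀ x y, K x y = K y x)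
    {c : ℝ} (hc : ∀ x, K x x ≤ c) {m n : ℕ} (x : Fin m → α) (y : Fin n → α)
    (h : (kernelMatrix K (Fin.append x y)).PosSemidef) :
    |(kernelMatrix K (Fin.append x y)).det - (kernelMatrix K x).det * (kernelMatrix K y).det| ≤
      c ^ (m - 1) * c ^ (n - 1) * (m * n) * ∑ i, ∑ j, K (x i) (y j) ^ 2 := by
  have hdet : (kernelMatrix K (Fin.append x y)).det =
      (Matrix.fromBlocks (kernelMatrix K x) (Matrix.of fun i j => K (x i) (y j))
        (Matrix.of fun i j => K (x i) (y j)).transpose (kernelMatrix K y)).det := by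
    rw [← det_kernelMatrix_append hsymm, Matrix.det_submatrix_equiv_self]
  have h' := h.submatrix finSumFinEquiv
  rw [det_kernelMatrix_append hsymm] at h'
  rcases m with _ | m
  · have h0 : (Matrix.of fun (i : Fin 0) (j : Fin n) => K (x i) (y j)) = 0 := by
      ext i; exact i.elim0
    rw [hdet, h0, Matrix.transpose_zero, Matrix.det_fromBlocks_zero₂₁]
    simp
  rcases n with _ | n
  · have h0 : (Matrix.of fun (i : Fin (m + 1)) (j : Fin 0) => K (x i) (y j)) = 0 := by
      ext _ j; exact j.elim0
    rw [hdet, h0, Matrix.transpose_zero, Matrix.det_fromBlocks_zero₂₁]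
    simp
  · obtain ⟨h1, h2⟩ := PosSemidef.det_mul_det_sub_det_fromBlocks (c := c) h'
      (fun i => hc _) (fun i => hc _)
    rw [hdet, abs_sub_comm, abs_of_nonneg h1]
    simpa using h2

variable {Ω : Type*} [MeasurableSpace Ω] {P : Measure Ω} {X : Ω → Set (EuclideanSpace ℝ (Fin d))}
  {μ : Measure (EuclideanSpace ℝ (Fin d))}
  {K : EuclideanSpace ℝ (Fin d) → EuclideanSpace ℝ (Fin d) → ℝ}

theorem IsDPP.ae_posSemidef [SigmaFinite μ] (hX : IsDPP P X μ K) (hsymm : ∀ x y, K x y = K y x)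
    (n : ℕ) : ∀ᵐ x ∂(Measure.pi fun _ : Fin n => μ), (kernelMatrix K x).PosSemidef :=
  ae_posSemidef_kernelMatrix μ hsymm (fun n hn => (hX.2 n hn).1) n

theorem IsDPP.intensityBound [SigmaFinite μ] (hX : IsDPP P X μ K) (hsymm : ∀ x y, K x y = K y x)
    {c : ℝ} (hc : ∀ x, K x x ≤ c) : IntensityBound μ K c := by
  intro n
  filter_upwards [hX.ae_posSemidef hsymm n] with x hx
  refine ⟨hx.det_nonneg, ?_⟩
  simpa using det_le_pow_card hx (c := c) fun i => hc _

/-- The expectation of a functional of `X ∩ A` in terms of the intensities. -/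
theorem hasSum_integral [IsProbabilityMeasure P] [SigmaFinite μ] (hX : IsDPP P X μ K)
    (hKm : Measurable (Function.uncurry K)) {c : ℝ} (hρ : IntensityBound μ K c)
    {A : Set 𝔼} (hAb : Bornology.IsBounded A)
    (hA : MeasurableSet A) (hAfin : μ A ≠ ∞)
    {f : Set 𝔼 → ℝ} (hf : Measurable[configSpace d] f) (hf1 : ∀ s, |f s| ≤ 1) :
    HasSum (fun m : ℕ => (m.factorial : ℝ)⁻¹ *
      ∫ x : Fin m → 𝔼, moebius f x * (kernelMatrix K x).det
        ∂(Measure.pi fun _ => μ.restrict A))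
      (∫ ω, f (X ω ∩ A) ∂P) := by
  have h := hasSum_integral_mul hX hKm hρ (Set.disjoint_empty A) hAb Bornology.isBounded_empty hA
    MeasurableSet.empty hAfin (by simp) hf (@measurable_const _ _ _ (configSpace d) 1) hf1
    (by simp)
  have hinj : Function.Injective fun m : ℕ => (m, 0) := fun a b hab => congrArg Prod.fst hab
  rw [← hinj.hasSum_iff] at h
  · simp only [mul_one] at h
    refine h.congr_fun fun m => ?_
    simp only [Function.comp_apply]
    have h1 : ∀ z : (Fin m → 𝔼) × (Fin 0 → 𝔼), moebius f z.1 * moebius (fun _ => 1) z.2 *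
        (kernelMatrix K (Fin.append z.1 z.2)).det = moebius f z.1 * (kernelMatrix K z.1).det := by
      intro z
      rw [moebius_fin_zero, mul_one, Fin.append_right_nil _ _ rfl]
      rfl
    rw [Nat.factorial_zero, Nat.cast_one, inv_one, mul_one]
    congr 1
    rw [integral_congr_ae (Filter.Eventually.of_forall h1),
      integral_fun_fst (fun x : Fin m → 𝔼 => moebius f x * (kernelMatrix K x).det)]
    simp [Measure.real, Measure.pi_empty_univ]
  · rintro ⟨m, n⟩ hn
    have hn0 : n ≠ 0 := by
      rintro rfl
      exact hn ⟨m, rfl⟩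
    simp [moebius_const_one_of_pos hn0]

theorem ae_append_restrict [SigmaFinite μ] (A B : Set 𝔼) {m n : ℕ} {p : (Fin (m + n) → 𝔼) → Prop}
    (h : ∀ᵐ w ∂(Measure.pi fun _ => μ), p w) :
    ∀ᵐ z : (Fin m → 𝔼) × (Fin n → 𝔼)
      ∂((Measure.pi fun _ => μ.restrict A).prod (Measure.pi fun _ => μ.restrict B)),
      p (Fin.append z.1 z.2) := by
  rw [← Measure.restrict_pi_pi, ← Measure.restrict_pi_pi, Measure.prod_restrict]
  exact ae_restrict_of_ae ((measurePreserving_append μ m n).quasiMeasurePreserving.ae h)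

/-- The measure `μ^m × μ^n` on `A^m × B^n`. -/
noncomputable abbrev tupleMeasure (μ : Measure 𝔼) (A B : Set 𝔼) (m n : ℕ) :
    Measure ((Fin m → 𝔼) × (Fin n → 𝔼)) :=
  (Measure.pi fun _ => μ.restrict A).prod (Measure.pi fun _ => μ.restrict B)

/-- The difference between the joint intensity and the product of the intensities. -/
def decouplingError (K : 𝔼 → 𝔼 → ℝ) {m n : ℕ} (z : (Fin m → 𝔼) × (Fin n → 𝔼)) : ℝ :=
  (kernelMatrix K (Fin.append z.1 z.2)).det - (kernelMatrix K z.1).det * (kernelMatrix K z.2).det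

theorem integrable_mul_append [SigmaFinite μ] (hKm : Measurable (Function.uncurry K)) {c : ℝ}
    (hρ : IntensityBound μ K c) {A B : Set 𝔼} (hA : μ A ≠ ∞) (hB : μ B ≠ ∞) {m n : ℕ}
    {φ : (Fin m → 𝔼) × (Fin n → 𝔼) → ℝ} (hφm : Measurable φ) {C : ℝ} (hC : ∀ z, |φ z| ≤ C) :
    Integrable (fun z => φ z * (kernelMatrix K (Fin.append z.1 z.2)).det)
        (tupleMeasure μ A B m n) ∧
      Integrable (fun z => φ z * ((kernelMatrix K z.1).det * (kernelMatrix K z.2).det))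
        (tupleMeasure μ A B m n) := by
  have : IsFiniteMeasure (μ.restrict A) := isFiniteMeasure_restrict.mpr hA
  have : IsFiniteMeasure (μ.restrict B) := isFiniteMeasure_restrict.mpr hB
  have h1 := ae_append_restrict A B (hρ (m + n))
  have h2 : ∀ᵐ z ∂(tupleMeasure μ A B m n),
      0 ≤ (kernelMatrix K z.1).det ∧ (kernelMatrix K z.1).det ≤ c ^ m :=
    Measure.quasiMeasurePreserving_fst.ae (ae_pi_restrict_of_ae μ A (hρ m))
  have h3 : ∀ᵐ z ∂(tupleMeasure μ A B m n),
      0 ≤ (kernelMatrix K z.2).det ∧ (kernelMatrix K z.2).det ≤ c ^ n :=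
    Measure.quasiMeasurePreserving_snd.ae (ae_pi_restrict_of_ae μ B (hρ n))
  constructor
  · refine Integrable.of_bound (hφm.mul
      (measurable_det_kernelMatrix hKm (measurable_append m n))).aestronglyMeasurable
      (C * c ^ (m + n)) ?_
    filter_upwards [h1] with z hz
    rw [Real.norm_eq_abs, abs_mul, abs_of_nonneg hz.1]
    exact mul_le_mul (hC z) hz.2 hz.1 ((abs_nonneg _).trans (hC z))
  · refine Integrable.of_bound (hφm.mul ((measurable_det_kernelMatrix hKm measurable_fst).mul
      (measurable_det_kernelMatrix hKm measurable_snd))).aestronglyMeasurable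
      (C * (c ^ m * c ^ n)) ?_
    filter_upwards [h2, h3] with z hz hz'
    rw [Real.norm_eq_abs, abs_mul, abs_mul, abs_of_nonneg hz.1, abs_of_nonneg hz'.1]
    exact mul_le_mul (hC z) (mul_le_mul hz.2 hz'.2 hz'.1 (hz.1.trans hz.2))
      (mul_nonneg hz.1 hz'.1) ((abs_nonneg _).trans (hC z))

theorem integrable_mul_decouplingError [SigmaFinite μ] (hKm : Measurable (Function.uncurry K))
    {c : ℝ} (hρ : IntensityBound μ K c) {A B : Set 𝔼} (hA : μ A ≠ ∞) (hB : μ B ≠ ∞) {m n : ℕ}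
    {φ : (Fin m → 𝔼) × (Fin n → 𝔼) → ℝ} (hφm : Measurable φ) {C : ℝ} (hC : ∀ z, |φ z| ≤ C) :
    Integrable (fun z => φ z * decouplingError K z) (tupleMeasure μ A B m n) := by
  obtain ⟨h1, h2⟩ := integrable_mul_append hKm hρ hA hB hφm hC
  refine (h1.sub h2).congr (Filter.Eventually.of_forall fun z => ?_)
  simp only [Pi.sub_apply, decouplingError]
  ring

theorem abs_moebius_mul_le {f g : Set 𝔼 → ℝ} (hf1 : ∀ s, |f s| ≤ 1) (hg1 : ∀ s, |g s| ≤ 1)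
    {m n : ℕ} (z : (Fin m → 𝔼) × (Fin n → 𝔼)) :
    |moebius f z.1 * moebius g z.2| ≤ 2 ^ m * 2 ^ n := by
  rw [abs_mul]
  exact mul_le_mul (abs_moebius_le hf1 _) (abs_moebius_le hg1 _) (abs_nonneg _) (by positivity)

/-- The covariance of a functional of `X ∩ A` and a functional of `X ∩ B`. -/
theorem hasSum_covariance [IsProbabilityMeasure P] [SigmaFinite μ] (hX : IsDPP P X μ K)
    (hKm : Measurable (Function.uncurry K)) {c : ℝ} (hρ : IntensityBound μ K c)
    {A B : Set 𝔼} (hAB : Disjoint A B) (hAb : Bornology.IsBounded A) (hBb : Bornology.IsBounded B)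
    (hA : MeasurableSet A) (hB : MeasurableSet B) (hAfin : μ A ≠ ∞) (hBfin : μ B ≠ ∞)
    {f g : Set 𝔼 → ℝ} (hf : Measurable[configSpace d] f) (hg : Measurable[configSpace d] g)
    (hf1 : ∀ s, |f s| ≤ 1) (hg1 : ∀ s, |g s| ≤ 1) :
    HasSum (fun k : ℕ × ℕ => (k.1.factorial : ℝ)⁻¹ * (k.2.factorial : ℝ)⁻¹ *
      ∫ z, moebius f z.1 * moebius g z.2 * decouplingError K z ∂(tupleMeasure μ A B k.1 k.2))
      (∫ ω, f (X ω ∩ A) * g (X ω ∩ B) ∂P -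
        (∫ ω, f (X ω ∩ A) ∂P) * ∫ ω, g (X ω ∩ B) ∂P) := by
  have h := hasSum_integral_mul hX hKm hρ hAB hAb hBb hA hB hAfin hBfin hf hg hf1 hg1
  have hF := hasSum_integral hX hKm hρ hAb hA hAfin hf hf1
  have hG := hasSum_integral hX hKm hρ hBb hB hBfin hg hg1
  have hFG := hF.mul hG (summable_mul_of_summable_norm
      (f := fun m : ℕ => (m.factorial : ℝ)⁻¹ * ∫ x : Fin m → 𝔼, moebius f x *
        (kernelMatrix K x).det ∂(Measure.pi fun _ => μ.restrict A))
      (g := fun m : ℕ => (m.factorial : ℝ)⁻¹ * ∫ x : Fin m → 𝔼, moebius g x *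
        (kernelMatrix K x).det ∂(Measure.pi fun _ => μ.restrict B))
      hF.summable.norm hG.summable.norm)
  refine (h.sub hFG).congr_fun fun k => ?_
  have hm : Measurable fun z : (Fin k.1 → 𝔼) × (Fin k.2 → 𝔼) => moebius f z.1 * moebius g z.2 :=
    ((measurable_moebius hf _).comp measurable_fst).mul
      ((measurable_moebius hg _).comp measurable_snd)
  obtain ⟨h1, h2⟩ := integrable_mul_append hKm hρ hAfin hBfin hm (abs_moebius_mul_le hf1 hg1)
  have h3 : ∀ z : (Fin k.1 → 𝔼) × (Fin k.2 → 𝔼),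
      moebius f z.1 * moebius g z.2 * decouplingError K z =
      moebius f z.1 * moebius g z.2 * (kernelMatrix K (Fin.append z.1 z.2)).det -
      moebius f z.1 * moebius g z.2 * ((kernelMatrix K z.1).det * (kernelMatrix K z.2).det) :=
    fun z => by rw [decouplingError]; ring
  have h4 : ∀ z : (Fin k.1 → 𝔼) × (Fin k.2 → 𝔼),
      moebius f z.1 * moebius g z.2 * ((kernelMatrix K z.1).det * (kernelMatrix K z.2).det) =
      (moebius f z.1 * (kernelMatrix K z.1).det) * (moebius g z.2 * (kernelMatrix K z.2).det) :=
    fun z => by ring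
  simp_rw [h3]
  rw [integral_sub h1 h2]
  simp_rw [h4]
  rw [integral_prod_mul (fun x : Fin k.1 → 𝔼 => moebius f x * (kernelMatrix K x).det)
    (fun y : Fin k.2 → 𝔼 => moebius g y * (kernelMatrix K y).det)]
  ring

/-- Integrating out all but two of the coordinates. The exponents `m - 1` and `n - 1` do not
truncate, as `i : Fin m` and `j : Fin n` exist. -/
theorem integral_kernel_sq_tuple (μ : Measure 𝔼) {A B : Set 𝔼} (hA : μ A ≠ ∞) (hB : μ B ≠ ∞)
    (hKm : Measurable (Function.uncurry K)) {m n : ℕ} (i : Fin m) (j : Fin n) :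
    ∫ z, K (z.1 i) (z.2 j) ^ 2 ∂(tupleMeasure μ A B m n) =
      μ.real A ^ (m - 1) * μ.real B ^ (n - 1) *
        ∫ z, K z.1 z.2 ^ 2 ∂((μ.restrict A).prod (μ.restrict B)) := by
  have : IsFiniteMeasure (μ.restrict A) := isFiniteMeasure_restrict.mpr hA
  have : IsFiniteMeasure (μ.restrict B) := isFiniteMeasure_restrict.mpr hB
  have h1 : ∀ (k : ℕ) (l : Fin k) (D : Set 𝔼) [IsFiniteMeasure (μ.restrict D)],
      (Measure.pi fun _ : Fin k => μ.restrict D).map (Function.eval l) =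
        μ D ^ (k - 1) • μ.restrict D := by
    intro k l D _
    rw [Measure.pi_map_eval]
    simp
  have h2 : (tupleMeasure μ A B m n).map (Prod.map (Function.eval i) (Function.eval j)) =
      (μ A ^ (m - 1) * μ B ^ (n - 1)) • (μ.restrict A).prod (μ.restrict B) := by
    rw [← Measure.map_prod_map _ _ (measurable_pi_apply i) (measurable_pi_apply j), h1, h1,
      Measure.prod_smul_left, Measure.prod_smul_right, smul_smul]
  have h3 : Measurable fun z : 𝔼 × 𝔼 => K z.1 z.2 ^ 2 := hKm.pow_const 2
  have h4 := integral_map (μ := tupleMeasure μ A B m n)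
    (φ := Prod.map (Function.eval i) (Function.eval j))
    ((measurable_pi_apply i).prodMap (measurable_pi_apply j)).aemeasurable
    (f := fun z : 𝔼 × 𝔼 => K z.1 z.2 ^ 2) h3.aestronglyMeasurable
  rw [h2, integral_smul_measure, ENNReal.toReal_mul, ENNReal.toReal_pow, ENNReal.toReal_pow] at h4
  exact h4.symm

/-- The quantitative Fischer inequality, integrated: each of the `m n` entries of the off-diagonal
block contributes the mass of `K²` on `A × B`. -/
theorem integral_abs_decouplingError_le [SigmaFinite μ] (hX : IsDPP P X μ K)
    (hKm : Measurable (Function.uncurry K)) (hsymm : ∀ x y, K x y = K y x)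
    (hK0 : ∀ x y, 0 ≤ K x y) {c : ℝ} (hc : ∀ x y, K x y ≤ c)
    {A B : Set 𝔼} (hA : μ A ≠ ∞) (hB : μ B ≠ ∞) (m n : ℕ) :
    ∫ z, |decouplingError K z| ∂(tupleMeasure μ A B m n) ≤
      ((m : ℝ) ^ 2 * (c * μ.real A) ^ (m - 1)) * ((n : ℝ) ^ 2 * (c * μ.real B) ^ (n - 1)) *
        ∫ z, K z.1 z.2 ^ 2 ∂((μ.restrict A).prod (μ.restrict B)) := by
  have : IsFiniteMeasure (μ.restrict A) := isFiniteMeasure_restrict.mpr hA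
  have : IsFiniteMeasure (μ.restrict B) := isFiniteMeasure_restrict.mpr hB
  have hKint : ∀ (i : Fin m) (j : Fin n),
      Integrable (fun z : (Fin m → 𝔼) × (Fin n → 𝔼) => K (z.1 i) (z.2 j) ^ 2)
        (tupleMeasure μ A B m n) := by
    intro i j
    have hm : Measurable fun z : (Fin m → 𝔼) × (Fin n → 𝔼) =>
        Function.uncurry K (z.1 i, z.2 j) ^ 2 :=
      (hKm.comp (((measurable_pi_apply i).comp measurable_fst).prodMk
        ((measurable_pi_apply j).comp measurable_snd))).pow_const 2
    refine Integrable.of_bound hm.aestronglyMeasurable (c ^ 2)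
      (Filter.Eventually.of_forall fun z => ?_)
    rw [Real.norm_of_nonneg (by positivity)]
    exact pow_le_pow_left₀ (hK0 _ _) (hc _ _) 2
  have hsum : Integrable (fun z : (Fin m → 𝔼) × (Fin n → 𝔼) => ∑ i, ∑ j, K (z.1 i) (z.2 j) ^ 2)
      (tupleMeasure μ A B m n) :=
    integrable_finsetSum _ fun i _ => integrable_finsetSum _ fun j _ => hKint i j
  calc ∫ z, |decouplingError K z| ∂(tupleMeasure μ A B m n)
      ≤ ∫ z, c ^ (m - 1) * c ^ (n - 1) * (m * n) * ∑ i, ∑ j, K (z.1 i) (z.2 j) ^ 2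
          ∂(tupleMeasure μ A B m n) := by
        refine integral_mono_of_nonneg (Filter.Eventually.of_forall fun z => abs_nonneg _)
          (hsum.const_mul _) ?_
        filter_upwards [ae_append_restrict A B (hX.ae_posSemidef hsymm (m + n))] with z hz
        exact abs_det_append_sub_le hsymm (fun x => hc x x) z.1 z.2 hz
    _ = _ := by
        rw [integral_const_mul, integral_finsetSum _ fun i _ =>
          integrable_finsetSum _ fun j _ => hKint i j]
        simp_rw [integral_finsetSum _ fun j _ => hKint _ j, integral_kernel_sq_tuple μ hA hB hKm]
        simp only [Finset.sum_const, Finset.card_univ, Fintype.card_fin, nsmul_eq_mul, mul_pow]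
        ring

end UpperBound

section UpperBound

variable {d : ℕ}

local notation "𝔼" => EuclideanSpace ℝ (Fin d)

theorem hasSum_pow_div_factorial (x : ℝ) :
    HasSum (fun n : ℕ => x ^ n / n.factorial) (Real.exp x) := by
  rw [Real.exp_eq_exp_ℝ]
  exact NormedSpace.expSeries_div_hasSum_exp x

theorem hasSum_nat_mul_pow_div_factorial (x : ℝ) :
    HasSum (fun n : ℕ => n * (x ^ n / n.factorial)) (x * Real.exp x) := by
  rw [← hasSum_nat_add_iff' 1]
  have h := (hasSum_pow_div_factorial x).mul_left x
  simp only [Finset.range_one, Finset.sum_singleton, Nat.cast_zero, zero_mul, sub_zero]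
  refine h.congr_fun fun n => ?_
  rw [Nat.factorial_succ]
  push_cast
  field_simp
  ring

theorem hasSum_sq_mul_pow_pred_div_factorial (x : ℝ) :
    HasSum (fun n : ℕ => 2 ^ n * (n ^ 2 * x ^ (n - 1)) / n.factorial)
      (2 * (1 + 2 * x) * Real.exp (2 * x)) := by
  rw [← hasSum_nat_add_iff' 1]
  have h := ((hasSum_pow_div_factorial (2 * x)).add
    (hasSum_nat_mul_pow_div_factorial (2 * x))).mul_left 2
  have e : 2 * (1 + 2 * x) * Real.exp (2 * x) - ∑ i ∈ Finset.range 1,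
      2 ^ i * ((i : ℝ) ^ 2 * x ^ (i - 1)) / (i.factorial : ℝ) =
      2 * (Real.exp (2 * x) + 2 * x * Real.exp (2 * x)) := by
    simp; ring
  rw [e]
  refine h.congr_fun fun n => ?_
  rw [Nat.factorial_succ, Nat.add_sub_cancel]
  push_cast
  field_simp
  ring

theorem measurable_inter_configSpace {A : Set 𝔼} (hA : MeasurableSet A) :
    @Measurable _ _ (configSpace d) (configSpace d) fun s : Set 𝔼 => s ∩ A := by
  refine @measurable_configSpace d _ (configSpace d) _ fun B hB hBm => ?_
  simp_rw [Set.inter_assoc]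
  exact measurable_encard_inter (hB.subset Set.inter_subset_right) (hA.inter hBm)

variable {Ω : Type*} [MeasurableSpace Ω] {P : Measure Ω} {X : Ω → Set (EuclideanSpace ℝ (Fin d))}
  {μ : Measure (EuclideanSpace ℝ (Fin d))}
  {K : EuclideanSpace ℝ (Fin d) → EuclideanSpace ℝ (Fin d) → ℝ}

omit [MeasurableSpace Ω] in
/-- A partition in `ℰ(A)` is induced by a family of disjoint sets of configurations. -/
theorem exists_indicators_of_partition {A : Set 𝔼} {m : ℕ} {S : Fin m → Set Ω}
    (hS : IsFinitePartition (sigmaOn X A) S) :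
    ∃ f : Fin m → Set 𝔼 → ℝ, (∀ i, Measurable[configSpace d] (f i)) ∧ (∀ i s, 0 ≤ f i s) ∧
      (∀ s, ∑ i, f i s ≤ 1) ∧ ∀ i ω, f i (X ω ∩ A) = (S i).indicator 1 ω := by
  choose T hTm hT using hS.1
  -- the sets `T i` may overlap outside the range of `X ∩ A`, so they are made disjoint
  set T' : Fin m → Set (Set 𝔼) := fun i => T i \ ⋃ j, ⋃ (_ : j < i), T j with hT'
  have hT'm : ∀ i, MeasurableSet[configSpace d] (T' i) := fun i =>
    (hTm i).diff (MeasurableSet.iUnion fun j => MeasurableSet.iUnion fun _ => hTm j)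
  have hdisj : ∀ i j s, s ∈ T' i → s ∈ T' j → i = j := by
    intro i j s hi hj
    by_contra hne
    rcases lt_or_gt_of_ne hne with h | h
    · exact hj.2 (Set.mem_iUnion₂.mpr ⟨i, h, hi.1⟩)
    · exact hi.2 (Set.mem_iUnion₂.mpr ⟨j, h, hj.1⟩)
  refine ⟨fun i => (T' i).indicator 1, fun i => ?_, fun i s => ?_, fun s => ?_, fun i ω => ?_⟩
  · exact Measurable.indicator (m := configSpace d) (@measurable_const _ _ _ (configSpace d) 1)
      (hT'm i)
  · exact Set.indicator_nonneg (fun _ _ => zero_le_one) s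
  · by_cases h : ∃ i, s ∈ T' i
    · obtain ⟨i, hi⟩ := h
      rw [Finset.sum_eq_single i]
      · simp [hi]
      · intro j _ hji
        exact Set.indicator_of_notMem (fun hj => hji (hdisj j i s hj hi)) _
      · simp
    · push Not at h
      rw [Finset.sum_eq_zero fun i _ => Set.indicator_of_notMem (h i) _]
      exact zero_le_one
  · have hmem : ∀ j, X ω ∩ A ∈ T j ↔ ω ∈ S j := fun j => by rw [← hT j]; rfl
    have : X ω ∩ A ∈ T' i ↔ ω ∈ S i := by
      constructor
      · exact fun h => (hmem i).mp h.1
      · refine fun h => ⟨(hmem i).mpr h, fun h' => ?_⟩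
        obtain ⟨j, hj, hj'⟩ := Set.mem_iUnion₂.mp h'
        exact Set.disjoint_left.mp (hS.2.1 hj.ne) ((hmem j).mp hj') h
    change (T' i).indicator (1 : Set 𝔼 → ℝ) (X ω ∩ A) = _
    by_cases h : ω ∈ S i
    · rw [Set.indicator_of_mem (this.mpr h), Set.indicator_of_mem h]; rfl
    · rw [Set.indicator_of_notMem (fun h' => h (this.mp h')), Set.indicator_of_notMem h]

/-- The bound `2 ^ m` for the Möbius transform holds for a whole partition at once; this keeps the
estimates independent of the number of sets in a partition. -/
theorem sum_abs_moebius_le {α : Type*} {l : ℕ} {f : Fin l → Set α → ℝ} (h0 : ∀ i s, 0 ≤ f i s)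
    (h1 : ∀ s, ∑ i, f i s ≤ 1) {m : ℕ} (x : Fin m → α) : ∑ i, |moebius (f i) x| ≤ 2 ^ m := by
  calc ∑ i, |moebius (f i) x| ≤ ∑ i, ∑ S : Finset (Fin m), f i (x '' S) := by
        refine Finset.sum_le_sum fun i _ => (Finset.abs_sum_le_sum_abs _ _).trans
          (Finset.sum_le_sum fun S _ => ?_)
        rw [abs_mul, abs_pow, abs_neg, abs_one, one_pow, one_mul, abs_of_nonneg (h0 _ _)]
    _ = ∑ S : Finset (Fin m), ∑ i, f i (x '' S) := Finset.sum_comm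
    _ ≤ ∑ _S : Finset (Fin m), (1 : ℝ) := Finset.sum_le_sum fun S _ => h1 _
    _ = 2 ^ m := by simp

theorem IsDPP.measurable_inter (hX : IsDPP P X μ K) {A : Set 𝔼} (hA : MeasurableSet A) :
    @Measurable _ _ _ (configSpace d) fun ω => X ω ∩ A :=
  (measurable_inter_configSpace hA).comp hX.1.measurable

theorem IsDPP.measurableSet_of_sigmaOn (hX : IsDPP P X μ K) {A : Set 𝔼} (hA : MeasurableSet A)
    {S : Set Ω} (hS : MeasurableSet[sigmaOn X A] S) : MeasurableSet S :=
  (hX.measurable_inter hA).comap_le S hS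

/-- The total correlation of two partitions in `ℰ(A)` and `ℰ(B)`. -/
theorem sum_abs_covariance_le [IsProbabilityMeasure P] [SigmaFinite μ] (hX : IsDPP P X μ K)
    (hKm : Measurable (Function.uncurry K)) (hsymm : ∀ x y, K x y = K y x)
    (hK0 : ∀ x y, 0 ≤ K x y) {c : ℝ} (hc : ∀ x y, K x y ≤ c)
    {A B : Set 𝔼} (hAB : Disjoint A B) (hAb : Bornology.IsBounded A) (hBb : Bornology.IsBounded B)
    (hA : MeasurableSet A) (hB : MeasurableSet B) (hAfin : μ A ≠ ∞) (hBfin : μ B ≠ ∞)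
    {m n : ℕ} {S : Fin m → Set Ω} {T : Fin n → Set Ω} (hS : IsFinitePartition (sigmaOn X A) S)
    (hT : IsFinitePartition (sigmaOn X B) T) :
    ∑ i, ∑ j, |P.real (S i ∩ T j) - P.real (S i) * P.real (T j)| ≤
      (2 * (1 + 2 * (c * μ.real A)) * Real.exp (2 * (c * μ.real A))) *
      (2 * (1 + 2 * (c * μ.real B)) * Real.exp (2 * (c * μ.real B))) *
        ∫ z, K z.1 z.2 ^ 2 ∂((μ.restrict A).prod (μ.restrict B)) := by
  have hρ := hX.intensityBound hsymm fun x => hc x x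
  obtain ⟨f, hfm, hf0, hf1, hf⟩ := exists_indicators_of_partition hS
  obtain ⟨g, hgm, hg0, hg1, hg⟩ := exists_indicators_of_partition hT
  have hSm : ∀ i, MeasurableSet (S i) := fun i => hX.measurableSet_of_sigmaOn hA (hS.1 i)
  have hTm : ∀ i, MeasurableSet (T i) := fun i => hX.measurableSet_of_sigmaOn hB (hT.1 i)
  have habs : ∀ {l : ℕ} {f : Fin l → Set 𝔼 → ℝ}, (∀ i s, 0 ≤ f i s) → (∀ s, ∑ i, f i s ≤ 1) →
      ∀ i s, |f i s| ≤ 1 := by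
    intro l f h0 h1 i s
    rw [abs_of_nonneg (h0 i s)]
    exact (Finset.single_le_sum (f := fun i => f i s) (fun i _ => h0 i s)
      (Finset.mem_univ i)).trans (h1 s)
  set I := ∫ z, K z.1 z.2 ^ 2 ∂((μ.restrict A).prod (μ.restrict B)) with hI
  set t : Fin m → Fin n → ℕ × ℕ → ℝ := fun i j k =>
    (k.1.factorial : ℝ)⁻¹ * (k.2.factorial : ℝ)⁻¹ * ∫ z, moebius (f i) z.1 * moebius (g j) z.2 *
      decouplingError K z ∂(tupleMeasure μ A B k.1 k.2) with ht
  have hcov : ∀ i j, HasSum (t i j) (P.real (S i ∩ T j) - P.real (S i) * P.real (T j)) := by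
    intro i j
    have h := hasSum_covariance hX hKm hρ hAB hAb hBb hA hB hAfin hBfin (hfm i) (hgm j)
      (habs hf0 hf1 i) (habs hg0 hg1 j)
    simp_rw [hf, hg] at h
    rw [integral_indicator_one (hSm i), integral_indicator_one (hTm j)] at h
    have h' : ∫ ω, (S i).indicator (1 : Ω → ℝ) ω * (T j).indicator (1 : Ω → ℝ) ω ∂P =
        P.real (S i ∩ T j) := by
      rw [← integral_indicator_one ((hSm i).inter (hTm j))]
      congr 1
      ext ω
      rw [Set.inter_indicator_one]
      rfl
    rwa [h'] at h
  set U : ℕ × ℕ → ℝ := fun k =>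
    (2 ^ k.1 * (k.1 ^ 2 * (c * μ.real A) ^ (k.1 - 1)) / k.1.factorial) *
    (2 ^ k.2 * (k.2 ^ 2 * (c * μ.real B) ^ (k.2 - 1)) / k.2.factorial) * I with hU
  have hUsum : HasSum U ((2 * (1 + 2 * (c * μ.real A)) * Real.exp (2 * (c * μ.real A))) *
      (2 * (1 + 2 * (c * μ.real B)) * Real.exp (2 * (c * μ.real B))) * I) := by
    have h1 := hasSum_sq_mul_pow_pred_div_factorial (c * μ.real A)
    have h2 := hasSum_sq_mul_pow_pred_div_factorial (c * μ.real B)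
    exact (h1.mul h2 (summable_mul_of_summable_norm
      (f := fun n : ℕ => 2 ^ n * (n ^ 2 * (c * μ.real A) ^ (n - 1)) / (n.factorial : ℝ))
      (g := fun n : ℕ => 2 ^ n * (n ^ 2 * (c * μ.real B) ^ (n - 1)) / (n.factorial : ℝ))
      h1.summable.norm h2.summable.norm)).mul_right I
  have hbound : ∀ k, ∑ i, ∑ j, |t i j k| ≤ U k := by
    intro k
    have hint : ∀ i j, Integrable (fun z => |moebius (f i) z.1 * moebius (g j) z.2 *
        decouplingError K z|) (tupleMeasure μ A B k.1 k.2) := fun i j =>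
      (integrable_mul_decouplingError hKm hρ hAfin hBfin
        (((measurable_moebius (hfm i) _).comp measurable_fst).mul
          ((measurable_moebius (hgm j) _).comp measurable_snd))
        (abs_moebius_mul_le (habs hf0 hf1 i) (habs hg0 hg1 j))).abs
    have hΔ : Integrable (fun z => |decouplingError K z|) (tupleMeasure μ A B k.1 k.2) := by
      simpa using (integrable_mul_decouplingError hKm hρ hAfin hBfin (φ := fun _ => 1)
        measurable_const (C := 1) (fun _ => by simp)).abs
    calc ∑ i, ∑ j, |t i j k|
        ≤ ∑ i, ∑ j, (k.1.factorial : ℝ)⁻¹ * (k.2.factorial : ℝ)⁻¹ *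
          ∫ z, |moebius (f i) z.1 * moebius (g j) z.2 * decouplingError K z|
            ∂(tupleMeasure μ A B k.1 k.2) := by
          refine Finset.sum_le_sum fun i _ => Finset.sum_le_sum fun j _ => ?_
          rw [ht, abs_mul, abs_of_nonneg (by positivity)]
          gcongr
          exact abs_integral_le_integral_abs
      _ = (k.1.factorial : ℝ)⁻¹ * (k.2.factorial : ℝ)⁻¹ *
          ∫ z, ∑ i, ∑ j, |moebius (f i) z.1 * moebius (g j) z.2 * decouplingError K z|
            ∂(tupleMeasure μ A B k.1 k.2) := by
          rw [integral_finsetSum _ fun i _ => integrable_finsetSum _ fun j _ => hint i j,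
            Finset.mul_sum]
          refine Finset.sum_congr rfl fun i _ => ?_
          rw [integral_finsetSum _ fun j _ => hint i j, Finset.mul_sum]
      _ ≤ (k.1.factorial : ℝ)⁻¹ * (k.2.factorial : ℝ)⁻¹ *
          ∫ z, 2 ^ k.1 * 2 ^ k.2 * |decouplingError K z| ∂(tupleMeasure μ A B k.1 k.2) := by
          gcongr ?_ * ?_
          refine integral_mono (integrable_finsetSum _ fun i _ => integrable_finsetSum _
            fun j _ => hint i j) (hΔ.const_mul _) fun z => ?_
          simp_rw [abs_mul, ← Finset.sum_mul]
          rw [← Finset.sum_mul_sum]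
          exact mul_le_mul_of_nonneg_right (mul_le_mul (sum_abs_moebius_le hf0 hf1 z.1)
            (sum_abs_moebius_le hg0 hg1 z.2) (Finset.sum_nonneg fun _ _ => abs_nonneg _)
            (by positivity)) (abs_nonneg _)
      _ ≤ (k.1.factorial : ℝ)⁻¹ * (k.2.factorial : ℝ)⁻¹ * (2 ^ k.1 * 2 ^ k.2 *
          (((k.1 : ℝ) ^ 2 * (c * μ.real A) ^ (k.1 - 1)) *
            ((k.2 : ℝ) ^ 2 * (c * μ.real B) ^ (k.2 - 1)) * I)) := by
          rw [integral_const_mul]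
          gcongr
          exact integral_abs_decouplingError_le hX hKm hsymm hK0 hc hAfin hBfin k.1 k.2
      _ = U k := by
          rw [hU]
          field_simp
  have hts : ∀ i j, Summable fun k => |t i j k| := fun i j => (hcov i j).summable.abs
  calc ∑ i, ∑ j, |P.real (S i ∩ T j) - P.real (S i) * P.real (T j)|
      ≤ ∑ i, ∑ j, ∑' k, |t i j k| := by
        refine Finset.sum_le_sum fun i _ => Finset.sum_le_sum fun j _ => ?_
        have h := norm_tsum_le_tsum_norm (hcov i j).summable.norm
        simp only [Real.norm_eq_abs] at h
        rwa [(hcov i j).tsum_eq] at h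
    _ = ∑' k, ∑ i, ∑ j, |t i j k| := by
        rw [Summable.tsum_finsetSum fun i _ => summable_sum fun j _ => hts i j]
        refine Finset.sum_congr rfl fun i _ => ?_
        rw [Summable.tsum_finsetSum fun j _ => hts i j]
    _ ≤ ∑' k, U k := Summable.tsum_le_tsum hbound
        (summable_sum fun i _ => summable_sum fun j _ => hts i j) hUsum.summable
    _ = _ := hUsum.tsum_eq

theorem kernelMass_eq_ofReal {c : ℝ} [SigmaFinite μ] (hKm : Measurable (Function.uncurry K))
    (hK0 : ∀ x y, 0 ≤ K x y) (hc : ∀ x y, K x y ≤ c) {A B : Set 𝔼}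
    (hA : μ A ≠ ∞) (hB : μ B ≠ ∞) :
    kernelMass μ K A B =
      ENNReal.ofReal (∫ z, K z.1 z.2 ^ 2 ∂((μ.restrict A).prod (μ.restrict B))) := by
  have : IsFiniteMeasure (μ.restrict A) := isFiniteMeasure_restrict.mpr hA
  have : IsFiniteMeasure (μ.restrict B) := isFiniteMeasure_restrict.mpr hB
  have hm : Measurable fun z : 𝔼 × 𝔼 => K z.1 z.2 ^ 2 := hKm.pow_const 2
  rw [kernelMass, ← Measure.prod_restrict, ofReal_integral_eq_lintegral_ofReal]
  · simp
  · refine Integrable.of_bound hm.aestronglyMeasurable (c ^ 2)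
      (Filter.Eventually.of_forall fun z => ?_)
    rw [Real.norm_of_nonneg (by positivity)]
    exact pow_le_pow_left₀ (hK0 _ _) (hc _ _) 2
  · exact Filter.Eventually.of_forall fun z => by positivity

theorem betaCoeff_le [IsProbabilityMeasure P] [SigmaFinite μ] (hX : IsDPP P X μ K)
    (hKm : Measurable (Function.uncurry K)) (hsymm : ∀ x y, K x y = K y x)
    (hK0 : ∀ x y, 0 ≤ K x y) {c : ℝ} (hc : ∀ x y, K x y ≤ c)
    {A B : Set 𝔼} (hAB : Disjoint A B) (hAb : Bornology.IsBounded A) (hBb : Bornology.IsBounded B)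
    (hA : MeasurableSet A) (hB : MeasurableSet B) {p q : ℝ} (hp : 0 < p) (hq : 0 < q)
    (hAp : μ A ≤ ENNReal.ofReal p) (hBq : μ B ≤ ENNReal.ofReal q) :
    betaCoeff P (sigmaOn X A) (sigmaOn X B) ≤
      ENNReal.ofReal (4 * (1 + 2 * p * c) * (1 + 2 * q * c) * Real.exp (2 * (p + q) * c)) *
        kernelMass μ K A B := by
  have hAfin : μ A ≠ ∞ := (hAp.trans_lt ENNReal.ofReal_lt_top).ne
  have hBfin : μ B ≠ ∞ := (hBq.trans_lt ENNReal.ofReal_lt_top).ne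
  have hAp' : μ.real A ≤ p := ENNReal.toReal_le_of_le_ofReal hp.le hAp
  have hBq' : μ.real B ≤ q := ENNReal.toReal_le_of_le_ofReal hq.le hBq
  have hc0 : 0 ≤ c := (hK0 0 0).trans (hc 0 0)
  rw [kernelMass_eq_ofReal hKm hK0 hc hAfin hBfin]
  set I := ∫ z, K z.1 z.2 ^ 2 ∂((μ.restrict A).prod (μ.restrict B))
  have hI : 0 ≤ I := integral_nonneg fun z => by positivity
  rw [← ENNReal.ofReal_mul (by positivity)]
  have hsum : ∀ (m n : ℕ) (S : Fin m → Set Ω) (T : Fin n → Set Ω),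
      IsFinitePartition (sigmaOn X A) S → IsFinitePartition (sigmaOn X B) T →
      ∑ i, ∑ j, ENNReal.ofReal |P.real (S i ∩ T j) - P.real (S i) * P.real (T j)| ≤
      ENNReal.ofReal (4 * (1 + 2 * p * c) * (1 + 2 * q * c) * Real.exp (2 * (p + q) * c) * I) := by
    intro m n S T hS hT
    have h1 : ∑ i, ∑ j, ENNReal.ofReal |P.real (S i ∩ T j) - P.real (S i) * P.real (T j)| =
        ENNReal.ofReal (∑ i, ∑ j, |P.real (S i ∩ T j) - P.real (S i) * P.real (T j)|) := by
      rw [ENNReal.ofReal_sum_of_nonneg fun i _ => Finset.sum_nonneg fun j _ => abs_nonneg _]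
      refine Finset.sum_congr rfl fun i _ => ?_
      rw [ENNReal.ofReal_sum_of_nonneg fun j _ => abs_nonneg _]
    rw [h1]
    refine ENNReal.ofReal_le_ofReal ((sum_abs_covariance_le hX hKm hsymm hK0 hc hAB hAb hBb hA hB
      hAfin hBfin hS hT).trans ?_)
    calc _ ≤ (2 * (1 + 2 * (c * p)) * Real.exp (2 * (c * p))) *
          (2 * (1 + 2 * (c * q)) * Real.exp (2 * (c * q))) * I := by gcongr
      _ = 4 * (1 + 2 * p * c) * (1 + 2 * q * c) * Real.exp (2 * (p + q) * c) * I := by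
          rw [show 2 * (p + q) * c = 2 * (c * p) + 2 * (c * q) by ring, Real.exp_add]; ring
  have hsup := iSup_le fun m : ℕ => iSup_le fun n : ℕ => iSup_le fun S : Fin m → Set Ω =>
    iSup_le fun T : Fin n → Set Ω => iSup_le fun hS => iSup_le fun hT => hsum m n S T hS hT
  -- the factor `1 / 2` in the definition of `betaCoeff` is not needed for the upper bound
  have h2 : (2 : ℝ≥0∞)⁻¹ ≤ 1 := ENNReal.inv_le_one.mpr one_le_two
  calc betaCoeff P (sigmaOn X A) (sigmaOn X B) ≤ 1 * _ := mul_le_mul' h2 hsup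
    _ = _ := one_mul _

end UpperBound

/-! ### The Fredholm expansion and iterated kernels -/

section Fredholm

variable {α : Type*} [MeasurableSpace α]

/-- The iterated kernels: `iterKernel ν K k` is the kernel of the `(k + 1)`-st power of the integral
operator with kernel `K` on `L²(ν)`. -/
noncomputable def iterKernel (ν : Measure α) (K : α → α → ℝ) : ℕ → α → α → ℝ
  | 0 => K
  | k + 1 => fun x y => ∫ z, K x z * iterKernel ν K k z y ∂ν

/-- The integral of the iterated kernel over the diagonal, a substitute for the trace of the
`(k + 1)`-st power of the operator. -/
noncomputable def iterTrace (ν : Measure α) (K : α → α → ℝ) (k : ℕ) : ℝ :=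
  ∫ x, iterKernel ν K k x x ∂ν

/-- The integral of the `n`-th intensity. -/
noncomputable def fredholmCoeff (ν : Measure α) (K : α → α → ℝ) (n : ℕ) : ℝ :=
  ∫ x : Fin n → α, (kernelMatrix K x).det ∂(Measure.pi fun _ => ν)

/-- The determinant of `(K (x i) (x j))` bordered by a further row, belonging to `x`, and a further
column, belonging to `y`. -/
def borderedDet (K : α → α → ℝ) {n : ℕ} (x y : α) (w : Fin n → α) : ℝ :=
  (Matrix.of fun i j : Fin (n + 1) =>
    K ((Fin.cons x w : Fin (n + 1) → α) i) ((Fin.cons y w : Fin (n + 1) → α) j)).det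

omit [MeasurableSpace α] in
/-- Laplace expansion of the bordered determinant along its first row. -/
theorem borderedDet_succ (K : α → α → ℝ) {n : ℕ} (x y : α) (w : Fin (n + 1) → α) :
    borderedDet K x y w = K x y * (kernelMatrix K w).det -
      ∑ l, K x (w l) * borderedDet K (w l) y (fun i => w (l.succAbove i)) := by
  rw [borderedDet, Matrix.det_succ_row_zero, Fin.sum_univ_succ, sub_eq_add_neg,
    ← Finset.sum_neg_distrib]
  congr 1
  · simp only [Fin.val_zero, pow_zero, one_mul, Matrix.of_apply, Fin.cons_zero]
    congr 2
  · refine Finset.sum_congr rfl fun l _ => ?_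
    have h : (Matrix.of fun i j : Fin (n + 1) =>
        K ((Fin.cons (w l) (fun i => w (l.succAbove i)) : Fin (n + 1) → α) i)
          ((Fin.cons y (fun i => w (l.succAbove i)) : Fin (n + 1) → α) j)) =
        ((Matrix.of fun i j : Fin (n + 1 + 1) =>
          K ((Fin.cons x w : Fin (n + 1 + 1) → α) i)
            ((Fin.cons y w : Fin (n + 1 + 1) → α) j)).submatrix Fin.succ
              l.succ.succAbove).submatrix l.cycleRange.symm id := by
      ext i j
      simp only [Matrix.of_apply, Matrix.submatrix_apply, Fin.cons_succ, id]
      congr 1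
      · refine Fin.cases ?_ (fun i => ?_) i
        · simp
        · simp
      · refine Fin.cases ?_ (fun j => ?_) j
        · simp
        · simp
    rw [borderedDet, h, Matrix.det_permute, Equiv.Perm.sign_symm, Fin.sign_cycleRange]
    simp only [Matrix.of_apply, Fin.cons_zero, Fin.cons_succ, Fin.val_succ]
    push_cast
    have h1 : ((-1 : ℝ) ^ (l : ℕ)) * (-1) ^ (l : ℕ) = 1 := by
      rw [← mul_pow]; simp
    rw [pow_succ]
    ring

variable {ν : Measure α} {K : α → α → ℝ} {c : ℝ}

theorem iterKernel_nonneg (hK0 : ∀ x y, 0 ≤ K x y) (k : ℕ) (x y : α) :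
    0 ≤ iterKernel ν K k x y := by
  induction k generalizing x with
  | zero => exact hK0 x y
  | succ k ih => exact integral_nonneg fun z => mul_nonneg (hK0 x z) (ih z)

theorem measurable_iterKernel [SFinite ν] (hKm : Measurable (Function.uncurry K)) (k : ℕ) :
    Measurable (Function.uncurry (iterKernel ν K k)) := by
  induction k with
  | zero => exact hKm
  | succ k ih =>
    have : Measurable fun p : (α × α) × α =>
        Function.uncurry K (p.1.1, p.2) * Function.uncurry (iterKernel ν K k) (p.2, p.1.2) :=
      (hKm.comp (by fun_prop)).mul (ih.comp (by fun_prop))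
    exact (this.stronglyMeasurable.integral_prod_right (ν := ν)).measurable

theorem iterKernel_le [IsFiniteMeasure ν] (hK0 : ∀ x y, 0 ≤ K x y) (hc : ∀ x y, K x y ≤ c)
    (k : ℕ) (x y : α) : iterKernel ν K k x y ≤ c * (c * ν.real Set.univ) ^ k := by
  induction k generalizing x with
  | zero => simpa [iterKernel] using hc x y
  | succ k ih =>
    have hc0 : 0 ≤ c := (hK0 x y).trans (hc x y)
    calc iterKernel ν K (k + 1) x y
        ≤ ∫ _z, c * (c * (c * ν.real Set.univ) ^ k) ∂ν := by
          refine integral_mono_of_nonneg (Filter.Eventually.of_forall fun z =>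
            mul_nonneg (hK0 x z) (iterKernel_nonneg hK0 k z y)) (integrable_const _)
            (Filter.Eventually.of_forall fun z => ?_)
          exact mul_le_mul (hc x z) (ih z) (iterKernel_nonneg hK0 k z y) hc0
      _ = c * (c * ν.real Set.univ) ^ (k + 1) := by
          rw [integral_const, smul_eq_mul]; ring

theorem integrable_of_measurable_of_bound {β : Type*} [MeasurableSpace β] {ν : Measure β}
    [IsFiniteMeasure ν] {f : β → ℝ} (hf : Measurable f) {C : ℝ} (hC : ∀ x, |f x| ≤ C) :
    Integrable f ν :=
  Integrable.of_bound hf.aestronglyMeasurable C (Filter.Eventually.of_forall hC)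

theorem measurable_borderedDet (hKm : Measurable (Function.uncurry K)) {n : ℕ} :
    Measurable fun p : (α × α) × (Fin n → α) => borderedDet K p.1.1 p.1.2 p.2 := by
  simp_rw [borderedDet, Matrix.det_apply']
  refine Finset.measurable_sum _ fun σ _ => Measurable.const_mul ?_ _
  refine Finset.measurable_prod _ fun i _ => ?_
  have h : ∀ (g : (α × α) × (Fin n → α) → α), Measurable g → ∀ i : Fin (n + 1),
      Measurable fun p : (α × α) × (Fin n → α) => (Fin.cons (g p) p.2 : Fin (n + 1) → α) i := by
    intro g hg i
    refine Fin.cases ?_ (fun i => ?_) i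
    · simpa using hg
    · simp only [Fin.cons_succ]; fun_prop
  exact hKm.comp ((h _ (by fun_prop) _).prodMk (h _ (by fun_prop) _))

omit [MeasurableSpace α] in
theorem abs_det_le_factorial (hK0 : ∀ x y, 0 ≤ K x y) (hc : ∀ x y, K x y ≤ c) {n : ℕ}
    (u v : Fin n → α) :
    |(Matrix.of fun i j => K (u i) (v j)).det| ≤ n.factorial * c ^ n := by
  have := Matrix.det_le (A := Matrix.of fun i j => K (u i) (v j)) (abv := AbsoluteValue.abs)
    (x := c) (fun i j => by simpa [abs_of_nonneg (hK0 _ _)] using hc _ _)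
  simpa using this

omit [MeasurableSpace α] in
theorem abs_borderedDet_le (hK0 : ∀ x y, 0 ≤ K x y) (hc : ∀ x y, K x y ≤ c) {n : ℕ}
    (x y : α) (w : Fin n → α) :
    |borderedDet K x y w| ≤ (n + 1).factorial * c ^ (n + 1) :=
  abs_det_le_factorial hK0 hc _ _

theorem integral_pi_succAbove [IsFiniteMeasure ν] {n : ℕ} (l : Fin (n + 1))
    {F : α → (Fin n → α) → ℝ} (hF : Measurable (Function.uncurry F)) {C : ℝ}
    (hC : ∀ z w, |F z w| ≤ C) :
    ∫ w, F (w l) (fun i => w (l.succAbove i)) ∂(Measure.pi fun _ : Fin (n + 1) => ν) =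
      ∫ z, ∫ w, F z w ∂(Measure.pi fun _ => ν) ∂ν := by
  have h := (measurePreserving_piFinSuccAbove (fun _ : Fin (n + 1) => ν) l).integral_comp'
    (Function.uncurry F)
  rw [integral_prod _ (integrable_of_measurable_of_bound hF fun p => hC p.1 p.2)] at h
  exact h

/-- Fredholm's recursion for the integrals of the bordered determinants. -/
theorem integral_borderedDet_succ [IsFiniteMeasure ν] (hKm : Measurable (Function.uncurry K))
    (hK0 : ∀ x y, 0 ≤ K x y) (hc : ∀ x y, K x y ≤ c) (n : ℕ) (x y : α) :
    ∫ w : Fin (n + 1) → α, borderedDet K x y w ∂(Measure.pi fun _ => ν) =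
      K x y * fredholmCoeff ν K (n + 1) - (n + 1) *
        ∫ z, K x z * ∫ w : Fin n → α, borderedDet K z y w ∂(Measure.pi fun _ => ν) ∂ν := by
  have hc0 : 0 ≤ c := (hK0 x y).trans (hc x y)
  have hFm : Measurable (Function.uncurry fun (z : α) (w : Fin n → α) =>
      K x z * borderedDet K z y w) := by
    refine (hKm.comp (measurable_const.prodMk measurable_fst)).mul ?_
    exact (measurable_borderedDet hKm).comp (f := fun p : α × (Fin n → α) => ((p.1, y), p.2))
      (by fun_prop)
  have hFb : ∀ z (w : Fin n → α), |K x z * borderedDet K z y w| ≤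
      c * ((n + 1).factorial * c ^ (n + 1)) := by
    intro z w
    rw [abs_mul, abs_of_nonneg (hK0 x z)]
    exact mul_le_mul (hc x z) (abs_borderedDet_le hK0 hc z y w) (abs_nonneg _) hc0
  simp_rw [borderedDet_succ]
  rw [integral_sub, integral_const_mul, integral_finsetSum]
  · congr 1
    have : ∀ l : Fin (n + 1), ∫ w : Fin (n + 1) → α, K x (w l) *
        borderedDet K (w l) y (fun i => w (l.succAbove i)) ∂(Measure.pi fun _ => ν) =
        ∫ z, K x z * ∫ w : Fin n → α, borderedDet K z y w ∂(Measure.pi fun _ => ν) ∂ν := by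
      intro l
      rw [integral_pi_succAbove l hFm hFb]
      simp_rw [integral_const_mul]
    rw [Finset.sum_congr rfl fun l _ => this l]
    simp
  · intro l _
    refine integrable_of_measurable_of_bound ?_ fun w => hFb (w l) fun i => w (l.succAbove i)
    exact hFm.comp (f := fun w : Fin (n + 1) → α => (w l, fun i => w (l.succAbove i)))
      (by fun_prop)
  · exact (integrable_of_measurable_of_bound (measurable_det_kernelMatrix hKm measurable_id)
      (fun w => abs_det_le_factorial hK0 hc w w)).const_mul _
  · refine integrable_finsetSum _ fun l _ => ?_
    refine integrable_of_measurable_of_bound ?_ fun w => hFb (w l) fun i => w (l.succAbove i)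
    exact hFm.comp (f := fun w : Fin (n + 1) → α => (w l, fun i => w (l.succAbove i)))
      (by fun_prop)

theorem integrable_mul_iterKernel [IsFiniteMeasure ν] (hKm : Measurable (Function.uncurry K))
    (hK0 : ∀ x y, 0 ≤ K x y) (hc : ∀ x y, K x y ≤ c) (j k : ℕ) (x y : α) :
    Integrable (fun z => iterKernel ν K j x z * iterKernel ν K k z y) ν := by
  refine integrable_of_measurable_of_bound ?_
    (C := (c * (c * ν.real Set.univ) ^ j) * (c * (c * ν.real Set.univ) ^ k)) fun z => ?_
  · exact ((measurable_iterKernel hKm j).comp measurable_prodMk_left).mul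
      ((measurable_iterKernel hKm k).comp measurable_prodMk_right)
  · rw [abs_of_nonneg (mul_nonneg (iterKernel_nonneg hK0 j x z) (iterKernel_nonneg hK0 k z y))]
    exact mul_le_mul (iterKernel_le hK0 hc j x z) (iterKernel_le hK0 hc k z y)
      (iterKernel_nonneg hK0 k z y)
      ((iterKernel_nonneg hK0 j x z).trans (iterKernel_le hK0 hc j x z))

/-- The expansion of the first Fredholm minors in iterated kernels, by iteration of Fredholm's
recursion. -/
theorem integral_borderedDet [IsFiniteMeasure ν] (hKm : Measurable (Function.uncurry K))
    (hK0 : ∀ x y, 0 ≤ K x y) (hc : ∀ x y, K x y ≤ c) (n : ℕ) (x y : α) :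
    ∫ w : Fin n → α, borderedDet K x y w ∂(Measure.pi fun _ => ν) =
      ∑ k ∈ Finset.range (n + 1), (-1) ^ k * n.descFactorial k * iterKernel ν K k x y *
        fredholmCoeff ν K (n - k) := by
  induction n generalizing x with
  | zero =>
    simp [borderedDet, iterKernel, fredholmCoeff, mul_comm]
  | succ n ih =>
    rw [integral_borderedDet_succ hKm hK0 hc]
    simp_rw [ih]
    rw [Finset.sum_range_succ']
    simp_rw [Finset.mul_sum]
    rw [integral_finsetSum]
    · rw [add_comm (Finset.sum _ _), sub_eq_add_neg]
      congr 1
      · simp [iterKernel]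
      · rw [Finset.mul_sum, ← Finset.sum_neg_distrib]
        refine Finset.sum_congr rfl fun k _ => ?_
        have : ∀ z, K x z * ((-1) ^ k * n.descFactorial k * iterKernel ν K k z y *
            fredholmCoeff ν K (n - k)) = ((-1) ^ k * n.descFactorial k *
            fredholmCoeff ν K (n - k)) * (K x z * iterKernel ν K k z y) := fun z => by ring
        simp_rw [this]
        rw [integral_const_mul, Nat.succ_descFactorial_succ, Nat.add_sub_add_right]
        simp only [iterKernel]
        push_cast
        ring
    · intro k _
      have := (integrable_mul_iterKernel (ν := ν) hKm hK0 hc 0 k x y).const_mul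
        ((-1) ^ k * n.descFactorial k * fredholmCoeff ν K (n - k))
      refine this.congr (Filter.Eventually.of_forall fun z => ?_)
      simp only [iterKernel]
      ring

theorem integrable_iterKernel_diag [IsFiniteMeasure ν] (hKm : Measurable (Function.uncurry K))
    (hK0 : ∀ x y, 0 ≤ K x y) (hc : ∀ x y, K x y ≤ c) (k : ℕ) :
    Integrable (fun x => iterKernel ν K k x x) ν := by
  refine integrable_of_measurable_of_bound
    ((measurable_iterKernel hKm k).comp (measurable_id.prodMk measurable_id))
    (C := c * (c * ν.real Set.univ) ^ k) fun x => ?_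
  rw [abs_of_nonneg (iterKernel_nonneg hK0 k x x)]
  exact iterKernel_le hK0 hc k x x

/-- Newton's identities between the integrated intensities and the traces. -/
theorem fredholmCoeff_succ [IsFiniteMeasure ν] (hKm : Measurable (Function.uncurry K))
    (hK0 : ∀ x y, 0 ≤ K x y) (hc : ∀ x y, K x y ≤ c) (n : ℕ) :
    fredholmCoeff ν K (n + 1) = ∑ k ∈ Finset.range (n + 1),
      (-1) ^ k * n.descFactorial k * iterTrace ν K k * fredholmCoeff ν K (n - k) := by
  have hFm : Measurable (Function.uncurry fun (z : α) (w : Fin n → α) => borderedDet K z z w) :=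
    (measurable_borderedDet hKm).comp (f := fun p : α × (Fin n → α) => ((p.1, p.1), p.2))
      (by fun_prop)
  have h := integral_pi_succAbove (ν := ν) (0 : Fin (n + 1)) hFm
    (fun z w => abs_borderedDet_le hK0 hc z z w)
  have h1 : ∀ w : Fin (n + 1) → α, borderedDet K (w 0) (w 0)
      (fun i => w ((0 : Fin (n + 1)).succAbove i)) = (kernelMatrix K w).det := by
    intro w
    have : (Fin.cons (w 0) fun i => w ((0 : Fin (n + 1)).succAbove i) : Fin (n + 1) → α) = w := by
      ext i
      refine Fin.cases ?_ (fun i => ?_) i <;> simp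
    rw [borderedDet, this]
  simp_rw [h1, integral_borderedDet hKm hK0 hc] at h
  rw [fredholmCoeff, h, integral_finsetSum]
  · refine Finset.sum_congr rfl fun k _ => ?_
    rw [iterTrace, integral_mul_const, integral_const_mul]
  · intro k _
    exact ((integrable_iterKernel_diag hKm hK0 hc k).const_mul _).mul_const _

end Fredholm

/-! ### Newton's identities and the exponential formula -/

section Exponential

theorem hasDerivAt_tsum_mul_pow {a : ℕ → ℝ} {ρ : ℝ} (hρ : 0 < ρ)
    (ha : Summable fun n : ℕ => n * |a n| * ρ ^ (n - 1)) {z : ℝ} (hz : |z| < ρ) :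
    HasDerivAt (fun z => ∑' n, a n * z ^ n) (∑' n : ℕ, a n * (n * z ^ (n - 1))) z := by
  have hmem : ∀ {y : ℝ}, y ∈ Metric.ball (0 : ℝ) ρ → |y| < ρ := fun {y} hy => by simpa using hy
  refine hasDerivAt_tsum_of_isPreconnected (g := fun n z => a n * z ^ n)
    (g' := fun n z => a n * (n * z ^ (n - 1))) ha (t := Metric.ball 0 ρ)
    Metric.isOpen_ball (convex_ball 0 ρ).isPreconnected (fun n y _ => ?_) (fun n y hy => ?_)
    (y₀ := 0) (by simpa using hρ) ?_ (by simpa using hz)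
  · exact (hasDerivAt_pow n y).const_mul (a n)
  · rw [norm_mul, norm_mul, norm_pow, Real.norm_eq_abs, Real.norm_eq_abs, Real.norm_eq_abs,
      Nat.abs_cast]
    have := hmem hy
    calc |a n| * (n * |y| ^ (n - 1)) ≤ |a n| * (n * ρ ^ (n - 1)) := by gcongr
      _ = n * |a n| * ρ ^ (n - 1) := by ring
  · refine summable_of_ne_finset_zero (s := {0}) fun n hn => ?_
    have : n ≠ 0 := by simpa using hn
    simp [this]

/-- If the sequences `c` and `τ` are related by Newton's identities, then
`∑ c n = exp (-∑ τ k / (k + 1))`: the generating function `D` of `c` solves `D' = -τ D`. -/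
theorem hasSum_exp_of_newton {c τ : ℕ → ℝ} (h0 : c 0 = 1)
    (hnewton : ∀ n : ℕ, (n + 1) * c (n + 1) = -∑ k ∈ Finset.range (n + 1), τ k * c (n - k))
    {R : ℝ} (hc : ∀ n, |c n| ≤ R ^ n / n.factorial) {C M : ℝ} (hM0 : 0 ≤ M) (hM1 : M < 1)
    (hτ : ∀ k, |τ k| ≤ C * M ^ k) :
    HasSum c (Real.exp (-∑' k : ℕ, τ k / (k + 1))) := by
  -- a radius larger than `1` on which all series converge
  set ρ := 2 / (1 + M) with hρ
  have hρ1 : 1 < ρ := by rw [hρ, lt_div_iff₀ (by linarith)]; linarith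
  have hρ0 : 0 < ρ := by linarith
  have hMρ : M * ρ < 1 := by rw [hρ, mul_div_assoc', div_lt_one (by linarith)]; linarith
  have hMρ0 : 0 ≤ M * ρ := by positivity
  have hcρ : Summable fun n => |c n| * ρ ^ n := by
    refine Summable.of_nonneg_of_le (fun n => by positivity) (fun n => ?_)
      (Real.summable_pow_div_factorial (R * ρ))
    calc |c n| * ρ ^ n ≤ R ^ n / n.factorial * ρ ^ n := by gcongr; exact hc n
      _ = (R * ρ) ^ n / n.factorial := by rw [mul_pow]; ring
  have hτρ : Summable fun n => |τ n| * ρ ^ n := by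
    refine Summable.of_nonneg_of_le (fun n => by positivity) (fun n => ?_)
      ((summable_geometric_of_lt_one hMρ0 hMρ).mul_left C)
    calc |τ n| * ρ ^ n ≤ C * M ^ n * ρ ^ n := by gcongr; exact hτ n
      _ = C * (M * ρ) ^ n := by rw [mul_pow]; ring
  have hcd : Summable fun n : ℕ => n * |c n| * ρ ^ (n - 1) := by
    have h := (hasSum_nat_mul_pow_div_factorial (R * ρ)).summable.mul_left ρ⁻¹
    refine Summable.of_nonneg_of_le (fun n => by positivity) (fun n => ?_) h
    rcases n with _ | n
    · simp
    · have h1 : ρ⁻¹ * (((n + 1 : ℕ) : ℝ) * ((R * ρ) ^ (n + 1) / ((n + 1).factorial : ℝ))) =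
          ((n + 1 : ℕ) : ℝ) * (R ^ (n + 1) / ((n + 1).factorial : ℝ)) * ρ ^ n := by
        rw [mul_pow, pow_succ ρ]; field_simp
      rw [h1, Nat.add_sub_cancel]
      gcongr
      exact hc _
  set l : ℕ → ℝ := fun n => if n = 0 then 0 else τ (n - 1) / n with hl
  have hls : ∀ k : ℕ, l (k + 1) = τ k / (k + 1) := fun k => by simp [hl]
  have hld : Summable fun n : ℕ => n * |l n| * ρ ^ (n - 1) := by
    rw [← summable_nat_add_iff 1]
    refine hτρ.congr fun n => ?_
    rw [hls, abs_div, Nat.add_sub_cancel, abs_of_pos (by positivity : (0 : ℝ) < n + 1)]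
    push_cast
    field_simp
  set D : ℝ → ℝ := fun z => ∑' n, c n * z ^ n with hD
  set L : ℝ → ℝ := fun z => ∑' n, l n * z ^ n with hL
  have hpow : ∀ {z : ℝ} (_ : |z| < ρ) (n : ℕ), |z| ^ n ≤ ρ ^ n := fun hz n =>
    pow_le_pow_left₀ (abs_nonneg _) hz.le n
  have hL' : ∀ z, |z| < ρ → HasDerivAt L (∑' k, τ k * z ^ k) z := by
    intro z hz
    have h := hasDerivAt_tsum_mul_pow hρ0 hld hz
    have hs : Summable fun n : ℕ => l n * (n * z ^ (n - 1)) := by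
      refine Summable.of_norm_bounded hld fun n => ?_
      rw [norm_mul, norm_mul, norm_pow, Real.norm_eq_abs, Real.norm_eq_abs, Real.norm_eq_abs,
        Nat.abs_cast]
      calc |l n| * (n * |z| ^ (n - 1)) ≤ |l n| * (n * ρ ^ (n - 1)) := by gcongr
        _ = n * |l n| * ρ ^ (n - 1) := by ring
    rw [hs.tsum_eq_zero_add] at h
    convert h using 1
    simp only [CharP.cast_eq_zero, zero_mul, mul_zero, zero_add]
    refine tsum_congr fun k => ?_
    rw [hls, Nat.add_sub_cancel]
    push_cast
    field_simp
  have hD' : ∀ z, |z| < ρ → HasDerivAt D (-((∑' k, τ k * z ^ k) * D z)) z := by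
    intro z hz
    have h := hasDerivAt_tsum_mul_pow hρ0 hcd hz
    have hs : Summable fun n : ℕ => c n * (n * z ^ (n - 1)) := by
      refine Summable.of_norm_bounded hcd fun n => ?_
      rw [norm_mul, norm_mul, norm_pow, Real.norm_eq_abs, Real.norm_eq_abs, Real.norm_eq_abs,
        Nat.abs_cast]
      calc |c n| * (n * |z| ^ (n - 1)) ≤ |c n| * (n * ρ ^ (n - 1)) := by gcongr
        _ = n * |c n| * ρ ^ (n - 1) := by ring
    rw [hs.tsum_eq_zero_add] at h
    convert h using 1
    have hn1 : Summable fun k => ‖τ k * z ^ k‖ := by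
      refine Summable.of_nonneg_of_le (fun n => norm_nonneg _) (fun n => ?_) hτρ
      rw [norm_mul, norm_pow, Real.norm_eq_abs, Real.norm_eq_abs]
      exact mul_le_mul_of_nonneg_left (hpow hz n) (abs_nonneg _)
    have hn2 : Summable fun k => ‖c k * z ^ k‖ := by
      refine Summable.of_nonneg_of_le (fun n => norm_nonneg _) (fun n => ?_) hcρ
      rw [norm_mul, norm_pow, Real.norm_eq_abs, Real.norm_eq_abs]
      exact mul_le_mul_of_nonneg_left (hpow hz n) (abs_nonneg _)
    rw [hD, tsum_mul_tsum_eq_tsum_sum_range_of_summable_norm hn1 hn2, ← tsum_neg]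
    simp only [CharP.cast_eq_zero, zero_mul, mul_zero, zero_add]
    refine tsum_congr fun n => ?_
    have h2 : ∀ k ∈ Finset.range (n + 1), τ k * z ^ k * (c (n - k) * z ^ (n - k)) =
        τ k * c (n - k) * z ^ n := by
      intro k hk
      have hk' : k ≤ n := Nat.lt_succ_iff.mp (Finset.mem_range.mp hk)
      rw [show z ^ n = z ^ k * z ^ (n - k) by rw [← pow_add, Nat.add_sub_cancel' hk']]
      ring
    rw [Finset.sum_congr rfl h2, ← Finset.sum_mul, ← neg_mul, ← hnewton n, Nat.add_sub_cancel]
    push_cast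
    ring
  have hG : ∀ z ∈ Set.Icc (0 : ℝ) 1,
      HasDerivAt (fun z => D z * Real.exp (L z)) 0 z := by
    intro z hz
    have hz' : |z| < ρ := by rw [abs_of_nonneg hz.1]; exact hz.2.trans_lt hρ1
    refine ((hD' z hz').mul (hL' z hz').exp).congr_deriv ?_
    ring
  have hconst := constant_of_has_deriv_right_zero
    (fun z hz => (hG z hz).continuousAt.continuousWithinAt)
    (fun z hz => (hG z ⟨hz.1, hz.2.le⟩).hasDerivWithinAt) 1 (by simp)
  have hD0 : D 0 = 1 := by
    rw [hD, ← h0]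
    refine (tsum_eq_single 0 fun n hn => ?_).trans (by simp)
    simp [hn]
  have hL0 : L 0 = 0 := by
    refine (tsum_eq_single 0 fun n hn => ?_).trans (by simp [hl])
    simp [hn]
  have hD1 : D 1 = ∑' n, c n := by simp [hD]
  have hcs : Summable c := by
    refine Summable.of_norm_bounded hcρ fun n => ?_
    exact le_mul_of_one_le_right (abs_nonneg _) (one_le_pow₀ hρ1.le)
  have hlsum : Summable l := by
    rw [← summable_nat_add_iff 1]
    refine Summable.of_norm_bounded hτρ fun n => ?_
    rw [hls, Real.norm_eq_abs, abs_div, abs_of_pos (by positivity : (0 : ℝ) < n + 1)]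
    calc |τ n| / (n + 1) ≤ |τ n| :=
          div_le_self (abs_nonneg _) (by linarith [Nat.cast_nonneg (α := ℝ) n])
      _ ≤ |τ n| * ρ ^ n := le_mul_of_one_le_right (abs_nonneg _) (one_le_pow₀ hρ1.le)
  have hL1 : L 1 = ∑' k : ℕ, τ k / (k + 1) := by
    simp only [hL, one_pow, mul_one]
    rw [hlsum.tsum_eq_zero_add]
    simp only [hls]
    simp [hl]
  rw [hD0, hL0, hD1, hL1, Real.exp_zero, one_mul] at hconst
  have : ∑' n, c n = Real.exp (-∑' k : ℕ, τ k / (k + 1)) := by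
    rw [Real.exp_neg]
    exact eq_inv_of_mul_eq_one_left hconst
  rw [← this]
  exact hcs.hasSum

/-- Newton's identities for the terms `(-1) ^ n / n! * fredholmCoeff ν K n` of the Fredholm
determinant at `1` and the traces. -/
theorem fredholm_newton {α : Type*} [MeasurableSpace α] {ν : Measure α} {K : α → α → ℝ} {c : ℝ}
    [IsFiniteMeasure ν] (hKm : Measurable (Function.uncurry K))
    (hK0 : ∀ x y, 0 ≤ K x y) (hc : ∀ x y, K x y ≤ c) (n : ℕ) :
    (n + 1) * ((-1) ^ (n + 1) * fredholmCoeff ν K (n + 1) / ((n + 1).factorial : ℝ)) =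
      -∑ k ∈ Finset.range (n + 1), iterTrace ν K k *
        ((-1) ^ (n - k) * fredholmCoeff ν K (n - k) / ((n - k).factorial : ℝ)) := by
  rw [fredholmCoeff_succ hKm hK0 hc, Finset.mul_sum, Finset.sum_div, Finset.mul_sum,
    ← Finset.sum_neg_distrib]
  refine Finset.sum_congr rfl fun k hk => ?_
  have hk' : k ≤ n := Nat.lt_succ_iff.mp (Finset.mem_range.mp hk)
  have h1 : (n.factorial : ℝ) = (n - k).factorial * n.descFactorial k := by
    rw [← Nat.factorial_mul_descFactorial hk']; push_cast; ring
  have h2 : (n.descFactorial k : ℝ) ≠ 0 := by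
    have := Nat.descFactorial_pos.mpr hk'
    positivity
  have h3 : (-1 : ℝ) ^ (n + 1) * (-1) ^ k = -(-1) ^ (n - k) := by
    obtain ⟨j, rfl⟩ := Nat.exists_eq_add_of_le hk'
    rw [Nat.add_sub_cancel_left, ← pow_add, show k + j + 1 + k = 2 * k + (j + 1) by ring, pow_add,
      pow_mul]
    simp [pow_succ]
  rw [Nat.factorial_succ]
  push_cast
  rw [h1]
  have h4 : (n : ℝ) + 1 ≠ 0 := by positivity
  field_simp
  rw [show (-1 : ℝ) ^ (n + 1) * (-1) ^ k * iterTrace ν K k * fredholmCoeff ν K (n - k) =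
    ((-1 : ℝ) ^ (n + 1) * (-1) ^ k) * (iterTrace ν K k * fredholmCoeff ν K (n - k)) by ring, h3]
  ring

end Exponential

/-! ### Geometric decay of the traces -/

section Decay

variable {α : Type*} [MeasurableSpace α] {ν : Measure α} {K : α → α → ℝ} {c : ℝ}

theorem integral_iterKernel_mul [IsFiniteMeasure ν] (hKm : Measurable (Function.uncurry K))
    (hK0 : ∀ x y, 0 ≤ K x y) (hc : ∀ x y, K x y ≤ c) (j l : ℕ) (x y : α) :
    ∫ z, iterKernel ν K j x z * iterKernel ν K l z y ∂ν = iterKernel ν K (j + l + 1) x y := by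
  induction j generalizing x with
  | zero => simp only [iterKernel, zero_add]
  | succ j ih =>
    have hc0 : 0 ≤ c := (hK0 x y).trans (hc x y)
    have hm : Measurable (Function.uncurry fun z w : α =>
        K x w * iterKernel ν K j w z * iterKernel ν K l z y) := by
      refine Measurable.mul (Measurable.mul ?_ ?_) ?_
      · exact hKm.comp (f := fun p : α × α => (x, p.2)) (by fun_prop)
      · exact (measurable_iterKernel hKm j).comp (f := fun p : α × α => (p.2, p.1)) (by fun_prop)
      · exact (measurable_iterKernel hKm l).comp (f := fun p : α × α => (p.1, y)) (by fun_prop)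
    have hb : ∀ z w, |K x w * iterKernel ν K j w z * iterKernel ν K l z y| ≤
        c * (c * (c * ν.real Set.univ) ^ j) * (c * (c * ν.real Set.univ) ^ l) := by
      intro z w
      have h1 := iterKernel_nonneg (ν := ν) hK0 j w z
      have h2 := iterKernel_nonneg (ν := ν) hK0 l z y
      have h3 := iterKernel_le (ν := ν) hK0 hc j w z
      have h4 := iterKernel_le (ν := ν) hK0 hc l z y
      have h5 := hK0 x w
      rw [abs_of_nonneg (by positivity)]
      have := hc x w
      gcongr
    calc ∫ z, iterKernel ν K (j + 1) x z * iterKernel ν K l z y ∂ν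
        = ∫ z, ∫ w, K x w * iterKernel ν K j w z * iterKernel ν K l z y ∂ν ∂ν := by
          simp_rw [integral_mul_const]; rfl
      _ = ∫ w, ∫ z, K x w * iterKernel ν K j w z * iterKernel ν K l z y ∂ν ∂ν :=
          integral_integral_swap (integrable_of_measurable_of_bound hm fun p => hb p.1 p.2)
      _ = iterKernel ν K (j + 1 + l + 1) x y := by
          simp_rw [mul_assoc, integral_const_mul, ih]
          rw [show j + 1 + l + 1 = j + l + 1 + 1 by ring]; rfl

theorem iterKernel_symm [IsFiniteMeasure ν] (hKm : Measurable (Function.uncurry K))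
    (hsymm : ∀ x y, K x y = K y x) (hK0 : ∀ x y, 0 ≤ K x y) (hc : ∀ x y, K x y ≤ c) (k : ℕ)
    (x y : α) : iterKernel ν K k x y = iterKernel ν K k y x := by
  induction k generalizing x y with
  | zero => exact hsymm x y
  | succ k ih =>
    have h := integral_iterKernel_mul (ν := ν) hKm hK0 hc k 0 y x
    rw [add_zero] at h
    rw [← h]
    simp only [iterKernel]
    refine integral_congr_ae (Filter.Eventually.of_forall fun z => ?_)
    simp only
    rw [ih z y, hsymm x z, mul_comm]

theorem integral_pi_eval [IsFiniteMeasure ν] {n : ℕ} (l : Fin (n + 1)) {f : α → ℝ}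
    (hf : Measurable f) {C : ℝ} (hC : ∀ z, |f z| ≤ C) :
    ∫ w, f (w l) ∂(Measure.pi fun _ : Fin (n + 1) => ν) =
      ν.real Set.univ ^ n * ∫ z, f z ∂ν := by
  rw [integral_pi_succAbove l (F := fun z _ => f z) (hf.comp measurable_fst) fun z _ => hC z]
  simp [Measure.real, Measure.pi_univ, integral_const_mul]

theorem integral_pi_eval_eval [IsFiniteMeasure ν] {n : ℕ} {l m : Fin (n + 2)} (hlm : m ≠ l)
    {F : α → α → ℝ} (hF : Measurable (Function.uncurry F)) {C : ℝ} (hC : ∀ z w, |F z w| ≤ C) :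
    ∫ w, F (w l) (w m) ∂(Measure.pi fun _ : Fin (n + 2) => ν) =
      ν.real Set.univ ^ n * ∫ z, ∫ w, F z w ∂ν ∂ν := by
  obtain ⟨m', rfl⟩ := Fin.exists_succAbove_eq hlm
  rw [integral_pi_succAbove l (F := fun z w => F z (w m'))
    (hF.comp (f := fun p : α × (Fin (n + 1) → α) => (p.1, p.2 m')) (by fun_prop))
    fun z w => hC z _, ← integral_const_mul]
  refine integral_congr_ae (Filter.Eventually.of_forall fun z => ?_)
  exact integral_pi_eval m' (hF.comp measurable_prodMk_left) (hC z)

/-- Positivity of the quadratic form of `K` on the measure `δ_x + g ν`. It is obtained from the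
positivity of the matrices `(K (x i) (x j))`, for `x` followed by `n` points sampled from `ν`, in
the limit `n → ∞`; no regularity of `K` at `x` is needed. -/
theorem quadForm_dirac_add_nonneg [IsFiniteMeasure ν] (hKm : Measurable (Function.uncurry K))
    (hsymm : ∀ x y, K x y = K y x) (hK0 : ∀ x y, 0 ≤ K x y) (hc : ∀ x y, K x y ≤ c) {x : α}
    (hx : ∀ n : ℕ, ∀ᵐ y ∂(Measure.pi fun _ : Fin n => ν),
      (kernelMatrix K (Fin.cons x y : Fin (n + 1) → α)).PosSemidef)
    {g : α → ℝ} (hg : Measurable g) {C : ℝ} (hC : ∀ y, |g y| ≤ C) :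
    0 ≤ K x x + 2 * ∫ y, K x y * g y ∂ν + ∫ y, ∫ z, g y * K y z * g z ∂ν ∂ν := by
  have hc0 : 0 ≤ c := (hK0 x x).trans (hc x x)
  have hC0 : 0 ≤ C := (abs_nonneg _).trans (hC x)
  rcases eq_or_ne ν 0 with rfl | hν
  · simpa using hK0 x x
  have hN : 0 < ν.real Set.univ := by
    have : NeZero ν := ⟨hν⟩
    exact measureReal_univ_pos
  set N := ν.real Set.univ with hNdef
  set I1 := ∫ y, K x y * g y ∂ν with hI1
  set I2 := ∫ y, ∫ z, g y * K y z * g z ∂ν ∂ν with hI2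
  set E := ∫ y, g y * K y y * g y ∂ν with hE
  have hf1 : Measurable fun y => K x y * g y := (hKm.comp measurable_prodMk_left).mul hg
  have hb1 : ∀ y, |K x y * g y| ≤ c * C := fun y => by
    rw [abs_mul, abs_of_nonneg (hK0 x y)]
    exact mul_le_mul (hc x y) (hC y) (abs_nonneg _) hc0
  have hf2 : Measurable (Function.uncurry fun y z => g y * K y z * g z) :=
    ((hg.comp measurable_fst).mul hKm).mul (hg.comp measurable_snd)
  have hb2 : ∀ y z, |g y * K y z * g z| ≤ C * c * C := fun y z => by
    rw [abs_mul, abs_mul, abs_of_nonneg (hK0 y z)]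
    exact mul_le_mul (mul_le_mul (hC y) (hc y z) (hK0 y z) hC0) (hC z) (abs_nonneg _)
      (by positivity)
  have hfin : ∀ n : ℕ, 0 ≤ K x x + 2 * I1 + I2 + (N * E - I2) * (1 / ((n + 1 : ℕ) + 1 : ℝ)) := by
    intro n
    set a : ℝ := N / (n + 2) with ha
    have hpos : ∀ᵐ y ∂(Measure.pi fun _ : Fin (n + 2) => ν),
        0 ≤ K x x + 2 * a * ∑ i, K x (y i) * g (y i) +
          a ^ 2 * ∑ i, ∑ j, g (y i) * K (y i) (y j) * g (y j) := by
      filter_upwards [hx (n + 2)] with y hy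
      have h := hy.dotProduct_mulVec_nonneg
        (Fin.cons 1 fun i => a * g (y i) : Fin (n + 2 + 1) → ℝ)
      simp only [dotProduct, Matrix.mulVec, Fin.sum_univ_succ (n := n + 2), star_trivial,
        Matrix.of_apply, Fin.cons_zero, Fin.cons_succ, Pi.star_apply] at h
      refine h.trans_eq ?_
      have e1 : ∑ i, K x (y i) * (a * g (y i)) = a * ∑ i, K x (y i) * g (y i) := by
        rw [Finset.mul_sum]; exact Finset.sum_congr rfl fun i _ => by ring
      have e2 : ∑ i, a * g (y i) * (K (y i) x * 1 + ∑ j, K (y i) (y j) * (a * g (y j))) =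
          a * ∑ i, K x (y i) * g (y i) +
            a ^ 2 * ∑ i, ∑ j, g (y i) * K (y i) (y j) * g (y j) := by
        rw [Finset.mul_sum, Finset.mul_sum, ← Finset.sum_add_distrib]
        refine Finset.sum_congr rfl fun i _ => ?_
        rw [hsymm (y i) x, mul_add, Finset.mul_sum, Finset.mul_sum]
        congr 1
        · ring
        · exact Finset.sum_congr rfl fun j _ => by ring
      rw [e1, e2]
      ring
    have hi1 : ∀ i : Fin (n + 2), Integrable (fun y => K x (y i) * g (y i))
        (Measure.pi fun _ : Fin (n + 2) => ν) := fun i =>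
      integrable_of_measurable_of_bound (hf1.comp (measurable_pi_apply i)) fun y => hb1 (y i)
    have hi2 : ∀ i j : Fin (n + 2), Integrable (fun y => g (y i) * K (y i) (y j) * g (y j))
        (Measure.pi fun _ : Fin (n + 2) => ν) := fun i j =>
      integrable_of_measurable_of_bound
        (hf2.comp (f := fun y : Fin (n + 2) → α => (y i, y j)) (by fun_prop))
        fun y => hb2 (y i) (y j)
    have hint := integral_nonneg_of_ae hpos
    rw [integral_add, integral_add, integral_const, integral_const_mul, integral_const_mul,
      integral_finsetSum _ fun i _ => hi1 i,
      integral_finsetSum _ fun i _ => integrable_finsetSum _ fun j _ => hi2 i j] at hint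
    rotate_left
    · exact integrable_const _
    · exact (integrable_finsetSum _ fun i _ => hi1 i).const_mul _
    · exact (integrable_const _).add ((integrable_finsetSum _ fun i _ => hi1 i).const_mul _)
    · exact (integrable_finsetSum _ fun i _ => integrable_finsetSum _ fun j _ =>
        hi2 i j).const_mul _
    have hsum : ∀ i : Fin (n + 2), ∫ y, ∑ j, g (y i) * K (y i) (y j) * g (y j)
        ∂(Measure.pi fun _ : Fin (n + 2) => ν) = N ^ (n + 1) * E + (n + 1) * (N ^ n * I2) := by
      intro i
      rw [integral_finsetSum _ fun j _ => hi2 i j, ← Finset.add_sum_erase _ _ (Finset.mem_univ i)]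
      congr 1
      · exact integral_pi_eval i (f := fun y => g y * K y y * g y)
          (hf2.comp (measurable_id.prodMk measurable_id)) fun y => hb2 y y
      · rw [Finset.sum_congr rfl fun j hj =>
          integral_pi_eval_eval (Finset.ne_of_mem_erase hj) hf2 hb2]
        simp [hI2, hNdef]
    simp_rw [hsum] at hint
    rw [Finset.sum_congr rfl fun i _ => integral_pi_eval i hf1 hb1] at hint
    simp only [Finset.sum_const, Finset.card_univ, Fintype.card_fin, nsmul_eq_mul, smul_eq_mul,
      Measure.real, Measure.pi_univ, Finset.prod_const, ENNReal.toReal_pow] at hint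
    rw [← Measure.real, ← hNdef, ← hI1] at hint
    refine nonneg_of_mul_nonneg_right (a := N ^ (n + 2)) ?_ (by positivity)
    refine hint.trans_eq ?_
    rw [ha]
    push_cast
    field_simp
    ring
  have hlim := ((tendsto_one_div_add_atTop_nhds_zero_nat (𝕜 := ℝ)).comp
    (Filter.tendsto_add_atTop_nat 1)).const_mul (N * E - I2)
  have := ge_of_tendsto' (hlim.const_add (K x x + 2 * I1 + I2)) hfin
  simpa using this

/-- The integral operator with kernel `K` on `L²(ν)` has its quadratic form between `0` and `M`
times the squared norm, tested on bounded functions. -/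
def QuadFormBound (ν : Measure α) (K : α → α → ℝ) (M : ℝ) : Prop :=
  ∀ f : α → ℝ, Measurable f → (∃ C, ∀ x, |f x| ≤ C) →
    0 ≤ ∫ x, f x * ∫ y, K x y * f y ∂ν ∂ν ∧
      ∫ x, f x * ∫ y, K x y * f y ∂ν ∂ν ≤ M * ∫ x, f x ^ 2 ∂ν

/-- Even steps: apply the upper bound of the form to `iterKernel ν K j x`. -/
theorem iterKernel_two_mul_add_two_le [IsFiniteMeasure ν] (hKm : Measurable (Function.uncurry K))
    (hsymm : ∀ x y, K x y = K y x) (hK0 : ∀ x y, 0 ≤ K x y) (hc : ∀ x y, K x y ≤ c) {M : ℝ}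
    (hM : QuadFormBound ν K M) (j : ℕ) (x : α) :
    iterKernel ν K (2 * j + 2) x x ≤ M * iterKernel ν K (2 * j + 1) x x := by
  have hs := iterKernel_symm (ν := ν) hKm hsymm hK0 hc
  have h := (hM (fun y => iterKernel ν K j y x)
    ((measurable_iterKernel hKm j).comp measurable_prodMk_right)
    ⟨_, fun y => (abs_of_nonneg (iterKernel_nonneg hK0 j y x)).trans_le
      (iterKernel_le hK0 hc j y x)⟩).2
  have e1 : ∫ z, iterKernel ν K j z x * ∫ y, K z y * iterKernel ν K j y x ∂ν ∂ν =
      iterKernel ν K (2 * j + 2) x x := by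
    rw [show 2 * j + 2 = j + (j + 1) + 1 by ring, ← integral_iterKernel_mul hKm hK0 hc]
    refine integral_congr_ae (Filter.Eventually.of_forall fun z => ?_)
    simp only [hs j x z]
    rfl
  have e2 : ∫ z, iterKernel ν K j z x ^ 2 ∂ν = iterKernel ν K (2 * j + 1) x x := by
    rw [show 2 * j + 1 = j + j + 1 by ring, ← integral_iterKernel_mul hKm hK0 hc]
    simp_rw [sq, hs j x _]
  rwa [e1, e2] at h

/-- Odd steps: apply the positivity of the form to
`iterKernel ν K j x - M⁻¹ * iterKernel ν K (j + 1) x`, and the previous bound for the even step. -/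
theorem iterKernel_two_mul_add_three_le [IsFiniteMeasure ν]
    (hKm : Measurable (Function.uncurry K)) (hsymm : ∀ x y, K x y = K y x)
    (hK0 : ∀ x y, 0 ≤ K x y) (hc : ∀ x y, K x y ≤ c) {M : ℝ} (hM0 : 0 < M)
    (hM : QuadFormBound ν K M) (j : ℕ) (x : α) :
    iterKernel ν K (2 * j + 3) x x ≤ M * iterKernel ν K (2 * j + 2) x x := by
  have hs := iterKernel_symm (ν := ν) hKm hsymm hK0 hc
  have hm : ∀ j, Measurable fun y => iterKernel ν K j y x := fun j =>
    (measurable_iterKernel hKm j).comp measurable_prodMk_right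
  have hb : ∀ j y, |iterKernel ν K j y x| ≤ c * (c * ν.real Set.univ) ^ j := fun j y =>
    (abs_of_nonneg (iterKernel_nonneg hK0 j y x)).trans_le (iterKernel_le hK0 hc j y x)
  have h := (hM (fun y => M * iterKernel ν K j y x - iterKernel ν K (j + 1) y x)
    (((hm j).const_mul M).sub (hm (j + 1)))
    ⟨M * (c * (c * ν.real Set.univ) ^ j) + c * (c * ν.real Set.univ) ^ (j + 1), fun y => by
      refine (abs_sub _ _).trans (add_le_add ?_ (hb _ _))
      rw [abs_mul, abs_of_pos hM0]
      exact mul_le_mul_of_nonneg_left (hb _ _) hM0.le⟩).1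
  have hI : ∀ i k, Integrable (fun z => iterKernel ν K i z x * iterKernel ν K k z x) ν := by
    intro i k
    refine (integrable_mul_iterKernel (ν := ν) hKm hK0 hc i k x x).congr
      (Filter.Eventually.of_forall fun z => ?_)
    simp only [hs i x z]
  have hv : ∀ i k, ∫ z, iterKernel ν K i z x * iterKernel ν K k z x ∂ν =
      iterKernel ν K (i + k + 1) x x := by
    intro i k
    rw [← integral_iterKernel_mul hKm hK0 hc]
    simp_rw [hs i x _]
  have e1 : ∀ z, ∫ y, K z y * (M * iterKernel ν K j y x - iterKernel ν K (j + 1) y x) ∂ν =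
      M * iterKernel ν K (j + 1) z x - iterKernel ν K (j + 2) z x := by
    intro z
    have i1 := integrable_mul_iterKernel (ν := ν) hKm hK0 hc 0 j z x
    have i2 := integrable_mul_iterKernel (ν := ν) hKm hK0 hc 0 (j + 1) z x
    simp only [iterKernel] at i1 i2 ⊢
    rw [← integral_const_mul, ← integral_sub (i1.const_mul M) i2]
    refine integral_congr_ae (Filter.Eventually.of_forall fun y => ?_)
    simp only
    ring
  simp_rw [e1] at h
  have e2 : ∫ z, (M * iterKernel ν K j z x - iterKernel ν K (j + 1) z x) *
      (M * iterKernel ν K (j + 1) z x - iterKernel ν K (j + 2) z x) ∂ν =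
      M ^ 2 * iterKernel ν K (2 * j + 2) x x - 2 * M * iterKernel ν K (2 * j + 3) x x +
        iterKernel ν K (2 * j + 4) x x := by
    have : ∀ z, (M * iterKernel ν K j z x - iterKernel ν K (j + 1) z x) *
        (M * iterKernel ν K (j + 1) z x - iterKernel ν K (j + 2) z x) =
        M ^ 2 * (iterKernel ν K j z x * iterKernel ν K (j + 1) z x) -
        M * (iterKernel ν K j z x * iterKernel ν K (j + 2) z x) -
        M * (iterKernel ν K (j + 1) z x * iterKernel ν K (j + 1) z x) +
        iterKernel ν K (j + 1) z x * iterKernel ν K (j + 2) z x := fun z => by ring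
    simp_rw [this]
    rw [integral_add _ (hI _ _), integral_sub _ ((hI _ _).const_mul _),
      integral_sub ((hI _ _).const_mul _) ((hI _ _).const_mul _), integral_const_mul,
      integral_const_mul, integral_const_mul, hv, hv, hv, hv,
      show j + (j + 1) + 1 = 2 * j + 2 by ring, show j + (j + 2) + 1 = 2 * j + 3 by ring,
      show j + 1 + (j + 1) + 1 = 2 * j + 3 by ring, show j + 1 + (j + 2) + 1 = 2 * j + 4 by ring]
    · ring
    · exact ((hI _ _).const_mul _).sub ((hI _ _).const_mul _)
    · exact (((hI _ _).const_mul _).sub ((hI _ _).const_mul _)).sub ((hI _ _).const_mul _)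
  rw [e2] at h
  have h2 := iterKernel_two_mul_add_two_le hKm hsymm hK0 hc hM (j + 1) x
  rw [show 2 * (j + 1) + 2 = 2 * j + 4 by ring, show 2 * (j + 1) + 1 = 2 * j + 3 by ring] at h2
  refine le_of_mul_le_mul_left ?_ hM0
  nlinarith

/-- The first step, where `K x x` is not the value of an iterated integral. -/
theorem iterKernel_one_le [IsFiniteMeasure ν]
    (hKm : Measurable (Function.uncurry K)) (hsymm : ∀ x y, K x y = K y x)
    (hK0 : ∀ x y, 0 ≤ K x y) (hc : ∀ x y, K x y ≤ c) {M : ℝ} (hM0 : 0 < M)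
    (hM : QuadFormBound ν K M) {x : α}
    (hx : ∀ n : ℕ, ∀ᵐ y ∂(Measure.pi fun _ : Fin n => ν),
      (kernelMatrix K (Fin.cons x y : Fin (n + 1) → α)).PosSemidef) :
    iterKernel ν K 1 x x ≤ M * K x x := by
  have h := quadForm_dirac_add_nonneg hKm hsymm hK0 hc hx (g := fun y => -M⁻¹ * K y x)
    ((hKm.comp measurable_prodMk_right).const_mul _) (C := M⁻¹ * c) (fun y => by
      rw [abs_mul, abs_neg, abs_of_pos (inv_pos.mpr hM0), abs_of_nonneg (hK0 _ _)]
      exact mul_le_mul_of_nonneg_left (hc _ _) (inv_pos.mpr hM0).le)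
  have e1 : ∫ y, K x y * (-M⁻¹ * K y x) ∂ν = -M⁻¹ * iterKernel ν K 1 x x := by
    simp only [iterKernel]
    rw [← integral_const_mul]
    exact integral_congr_ae (Filter.Eventually.of_forall fun y => by simp only; ring)
  have e2 : ∫ y, ∫ z, -M⁻¹ * K y x * K y z * (-M⁻¹ * K z x) ∂ν ∂ν =
      M⁻¹ ^ 2 * iterKernel ν K 2 x x := by
    simp only [iterKernel]
    rw [← integral_const_mul]
    refine integral_congr_ae (Filter.Eventually.of_forall fun y => ?_)
    simp only
    rw [← integral_const_mul, ← integral_const_mul]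
    refine integral_congr_ae (Filter.Eventually.of_forall fun z => ?_)
    simp only
    rw [hsymm y x]
    ring
  rw [e1, e2] at h
  have h2 := iterKernel_two_mul_add_two_le hKm hsymm hK0 hc hM 0 x
  simp only [mul_zero, zero_add] at h2
  have h3 : M⁻¹ ^ 2 * iterKernel ν K 2 x x ≤ M⁻¹ * iterKernel ν K 1 x x := by
    calc M⁻¹ ^ 2 * iterKernel ν K 2 x x ≤ M⁻¹ ^ 2 * (M * iterKernel ν K 1 x x) := by gcongr
      _ = M⁻¹ * iterKernel ν K 1 x x := by field_simp
  have h4 : M⁻¹ * iterKernel ν K 1 x x ≤ K x x := by linarith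
  rwa [inv_mul_le_iff₀ hM0] at h4

theorem ae_ae_posSemidef_cons [IsFiniteMeasure ν]
    (hpsd : ∀ n : ℕ, ∀ᵐ y ∂(Measure.pi fun _ : Fin n => ν), (kernelMatrix K y).PosSemidef) :
    ∀ᵐ x ∂ν, ∀ n : ℕ, ∀ᵐ y ∂(Measure.pi fun _ : Fin n => ν),
      (kernelMatrix K (Fin.cons x y : Fin (n + 1) → α)).PosSemidef := by
  rw [ae_all_iff]
  intro n
  have h := (measurePreserving_piFinSuccAbove (fun _ : Fin (n + 1) => ν)
    0).symm.quasiMeasurePreserving.ae (hpsd (n + 1))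
  refine (Measure.ae_ae_of_ae_prod h).mono fun x hx => hx.mono fun y hy => ?_
  simpa [Fin.consEquiv] using hy

/-- For an operator between `0` and `M` the traces of the powers decay at least by a factor `M`. It
holds pointwise on the diagonal, at almost every point. -/
theorem iterTrace_succ_le [IsFiniteMeasure ν]
    (hKm : Measurable (Function.uncurry K)) (hsymm : ∀ x y, K x y = K y x)
    (hK0 : ∀ x y, 0 ≤ K x y) (hc : ∀ x y, K x y ≤ c) {M : ℝ} (hM0 : 0 < M)
    (hM : QuadFormBound ν K M)
    (hpsd : ∀ n : ℕ, ∀ᵐ y ∂(Measure.pi fun _ : Fin n => ν), (kernelMatrix K y).PosSemidef)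
    (k : ℕ) : iterTrace ν K (k + 1) ≤ M * iterTrace ν K k := by
  rw [iterTrace, iterTrace, ← integral_const_mul]
  refine integral_mono_ae (integrable_iterKernel_diag hKm hK0 hc _)
    ((integrable_iterKernel_diag hKm hK0 hc _).const_mul M) ?_
  filter_upwards [ae_ae_posSemidef_cons hpsd] with x hx
  rcases Nat.even_or_odd' k with ⟨j, rfl | rfl⟩
  · rcases j with _ | j
    · exact iterKernel_one_le hKm hsymm hK0 hc hM0 hM hx
    · exact iterKernel_two_mul_add_three_le hKm hsymm hK0 hc hM0 hM j x
  · exact iterKernel_two_mul_add_two_le hKm hsymm hK0 hc hM j x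

theorem iterTrace_nonneg (hK0 : ∀ x y, 0 ≤ K x y) (k : ℕ) : 0 ≤ iterTrace ν K k :=
  integral_nonneg fun x => iterKernel_nonneg hK0 k x x

theorem iterTrace_le_mul_pow [IsFiniteMeasure ν]
    (hKm : Measurable (Function.uncurry K)) (hsymm : ∀ x y, K x y = K y x)
    (hK0 : ∀ x y, 0 ≤ K x y) (hc : ∀ x y, K x y ≤ c) {M : ℝ} (hM0 : 0 < M)
    (hM : QuadFormBound ν K M)
    (hpsd : ∀ n : ℕ, ∀ᵐ y ∂(Measure.pi fun _ : Fin n => ν), (kernelMatrix K y).PosSemidef)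
    (k : ℕ) : iterTrace ν K k ≤ iterTrace ν K 0 * M ^ k := by
  induction k with
  | zero => simp
  | succ k ih =>
    calc iterTrace ν K (k + 1) ≤ M * iterTrace ν K k :=
          iterTrace_succ_le hKm hsymm hK0 hc hM0 hM hpsd k
      _ ≤ M * (iterTrace ν K 0 * M ^ k) := by gcongr
      _ = iterTrace ν K 0 * M ^ (k + 1) := by ring

end Decay

/-! ### The integral operator -/

section Operator

variable {d : ℕ}

local notation "𝔼" => EuclideanSpace ℝ (Fin d)

variable {μ : Measure (EuclideanSpace ℝ (Fin d))}
  {K : EuclideanSpace ℝ (Fin d) → EuclideanSpace ℝ (Fin d) → ℝ} {T : Lp ℝ 2 μ →L[ℝ] Lp ℝ 2 μ}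

theorem integrable_kernel_mul_mul [SigmaFinite μ] (hKm : Measurable (Function.uncurry K))
    (hK0 : ∀ x y, 0 ≤ K x y) (hT : IsIntegralOperator μ K T) (f g : Lp ℝ 2 μ) :
    Integrable (fun z : 𝔼 × 𝔼 => K z.1 z.2 * f z.2 * g z.1) (μ.prod μ) := by
  have hm : AEStronglyMeasurable (fun z : 𝔼 × 𝔼 => K z.1 z.2 * f z.2 * g z.1) (μ.prod μ) :=
    (hKm.aestronglyMeasurable.mul (Lp.aestronglyMeasurable f).comp_snd).mul
      (Lp.aestronglyMeasurable g).comp_fst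
  rw [integrable_prod_iff hm]
  constructor
  · filter_upwards [hT f] with x hx
    exact hx.1.mul_const _
  · -- the inner integral of the absolute value is `T |f| * |g|`, a product of two `L²` functions
    have h : Integrable (fun x => T |f| x * ‖g x‖) μ :=
      MemLp.integrable_mul (Lp.memLp (T |f|)) (Lp.memLp g).norm
    refine h.congr ?_
    filter_upwards [hT |f|] with x hx
    rw [hx.2, ← integral_mul_const]
    refine integral_congr_ae ?_
    filter_upwards [Lp.coeFn_abs f] with y hy
    simp only [hy, norm_mul, Real.norm_eq_abs, abs_of_nonneg (hK0 x y)]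

theorem inner_integralOperator (hT : IsIntegralOperator μ K T) (f g : Lp ℝ 2 μ) :
    inner ℝ (T f) g = ∫ x, g x * ∫ y, K x y * f y ∂μ ∂μ := by
  rw [L2.inner_def]
  refine integral_congr_ae ?_
  filter_upwards [hT f] with x hx
  rw [hx.2]
  simp

theorem isSelfAdjoint_integralOperator [SigmaFinite μ] (hKm : Measurable (Function.uncurry K))
    (hsymm : ∀ x y, K x y = K y x) (hK0 : ∀ x y, 0 ≤ K x y) (hT : IsIntegralOperator μ K T) :
    IsSelfAdjoint T := by
  rw [ContinuousLinearMap.isSelfAdjoint_iff_isSymmetric]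
  intro f g
  change inner ℝ (T f) g = inner ℝ f (T g)
  rw [real_inner_comm (T g) f, inner_integralOperator hT, inner_integralOperator hT]
  have h := integral_integral_swap (f := fun x y => K x y * f y * g x)
    (integrable_kernel_mul_mul hKm hK0 hT f g)
  calc ∫ x, g x * ∫ y, K x y * f y ∂μ ∂μ = ∫ x, ∫ y, K x y * f y * g x ∂μ ∂μ := by
        simp_rw [integral_mul_const, mul_comm]
    _ = ∫ y, ∫ x, K x y * f y * g x ∂μ ∂μ := h
    _ = ∫ y, f y * ∫ x, K y x * g x ∂μ ∂μ := by
        refine integral_congr_ae (Filter.Eventually.of_forall fun y => ?_)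
        simp only
        rw [← integral_const_mul]
        refine integral_congr_ae (Filter.Eventually.of_forall fun x => ?_)
        simp only
        rw [hsymm x y]
        ring

theorem norm_le_of_spectrum_subset {E : Type*} [NormedAddCommGroup E] [InnerProductSpace ℝ E]
    [CompleteSpace E] {S : E →L[ℝ] E} (hS : IsSelfAdjoint S) {M : ℝ} (hM : 0 ≤ M)
    (hspec : spectrum ℝ S ⊆ Set.Icc 0 M) : ‖S‖ ≤ M := by
  have h := ContinuousLinearMap.spectralRadius_eq_nnnorm S hS
  have h2 : spectralRadius ℝ S ≤ (M.toNNReal : ℝ≥0∞) := by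
    refine iSup₂_le fun k hk => ?_
    have := hspec hk
    rw [ENNReal.coe_le_coe, ← NNReal.coe_le_coe, coe_nnnorm, Real.norm_of_nonneg this.1,
      Real.coe_toNNReal _ hM]
    exact this.2
  rw [h, ENNReal.coe_le_coe, ← NNReal.coe_le_coe, coe_nnnorm, Real.coe_toNNReal _ hM] at h2
  exact h2

/-- The bounds of a quadratic form by the ends of the spectrum: both `S` and `M - S` have norm at
most `M`. -/
theorem inner_mem_Icc_of_spectrum_subset {E : Type*} [NormedAddCommGroup E] [InnerProductSpace ℝ E]
    [CompleteSpace E] {S : E →L[ℝ] E} (hS : IsSelfAdjoint S) {M : ℝ} (hM : 0 ≤ M)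
    (hspec : spectrum ℝ S ⊆ Set.Icc 0 M) (f : E) :
    inner ℝ (S f) f ∈ Set.Icc 0 (M * ‖f‖ ^ 2) := by
  have key : ∀ R : E →L[ℝ] E, ‖R‖ ≤ M → inner ℝ (R f) f ≤ M * ‖f‖ ^ 2 := fun R hR => by
    calc inner ℝ (R f) f ≤ ‖R f‖ * ‖f‖ := real_inner_le_norm _ _
      _ ≤ M * ‖f‖ * ‖f‖ := by
          gcongr
          exact (R.le_opNorm f).trans (by gcongr)
      _ = M * ‖f‖ ^ 2 := by ring
  refine ⟨?_, key S (norm_le_of_spectrum_subset hS hM hspec)⟩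
  have hR : IsSelfAdjoint (algebraMap ℝ (E →L[ℝ] E) M - S) :=
    (IsSelfAdjoint.algebraMap _ (IsSelfAdjoint.all M)).sub hS
  have h := key _ (norm_le_of_spectrum_subset hR hM (by
    rw [← spectrum.singleton_sub_eq]
    rintro _ ⟨a, rfl, b, hb, rfl⟩
    have := hspec hb
    exact ⟨sub_nonneg.mpr this.2, sub_le_self _ this.1⟩))
  have e : (algebraMap ℝ (E →L[ℝ] E) M - S) f = M • f - S f := by
    simp [Algebra.algebraMap_eq_smul_one]
  rw [e, inner_sub_left, real_inner_smul_left, real_inner_self_eq_norm_sq] at h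
  linarith

theorem quadFormBound_restrict [SigmaFinite μ] (hKm : Measurable (Function.uncurry K))
    (hsymm : ∀ x y, K x y = K y x) (hK0 : ∀ x y, 0 ≤ K x y) (hT : IsIntegralOperator μ K T)
    {M : ℝ} (hM : 0 ≤ M) (hspec : spectrum ℝ T ⊆ Set.Icc 0 M) {E : Set 𝔼}
    (hE : MeasurableSet E) (hEfin : μ E ≠ ∞) : QuadFormBound (μ.restrict E) K M := by
  rintro f hf ⟨C, hC⟩
  have hmem : MemLp (E.indicator f) 2 μ := by
    rw [memLp_indicator_iff_restrict hE]
    have : IsFiniteMeasure (μ.restrict E) := isFiniteMeasure_restrict.mpr hEfin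
    exact MemLp.of_bound hf.aestronglyMeasurable C (Filter.Eventually.of_forall hC)
  set F := hmem.toLp with hF
  have hFe : F =ᵐ[μ] E.indicator f := hmem.coeFn_toLp
  have h := inner_mem_Icc_of_spectrum_subset
    (isSelfAdjoint_integralOperator hKm hsymm hK0 hT) hM hspec F
  have e1 : inner ℝ (T F) F = ∫ x in E, f x * ∫ y in E, K x y * f y ∂μ ∂μ := by
    rw [inner_integralOperator hT, ← integral_indicator hE]
    refine integral_congr_ae ?_
    filter_upwards [hFe] with x hx
    have : ∫ y, K x y * F y ∂μ = ∫ y in E, K x y * f y ∂μ := by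
      rw [← integral_indicator hE]
      refine integral_congr_ae ?_
      filter_upwards [hFe] with y hy
      rw [hy]
      by_cases hyE : y ∈ E <;> simp [hyE]
    rw [hx, this]
    by_cases hxE : x ∈ E <;> simp [hxE]
  have e2 : ‖F‖ ^ 2 = ∫ x in E, f x ^ 2 ∂μ := by
    rw [← real_inner_self_eq_norm_sq, L2.inner_def, ← integral_indicator hE]
    refine integral_congr_ae ?_
    filter_upwards [hFe] with x hx
    rw [hx]
    by_cases hxE : x ∈ E <;> simp [hxE, sq]
  rw [e1, e2] at h
  exact h

end Operator

/-! ### Void probabilities and the lower bound -/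

section TraceMono

variable {α : Type*} [MeasurableSpace α] {μ : Measure α} {K : α → α → ℝ} {c : ℝ}

theorem iterKernel_mono {ν ν' : Measure α} [IsFiniteMeasure ν'] (hν : ν ≤ ν')
    (hKm : Measurable (Function.uncurry K)) (hK0 : ∀ x y, 0 ≤ K x y) (hc : ∀ x y, K x y ≤ c)
    (k : ℕ) (x y : α) : iterKernel ν K k x y ≤ iterKernel ν' K k x y := by
  induction k generalizing x with
  | zero => exact le_rfl
  | succ k ih =>
    have hI := integrable_mul_iterKernel (ν := ν') hKm hK0 hc 0 k x y
    calc iterKernel ν K (k + 1) x y ≤ ∫ z, K x z * iterKernel ν' K k z y ∂ν := by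
          refine integral_mono_of_nonneg (Filter.Eventually.of_forall fun z =>
            mul_nonneg (hK0 _ _) (iterKernel_nonneg hK0 _ _ _)) (hI.mono_measure hν)
            (Filter.Eventually.of_forall fun z => ?_)
          exact mul_le_mul_of_nonneg_left (ih z) (hK0 _ _)
      _ ≤ iterKernel ν' K (k + 1) x y :=
          integral_mono_measure hν (Filter.Eventually.of_forall fun z =>
            mul_nonneg (hK0 _ _) (iterKernel_nonneg hK0 _ _ _)) hI

theorem iterTrace_add_le_union {A B : Set α} (hAB : Disjoint A B) (hB : MeasurableSet B)
    (hAfin : μ A ≠ ∞) (hBfin : μ B ≠ ∞)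
    (hKm : Measurable (Function.uncurry K)) (hK0 : ∀ x y, 0 ≤ K x y) (hc : ∀ x y, K x y ≤ c)
    (k : ℕ) : iterTrace (μ.restrict A) K k + iterTrace (μ.restrict B) K k ≤
      iterTrace (μ.restrict (A ∪ B)) K k := by
  have : IsFiniteMeasure (μ.restrict A) := isFiniteMeasure_restrict.mpr hAfin
  have : IsFiniteMeasure (μ.restrict B) := isFiniteMeasure_restrict.mpr hBfin
  have : IsFiniteMeasure (μ.restrict (A ∪ B)) :=
    isFiniteMeasure_restrict.mpr (measure_union_ne_top hAfin hBfin)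
  have hA' : μ.restrict A ≤ μ.restrict (A ∪ B) :=
    Measure.restrict_mono Set.subset_union_left le_rfl
  have hB' : μ.restrict B ≤ μ.restrict (A ∪ B) :=
    Measure.restrict_mono Set.subset_union_right le_rfl
  have hI := integrable_iterKernel_diag (ν := μ.restrict (A ∪ B)) hKm hK0 hc k
  rw [iterTrace, iterTrace, iterTrace, setIntegral_union hAB hB (hI.mono_measure hA')
    (hI.mono_measure hB')]
  refine add_le_add (integral_mono (integrable_iterKernel_diag hKm hK0 hc k)
    (hI.mono_measure hA') fun x => ?_) (integral_mono (integrable_iterKernel_diag hKm hK0 hc k)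
    (hI.mono_measure hB') fun x => ?_)
  · exact iterKernel_mono hA' hKm hK0 hc k x x
  · exact iterKernel_mono hB' hKm hK0 hc k x x

theorem iterTrace_one_union {A B : Set α} (hAB : Disjoint A B)
    (hB : MeasurableSet B) (hAfin : μ A ≠ ∞) (hBfin : μ B ≠ ∞)
    (hKm : Measurable (Function.uncurry K)) (hsymm : ∀ x y, K x y = K y x)
    (hK0 : ∀ x y, 0 ≤ K x y) (hc : ∀ x y, K x y ≤ c) :
    iterTrace (μ.restrict (A ∪ B)) K 1 =
      iterTrace (μ.restrict A) K 1 + iterTrace (μ.restrict B) K 1 +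
        2 * ∫ z, K z.1 z.2 ^ 2 ∂((μ.restrict A).prod (μ.restrict B)) := by
  have : IsFiniteMeasure (μ.restrict A) := isFiniteMeasure_restrict.mpr hAfin
  have : IsFiniteMeasure (μ.restrict B) := isFiniteMeasure_restrict.mpr hBfin
  have hb : ∀ x y, |K x y ^ 2| ≤ c ^ 2 := fun x y => by
    rw [abs_of_nonneg (by positivity)]
    exact pow_le_pow_left₀ (hK0 x y) (hc x y) 2
  have hm : Measurable (Function.uncurry fun x y => K x y ^ 2) := hKm.pow_const 2
  have htr : ∀ E : Set α, iterTrace (μ.restrict E) K 1 = ∫ x in E, ∫ y in E, K x y ^ 2 ∂μ ∂μ := by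
    intro E
    simp only [iterTrace, iterKernel]
    refine integral_congr_ae (Filter.Eventually.of_forall fun x => ?_)
    refine integral_congr_ae (Filter.Eventually.of_forall fun y => ?_)
    simp only
    rw [hsymm y x, sq]
  have hin : ∀ (E : Set α) [IsFiniteMeasure (μ.restrict E)] (x : α),
      Integrable (fun y => K x y ^ 2) (μ.restrict E) := fun E _ x =>
    integrable_of_measurable_of_bound (hm.comp measurable_prodMk_left) (hb x)
  have hout : ∀ (E F : Set α) [IsFiniteMeasure (μ.restrict E)] [IsFiniteMeasure (μ.restrict F)],
      Integrable (fun x => ∫ y in F, K x y ^ 2 ∂μ) (μ.restrict E) := fun E F _ _ =>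
    (integrable_of_measurable_of_bound (ν := (μ.restrict E).prod (μ.restrict F)) hm
      fun z => hb z.1 z.2).integral_prod_left
  have hprod : Integrable (Function.uncurry fun x y => K x y ^ 2)
      ((μ.restrict A).prod (μ.restrict B)) :=
    integrable_of_measurable_of_bound hm fun z => hb z.1 z.2
  have hswap : ∫ x in B, ∫ y in A, K x y ^ 2 ∂μ ∂μ = ∫ x in A, ∫ y in B, K x y ^ 2 ∂μ ∂μ := by
    rw [integral_integral_swap hprod]
    simp_rw [hsymm]
  have hsplit : ∀ x, ∫ y in A ∪ B, K x y ^ 2 ∂μ =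
      ∫ y in A, K x y ^ 2 ∂μ + ∫ y in B, K x y ^ 2 ∂μ := fun x =>
    setIntegral_union hAB hB (hin A x) (hin B x)
  rw [htr, htr, htr]
  simp_rw [hsplit]
  rw [setIntegral_union (f := fun x => (∫ y in A, K x y ^ 2 ∂μ) + ∫ y in B, K x y ^ 2 ∂μ) hAB hB
      ((hout A A).add (hout A B)) ((hout B A).add (hout B B)),
    integral_add (hout A A) (hout A B), integral_add (hout B A) (hout B B), hswap,
    integral_prod (fun z : α × α => K z.1 z.2 ^ 2) hprod]
  ring

end TraceMono

section Covariance

/-- The partitions into an event and its complement: the four terms have the same absolute value. -/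
theorem two_mul_abs_covariance_le_betaCoeff {Ω : Type*} {𝒜 ℬ m₀ : MeasurableSpace Ω}
    {P : Measure Ω} [IsProbabilityMeasure P] {S T : Set Ω} (hS : MeasurableSet[𝒜] S)
    (hT : MeasurableSet[ℬ] T) (hSm : MeasurableSet S)
    (hTm : MeasurableSet T) :
    ENNReal.ofReal (2 * |P.real (S ∩ T) - P.real S * P.real T|) ≤ betaCoeff P 𝒜 ℬ := by
  have hpart : ∀ {𝒞 : MeasurableSpace Ω} {U : Set Ω}, MeasurableSet[𝒞] U →
      IsFinitePartition 𝒞 ![U, Uᶜ] := by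
    intro 𝒞 U hU
    refine ⟨fun i => ?_, fun i j hij => ?_, ?_⟩
    · fin_cases i
      · exact hU
      · exact hU.compl
    · fin_cases i <;> fin_cases j <;>
        simp_all [Function.onFun, disjoint_compl_right, disjoint_compl_left]
    · ext ω
      simp [Fin.exists_fin_two, em]
  set δ := |P.real (S ∩ T) - P.real S * P.real T| with hδ
  have hle : ∑ i, ∑ j, ENNReal.ofReal |P.real ((![S, Sᶜ] : Fin 2 → Set Ω) i ∩
      (![T, Tᶜ] : Fin 2 → Set Ω) j) - P.real ((![S, Sᶜ] : Fin 2 → Set Ω) i) *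
        P.real ((![T, Tᶜ] : Fin 2 → Set Ω) j)| ≤
      ⨆ (m : ℕ) (n : ℕ) (A : Fin m → Set Ω) (B : Fin n → Set Ω)
      (_ : IsFinitePartition 𝒜 A) (_ : IsFinitePartition ℬ B),
        ∑ i, ∑ j, ENNReal.ofReal |P.real (A i ∩ B j) - P.real (A i) * P.real (B j)| :=
    le_iSup_of_le 2 (le_iSup_of_le 2 (le_iSup_of_le _ (le_iSup_of_le _
      (le_iSup_of_le (hpart hS) (le_iSup_of_le (hpart hT) le_rfl)))))
  have hc : ∀ {U V : Set Ω}, MeasurableSet V →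
      |P.real (U ∩ Vᶜ) - P.real U * P.real Vᶜ| = |P.real (U ∩ V) - P.real U * P.real V| := by
    intro U V hV
    have h1 := measureReal_inter_add_sdiff (μ := P) (s := U) hV
    rw [Set.sdiff_eq] at h1
    rw [probReal_compl_eq_one_sub hV, ← abs_neg]
    congr 1
    linarith
  have hc' : ∀ {U V : Set Ω}, MeasurableSet U →
      |P.real (Uᶜ ∩ V) - P.real Uᶜ * P.real V| = |P.real (U ∩ V) - P.real U * P.real V| := by
    intro U V hU
    rw [Set.inter_comm, mul_comm, hc hU, Set.inter_comm, mul_comm]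
  rw [Fin.sum_univ_two, Fin.sum_univ_two, Fin.sum_univ_two] at hle
  simp only [Matrix.cons_val_zero, Matrix.cons_val_one, hc' hSm, hc hTm, ← hδ] at hle
  rw [betaCoeff]
  refine le_trans ?_ (mul_le_mul_right hle 2⁻¹)
  rw [← ENNReal.ofReal_add (by positivity) (by positivity),
    ← ENNReal.ofReal_add (by positivity) (by positivity), ← ENNReal.ofReal_ofNat 2,
    ← ENNReal.ofReal_inv_of_pos (by positivity), ← ENNReal.ofReal_mul (by positivity)]
  refine ENNReal.ofReal_le_ofReal (le_of_eq ?_)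
  ring

end Covariance

section LowerBound

variable {d : ℕ}

local notation "𝔼" => EuclideanSpace ℝ (Fin d)

theorem measurableSet_singleton_empty : MeasurableSet[configSpace d] {(∅ : Set 𝔼)} := by
  have h : {(∅ : Set 𝔼)} = ⋂ k : ℕ, {s | (s ∩ Metric.ball 0 k).encard = 0} := by
    ext s
    simp only [Set.mem_singleton_iff, Set.mem_iInter, Set.mem_ofPred_eq, Set.encard_eq_zero]
    refine ⟨fun h k => by simp [h], fun h => ?_⟩
    rw [Set.eq_empty_iff_forall_notMem]
    intro x hx
    obtain ⟨k, hk⟩ := exists_nat_gt ‖x‖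
    have : x ∈ s ∩ Metric.ball 0 (k : ℝ) := ⟨hx, by simpa using hk⟩
    rw [h k] at this
    exact this
  rw [h]
  refine MeasurableSet.iInter fun k => ?_
  exact measurable_encard_inter (d := d) Metric.isBounded_ball measurableSet_ball
    (t := {0}) trivial

variable {Ω : Type*} [MeasurableSpace Ω] {P : Measure Ω} {X : Ω → Set (EuclideanSpace ℝ (Fin d))}
  {μ : Measure (EuclideanSpace ℝ (Fin d))}
  {K : EuclideanSpace ℝ (Fin d) → EuclideanSpace ℝ (Fin d) → ℝ} {c M : ℝ}

/-- The void probabilities in terms of the intensities. -/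
theorem hasSum_void [IsProbabilityMeasure P] [SigmaFinite μ] (hX : IsDPP P X μ K)
    (hKm : Measurable (Function.uncurry K)) (hρ : IntensityBound μ K c) {E : Set 𝔼}
    (hEb : Bornology.IsBounded E) (hE : MeasurableSet E) (hEfin : μ E ≠ ∞) :
    HasSum (fun n : ℕ => (-1) ^ n * fredholmCoeff (μ.restrict E) K n / n.factorial)
      (P.real {ω | X ω ∩ E = ∅}) := by
  have h := hasSum_integral hX hKm hρ hEb hE hEfin (f := Set.indicator {∅} fun _ => 1)
    (Measurable.indicator (m := configSpace d) (@measurable_const _ _ _ (configSpace d) 1)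
      measurableSet_singleton_empty) (fun s => by
        by_cases hs : s ∈ ({∅} : Set (Set 𝔼)) <;> simp [hs])
  have hS : MeasurableSet {ω | X ω ∩ E = ∅} :=
    hX.measurable_inter hE measurableSet_singleton_empty
  have e : ∫ ω, Set.indicator {∅} (fun _ => (1 : ℝ)) (X ω ∩ E) ∂P =
      P.real {ω | X ω ∩ E = ∅} := by
    rw [← integral_indicator_one hS]
    rfl
  rw [e] at h
  refine h.congr_fun fun n => ?_
  simp_rw [moebius_indicator_empty, integral_const_mul, fredholmCoeff]
  ring

theorem abs_fredholmCoeff_le [SigmaFinite μ] (hρ : IntensityBound μ K c) {E : Set 𝔼}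
    (hEfin : μ E ≠ ∞) (n : ℕ) :
    |fredholmCoeff (μ.restrict E) K n| ≤ (c * μ.real E) ^ n := by
  have : IsFiniteMeasure (μ.restrict E) := isFiniteMeasure_restrict.mpr hEfin
  have h := norm_integral_le_of_norm_le_const (ae_pi_restrict_of_ae μ E (hρ n) |>.mono fun x hx =>
    show ‖(kernelMatrix K x).det‖ ≤ c ^ n by rw [Real.norm_of_nonneg hx.1]; exact hx.2)
  rw [Real.norm_eq_abs] at h
  refine h.trans_eq ?_
  simp [Measure.real, Measure.pi_univ, mul_pow]

/-- The void probability as an exponential of traces; this is the identity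
`det (1 - T) = exp (tr (log (1 - T)))` for the operator `T` restricted to `L²(E)`. -/
theorem void_eq_exp [IsProbabilityMeasure P] [SigmaFinite μ] (hX : IsDPP P X μ K)
    (hKm : Measurable (Function.uncurry K)) (hsymm : ∀ x y, K x y = K y x)
    (hK0 : ∀ x y, 0 ≤ K x y) (hc : ∀ x y, K x y ≤ c)
    {E : Set 𝔼} (hEb : Bornology.IsBounded E) (hE : MeasurableSet E) (hEfin : μ E ≠ ∞)
    (hM0 : 0 < M) (hM1 : M < 1) (hM : QuadFormBound (μ.restrict E) K M) :
    P.real {ω | X ω ∩ E = ∅} = Real.exp (-∑' k : ℕ, iterTrace (μ.restrict E) K k / (k + 1)) := by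
  have : IsFiniteMeasure (μ.restrict E) := isFiniteMeasure_restrict.mpr hEfin
  have hρ := hX.intensityBound hsymm fun x => hc x x
  refine (hasSum_void hX hKm hρ hEb hE hEfin).unique (hasSum_exp_of_newton
    (R := c * μ.real E) (C := iterTrace (μ.restrict E) K 0) ?_ (fredholm_newton hKm hK0 hc)
    (fun n => ?_) hM0.le hM1 fun k => ?_)
  · simp [fredholmCoeff, Measure.real]
  · rw [abs_div, abs_mul, abs_pow, abs_neg, abs_one, one_pow, one_mul, Nat.abs_cast]
    gcongr
    exact abs_fredholmCoeff_le hρ hEfin n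
  · rw [abs_of_nonneg (iterTrace_nonneg hK0 k)]
    exact iterTrace_le_mul_pow hKm hsymm hK0 hc hM0 hM
      (fun n => ae_pi_restrict_of_ae μ E (hX.ae_posSemidef hsymm n)) k

theorem iterTrace_zero_le [SigmaFinite μ] (hc : ∀ x y, K x y ≤ c) (hK0 : ∀ x y, 0 ≤ K x y)
    {E : Set 𝔼} (hEfin : μ E ≠ ∞) :
    iterTrace (μ.restrict E) K 0 ≤ c * μ.real E := by
  have : IsFiniteMeasure (μ.restrict E) := isFiniteMeasure_restrict.mpr hEfin
  have h := norm_integral_le_of_norm_le_const (μ := μ.restrict E)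
    (f := fun x => iterKernel (μ.restrict E) K 0 x x) (C := c)
    (Filter.Eventually.of_forall fun x => by
      rw [Real.norm_of_nonneg (iterKernel_nonneg hK0 0 x x)]; exact hc x x)
  simpa [iterTrace] using (le_abs_self _).trans h

/-- Since `∑ M ^ k / (k + 1) = -log (1 - M) / M`. -/
theorem exp_neg_tsum_ge {τ : ℕ → ℝ} {t : ℝ} (hM0 : 0 < M) (hM1 : M < 1)
    (hτ0 : ∀ k, 0 ≤ τ k) (hτ : ∀ k, τ k ≤ t * M ^ k) :
    (1 - M) ^ (t / M) ≤ Real.exp (-∑' k : ℕ, τ k / (k + 1)) := by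
  have h := (Real.hasSum_pow_div_log_of_abs_lt_one (x := M) (by rwa [abs_of_pos hM0])).mul_left
    (t / M)
  have hle : ∀ k : ℕ, τ k / (k + 1) ≤ t / M * (M ^ (k + 1) / (k + 1)) := fun k => by
    calc τ k / (k + 1) ≤ t * M ^ k / (k + 1) := by gcongr; exact hτ k
      _ = t / M * (M ^ (k + 1) / (k + 1)) := by rw [pow_succ]; field_simp
  have h0 : ∀ k : ℕ, 0 ≤ τ k / (k + 1) := fun k => div_nonneg (hτ0 k) (by positivity)
  have hs := Summable.of_nonneg_of_le h0 hle h.summable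
  have h2 := hs.tsum_le_tsum hle h.summable
  rw [h.tsum_eq] at h2
  rw [Real.rpow_def_of_pos (by linarith)]
  refine Real.exp_le_exp.mpr ?_
  linarith

/-- Positive correlation of the void events of two disjoint sets, with a quantitative bound: the
traces of the union exceed the sums of the traces, and the excess of the second one is twice the
mass of `K²` on `A × B`. -/
theorem void_covariance_ge [IsProbabilityMeasure P] [SigmaFinite μ] (hX : IsDPP P X μ K)
    (hKm : Measurable (Function.uncurry K)) (hsymm : ∀ x y, K x y = K y x)
    (hK0 : ∀ x y, 0 ≤ K x y) (hc : ∀ x y, K x y ≤ c)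
    {T : Lp ℝ 2 μ →L[ℝ] Lp ℝ 2 μ} (hT : IsIntegralOperator μ K T)
    (hM0 : 0 < M) (hM1 : M < 1) (hspec : spectrum ℝ T ⊆ Set.Icc 0 M)
    {A B : Set 𝔼} (hAB : Disjoint A B) (hAb : Bornology.IsBounded A) (hBb : Bornology.IsBounded B)
    (hA : MeasurableSet A) (hB : MeasurableSet B) (hAfin : μ A ≠ ∞) (hBfin : μ B ≠ ∞) :
    (1 - M) ^ ((μ.real A + μ.real B) * c / M) *
        ∫ z, K z.1 z.2 ^ 2 ∂((μ.restrict A).prod (μ.restrict B)) ≤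
      P.real {ω | X ω ∩ A = ∅} * P.real {ω | X ω ∩ B = ∅} - P.real {ω | X ω ∩ (A ∪ B) = ∅} := by
  have hc0 : 0 ≤ c := (hK0 0 0).trans (hc 0 0)
  have hABfin : μ (A ∪ B) ≠ ∞ := measure_union_ne_top hAfin hBfin
  have hQ : ∀ {E : Set 𝔼}, MeasurableSet E → μ E ≠ ∞ → QuadFormBound (μ.restrict E) K M :=
    fun hE hEfin => quadFormBound_restrict hKm hsymm hK0 hT hM0.le hspec hE hEfin
  have hdecay : ∀ {E : Set 𝔼}, MeasurableSet E → μ E ≠ ∞ → ∀ k,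
      iterTrace (μ.restrict E) K k ≤ c * μ.real E * M ^ k := by
    intro E hE hEfin k
    have : IsFiniteMeasure (μ.restrict E) := isFiniteMeasure_restrict.mpr hEfin
    refine (iterTrace_le_mul_pow hKm hsymm hK0 hc hM0 (hQ hE hEfin)
      (fun n => ae_pi_restrict_of_ae μ E (hX.ae_posSemidef hsymm n)) k).trans ?_
    gcongr
    exact iterTrace_zero_le hc hK0 hEfin
  have hsum : ∀ {E : Set 𝔼}, MeasurableSet E → μ E ≠ ∞ →
      Summable fun k : ℕ => iterTrace (μ.restrict E) K k / (k + 1) := by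
    intro E hE hEfin
    refine Summable.of_nonneg_of_le (fun k => div_nonneg (iterTrace_nonneg hK0 k) (by positivity))
      (fun k => ?_) ((summable_geometric_of_lt_one hM0.le hM1).mul_left (c * μ.real E))
    exact (div_le_self (iterTrace_nonneg hK0 k) (by linarith [Nat.cast_nonneg (α := ℝ) k])).trans
      (hdecay hE hEfin k)
  rw [void_eq_exp hX hKm hsymm hK0 hc hAb hA hAfin hM0 hM1 (hQ hA hAfin),
    void_eq_exp hX hKm hsymm hK0 hc hBb hB hBfin hM0 hM1 (hQ hB hBfin),
    void_eq_exp hX hKm hsymm hK0 hc (hAb.union hBb) (hA.union hB) hABfin hM0 hM1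
      (hQ (hA.union hB) hABfin)]
  have hlow := exp_neg_tsum_ge hM0 hM1 (τ := iterTrace (μ.restrict (A ∪ B)) K)
    (iterTrace_nonneg hK0) (hdecay (hA.union hB) hABfin)
  rw [measureReal_union hAB hB hAfin hBfin, mul_comm c] at hlow
  set I := ∫ z, K z.1 z.2 ^ 2 ∂((μ.restrict A).prod (μ.restrict B)) with hI
  have hI0 : 0 ≤ I := integral_nonneg fun z => by positivity
  have hsA := hsum hA hAfin
  have hsB := hsum hB hBfin
  have hsAB := hsum (hA.union hB) hABfin
  set LA := ∑' k : ℕ, iterTrace (μ.restrict A) K k / (k + 1)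
  set LB := ∑' k : ℕ, iterTrace (μ.restrict B) K k / (k + 1)
  set L := ∑' k : ℕ, iterTrace (μ.restrict (A ∪ B)) K k / (k + 1)
  have hdiff : I ≤ L - LA - LB := by
    have h := (hsAB.sub hsA).sub hsB
    rw [← hsAB.tsum_sub hsA, ← (hsAB.sub hsA).tsum_sub hsB]
    -- all terms are non-negative, and the term `k = 1` is `2 I / 2`
    refine le_trans ?_ (h.le_tsum 1 fun k _ => ?_)
    · simp only [iterTrace_one_union hAB hB hAfin hBfin hKm hsymm hK0 hc, ← hI]
      refine le_of_eq ?_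
      push_cast
      ring
    · have := iterTrace_add_le_union hAB hB hAfin hBfin hKm hK0 hc k
      rw [← sub_div, ← sub_div]
      exact div_nonneg (by linarith) (by positivity)
  have hexp : Real.exp (-LA) * Real.exp (-LB) = Real.exp (-L) * Real.exp (L - LA - LB) := by
    rw [← Real.exp_add, ← Real.exp_add]
    congr 1
    ring
  calc (1 - M) ^ ((μ.real A + μ.real B) * c / M) * I ≤ Real.exp (-L) * I := by gcongr
    _ ≤ Real.exp (-L) * (Real.exp (L - LA - LB) - 1) := by
        gcongr
        have := Real.add_one_le_exp (L - LA - LB)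
        linarith
    _ = Real.exp (-LA) * Real.exp (-LB) - Real.exp (-L) := by rw [hexp]; ring

theorem le_betaCoeff [IsProbabilityMeasure P] [SigmaFinite μ] (hX : IsDPP P X μ K)
    (hKm : Measurable (Function.uncurry K)) (hsymm : ∀ x y, K x y = K y x)
    (hK0 : ∀ x y, 0 ≤ K x y) (hc : ∀ x y, K x y ≤ c)
    {T : Lp ℝ 2 μ →L[ℝ] Lp ℝ 2 μ} (hT : IsIntegralOperator μ K T)
    (hM0 : 0 < M) (hM1 : M < 1) (hspec : spectrum ℝ T ⊆ Set.Icc 0 M)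
    {A B : Set 𝔼} (hAB : Disjoint A B) (hAb : Bornology.IsBounded A) (hBb : Bornology.IsBounded B)
    (hA : MeasurableSet A) (hB : MeasurableSet B) {p q : ℝ} (hp : 0 < p) (hq : 0 < q)
    (hAp : μ A ≤ ENNReal.ofReal p) (hBq : μ B ≤ ENNReal.ofReal q) :
    ENNReal.ofReal (2 * (1 - M) ^ ((p + q) * c / M)) * kernelMass μ K A B ≤
      betaCoeff P (sigmaOn X A) (sigmaOn X B) := by
  have hAfin : μ A ≠ ∞ := (hAp.trans_lt ENNReal.ofReal_lt_top).ne
  have hBfin : μ B ≠ ∞ := (hBq.trans_lt ENNReal.ofReal_lt_top).ne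
  have hAp' : μ.real A ≤ p := ENNReal.toReal_le_of_le_ofReal hp.le hAp
  have hBq' : μ.real B ≤ q := ENNReal.toReal_le_of_le_ofReal hq.le hBq
  have hc0 : 0 ≤ c := (hK0 0 0).trans (hc 0 0)
  have hM1' : 0 < 1 - M := by linarith
  rw [kernelMass_eq_ofReal hKm hK0 hc hAfin hBfin]
  have hcov := void_covariance_ge hX hKm hsymm hK0 hc hT hM0 hM1 hspec hAB hAb hBb hA hB hAfin hBfin
  have hI : 0 ≤ ∫ z, K z.1 z.2 ^ 2 ∂((μ.restrict A).prod (μ.restrict B)) :=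
    integral_nonneg fun z => by positivity
  set I := ∫ z, K z.1 z.2 ^ 2 ∂((μ.restrict A).prod (μ.restrict B))
  have hpow : (1 - M) ^ ((p + q) * c / M) ≤ (1 - M) ^ ((μ.real A + μ.real B) * c / M) :=
    Real.rpow_le_rpow_of_exponent_ge hM1' (by linarith) (by gcongr)
  have hunion : {ω | X ω ∩ (A ∪ B) = ∅} = {ω | X ω ∩ A = ∅} ∩ {ω | X ω ∩ B = ∅} := by
    ext ω
    simp [Set.inter_union_distrib_left]
  rw [hunion] at hcov
  rw [← ENNReal.ofReal_mul (by positivity)]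
  have hmA := hX.measurable_inter hA (measurableSet_singleton_empty (d := d))
  have hmB := hX.measurable_inter hB (measurableSet_singleton_empty (d := d))
  refine le_trans (ENNReal.ofReal_le_ofReal ?_) (two_mul_abs_covariance_le_betaCoeff
    (𝒜 := sigmaOn X A) (ℬ := sigmaOn X B) (S := {ω | X ω ∩ A = ∅}) (T := {ω | X ω ∩ B = ∅})
    ⟨{∅}, measurableSet_singleton_empty, rfl⟩ ⟨{∅}, measurableSet_singleton_empty, rfl⟩ hmA hmB)
  rw [mul_assoc]
  refine mul_le_mul_of_nonneg_left ?_ zero_le_two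
  rw [abs_sub_comm]
  exact ((mul_le_mul_of_nonneg_right hpow hI).trans hcov).trans (le_abs_self _)

end LowerBound

/-! ### Admissible sets -/

section Admissible

variable {d : ℕ}

local notation "𝔼" => EuclideanSpace ℝ (Fin d)

theorem setDist_anti {A A' B B' : Set 𝔼} (hA : A' ⊆ A) (hB : B' ⊆ B) :
    setDist A B ≤ setDist A' B' :=
  le_iInf₂ fun x hx => le_iInf₂ fun y hy =>
    (iInf₂_le x (hA hx)).trans (iInf₂_le (f := fun y _ => edist x y) y (hB hy))

variable {μ : Measure (EuclideanSpace ℝ (Fin d))}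
  {K : EuclideanSpace ℝ (Fin d) → EuclideanSpace ℝ (Fin d) → ℝ} {p q r : ℝ}

theorem Admissible.disjoint {A B : Set 𝔼} (h : Admissible μ p q r A B) : Disjoint A B := by
  rw [Set.disjoint_left]
  intro x hxA hxB
  have h1 : setDist A B ≤ edist x x :=
    (iInf₂_le x hxA).trans (iInf₂_le (f := fun y _ => edist x y) x hxB)
  rw [edist_self] at h1
  exact not_lt_bot (h.dist_gt.trans_le h1)

theorem Admissible.mono {A A' B B' : Set 𝔼} (h : Admissible μ p q r A B) (hA : A' ⊆ A)
    (hB : B' ⊆ B) (hAm : MeasurableSet A') (hBm : MeasurableSet B') :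
    Admissible μ p q r A' B' where
  bounded_left := h.bounded_left.subset hA
  bounded_right := h.bounded_right.subset hB
  measurable_left := hAm
  measurable_right := hBm
  volume_left := (measure_mono hA).trans h.volume_left
  volume_right := (measure_mono hB).trans h.volume_right
  dist_gt := h.dist_gt.trans_le (setDist_anti hA hB)

/-- For a diffuse measure, a set is exhausted up to a null set by subsets of smaller measure: remove
small balls around a point all of whose neighbourhoods charge the set. -/
theorem exists_monotone_measure_lt (hμ : ∀ x, μ {x} = 0) {A : Set 𝔼} (hA : MeasurableSet A)
    (hp : 0 < p) (hAp : μ A ≤ ENNReal.ofReal p) :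
    ∃ S : ℕ → Set 𝔼, Monotone S ∧ (∀ n, MeasurableSet (S n)) ∧ (∀ n, S n ⊆ A) ∧
      (∀ n, μ (S n) < ENNReal.ofReal p) ∧ (⋃ n, S n) =ᵐ[μ] A := by
  rcases eq_or_ne (μ A) 0 with h0 | h0
  · refine ⟨fun _ => A, monotone_const, fun _ => hA, fun _ => subset_rfl, fun _ => ?_, ?_⟩
    · rw [h0]; exact ENNReal.ofReal_pos.mpr hp
    · rw [Set.iUnion_const]; exact Filter.EventuallyEq.rfl
  obtain ⟨x, -, hx⟩ := exists_mem_forall_mem_nhdsWithin_pos_measure h0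
  refine ⟨fun n => A \ Metric.closedBall x (1 / (n + 1)), fun m n hmn => ?_,
    fun n => hA.diff Metric.isClosed_closedBall.measurableSet, fun n => Set.sdiff_subset,
    fun n => ?_, ?_⟩
  · exact Set.sdiff_subset_sdiff_right (Metric.closedBall_subset_closedBall
      (one_div_le_one_div_of_le (by positivity) (by exact_mod_cast Nat.succ_le_succ hmn)))
  · have hpos : 0 < μ (A ∩ Metric.closedBall x (1 / (n + 1))) :=
      hx _ (Filter.inter_mem self_mem_nhdsWithin
        (mem_nhdsWithin_of_mem_nhds (Metric.closedBall_mem_nhds x (by positivity))))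
    have hfin : μ (A \ Metric.closedBall x (1 / (n + 1))) ≠ ∞ :=
      ((measure_mono Set.sdiff_subset).trans_lt (hAp.trans_lt ENNReal.ofReal_lt_top)).ne
    calc μ (A \ Metric.closedBall x (1 / (n + 1)))
        < μ (A \ Metric.closedBall x (1 / (n + 1))) + μ (A ∩ Metric.closedBall x (1 / (n + 1))) :=
          ENNReal.lt_add_right hfin hpos.ne'
      _ = μ A := by
          rw [add_comm]; exact measure_inter_add_sdiff A Metric.isClosed_closedBall.measurableSet
      _ ≤ ENNReal.ofReal p := hAp
  · have hU : (⋃ n : ℕ, A \ Metric.closedBall x (1 / ((n : ℝ) + 1))) = A \ {x} := by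
      ext y
      simp only [Set.mem_iUnion, Set.mem_sdiff, Metric.mem_closedBall, Set.mem_singleton_iff]
      constructor
      · rintro ⟨n, hy, hn⟩
        refine ⟨hy, ?_⟩
        rintro rfl
        exact hn (by rw [dist_self]; positivity)
      · rintro ⟨hy, hne⟩
        obtain ⟨n, hn⟩ := exists_nat_one_div_lt (dist_pos.mpr hne)
        exact ⟨n, hy, not_le.mpr hn⟩
    rw [hU]
    exact sdiff_null_ae_eq_self (hμ x)

theorem supMass_le_supMassStrict [SFinite μ] (hμ : ∀ x, μ {x} = 0) (hp : 0 < p) (hq : 0 < q) :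
    supMass μ K p q r ≤ supMassStrict μ K p q r := by
  refine iSup_le fun A => iSup_le fun B => iSup_le fun h => ?_
  obtain ⟨S, hSmono, hSm, hSA, hSp, hS⟩ :=
    exists_monotone_measure_lt hμ h.measurable_left hp h.volume_left
  obtain ⟨R, hRmono, hRm, hRB, hRq, hR⟩ :=
    exists_monotone_measure_lt hμ h.measurable_right hq h.volume_right
  have hae : (⋃ n, S n ×ˢ R n : Set (𝔼 × 𝔼)) =ᵐ[μ.prod μ] A ×ˢ B := by
    rw [Set.iUnion_prod_of_monotone hSmono hRmono]
    exact Measure.set_prod_ae_eq hS hR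
  have hdir : Directed (· ⊆ ·) fun n => (S n ×ˢ R n : Set (𝔼 × 𝔼)) :=
    (monotone_nat_of_le_succ fun n => Set.prod_mono (hSmono n.le_succ)
      (hRmono n.le_succ) : Monotone fun n => (S n ×ˢ R n : Set (𝔼 × 𝔼))).directed_le
  rw [kernelMass, ← setLIntegral_congr hae, setLIntegral_iUnion_of_directed _ hdir]
  refine iSup_le fun n => ?_
  exact le_iSup_of_le (S n) (le_iSup_of_le (R n) (le_iSup_of_le
    (h.mono (hSA n) (hRB n) (hSm n) (hRm n))
    (le_iSup_of_le (hSp n) (le_iSup_of_le (hRq n) le_rfl))))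

theorem supMassStrict_le_supMass : supMassStrict μ K p q r ≤ supMass μ K p q r :=
  iSup_mono fun _ => iSup_mono fun _ => iSup_mono fun _ => iSup_le fun _ => iSup_le fun _ => le_rfl

theorem le_supNorm (hK0 : ∀ x y, 0 ≤ K x y) (hb : ∃ C, ∀ x y, K x y ≤ C) (x y : 𝔼) :
    K x y ≤ supNorm K := by
  obtain ⟨C, hC⟩ := hb
  refine (le_abs_self _).trans (le_ciSup (f := fun z : 𝔼 × 𝔼 => |K z.1 z.2|) ⟨C, ?_⟩ (x, y))
  rintro _ ⟨z, rfl⟩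
  simpa only [abs_of_nonneg (hK0 z.1 z.2)] using hC z.1 z.2

end Admissible

end DPPMixing

theorem mainTheorem3 {d : ℕ} (μ : Measure (EuclideanSpace ℝ (Fin d))) [IsLocallyFiniteMeasure μ]
    {Ω : Type*} [MeasurableSpace Ω] (P : Measure Ω) [IsProbabilityMeasure P]
    (X : Ω → Set (EuclideanSpace ℝ (Fin d)))
    (K : EuclideanSpace ℝ (Fin d) → EuclideanSpace ℝ (Fin d) → ℝ)
    (hK_meas : Measurable (Function.uncurry K))
    (hK_symm : ∀ x y, K x y = K y x)
    (hK_nonneg : ∀ x y, 0 ≤ K x y)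
    (hK_bdd : ∃ C : ℝ, ∀ x y, K x y ≤ C)
    (T : Lp ℝ 2 μ →L[ℝ] Lp ℝ 2 μ) (hT : DPPMixing.IsIntegralOperator μ K T)
    (M : ℝ) (hM_pos : 0 < M) (hM_lt : M < 1) (hspec : spectrum ℝ T ⊆ Set.Icc 0 M)
    (hX : DPPMixing.IsDPP P X μ K)
    (p q r : ℝ) (hp : 0 < p) (hq : 0 < q) (hr : 0 < r) :
    (ENNReal.ofReal (2 * (1 - M) ^ ((p + q) * DPPMixing.supNorm K / M))
          * DPPMixing.supMass μ K p q r ≤ DPPMixing.betaMixing P X μ p q r ∧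
      DPPMixing.betaMixing P X μ p q r ≤
        ENNReal.ofReal (4 * (1 + 2 * p * DPPMixing.supNorm K) * (1 + 2 * q * DPPMixing.supNorm K)
            * Real.exp (2 * (p + q) * DPPMixing.supNorm K))
          * DPPMixing.supMass μ K p q r) ∧
    ((∀ x, μ {x} = 0) →
      ENNReal.ofReal (2 * (1 - M) ^ ((p + q) * DPPMixing.supNorm K / M))
          * DPPMixing.supMassStrict μ K p q r ≤ DPPMixing.betaMixing P X μ p q r ∧
      DPPMixing.betaMixing P X μ p q r ≤
        ENNReal.ofReal (4 * (1 + 2 * p * DPPMixing.supNorm K) * (1 + 2 * q * DPPMixing.supNorm K)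
            * Real.exp (2 * (p + q) * DPPMixing.supNorm K))
          * DPPMixing.supMassStrict μ K p q r) := by
  have hc := DPPMixing.le_supNorm hK_nonneg hK_bdd
  have hlower : ENNReal.ofReal (2 * (1 - M) ^ ((p + q) * DPPMixing.supNorm K / M)) *
      DPPMixing.supMass μ K p q r ≤ DPPMixing.betaMixing P X μ p q r := by
    simp only [DPPMixing.supMass, ENNReal.mul_iSup]
    exact iSup_mono fun A => iSup_mono fun B => iSup_mono fun h =>
      DPPMixing.le_betaCoeff hX hK_meas hK_symm hK_nonneg hc hT hM_pos hM_lt hspec h.disjoint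
        h.bounded_left h.bounded_right h.measurable_left h.measurable_right hp hq h.volume_left
        h.volume_right
  have hupper : DPPMixing.betaMixing P X μ p q r ≤
      ENNReal.ofReal (4 * (1 + 2 * p * DPPMixing.supNorm K) * (1 + 2 * q * DPPMixing.supNorm K)
          * Real.exp (2 * (p + q) * DPPMixing.supNorm K)) * DPPMixing.supMass μ K p q r := by
    simp only [DPPMixing.supMass, ENNReal.mul_iSup]
    exact iSup_mono fun A => iSup_mono fun B => iSup_mono fun h =>
      DPPMixing.betaCoeff_le hX hK_meas hK_symm hK_nonneg hc h.disjoint h.bounded_left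
        h.bounded_right h.measurable_left h.measurable_right hp hq h.volume_left h.volume_right
  refine ⟨⟨hlower, hupper⟩, fun hμ => ?_⟩
  rw [(DPPMixing.supMassStrict_le_supMass (K := K) (r := r)).antisymm
    (DPPMixing.supMass_le_supMassStrict hμ hp hq)]
  exact ⟨hlower, hupper⟩
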